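/- Let $A_1,\dots,A_N$ be non-singular real $2\times 2$ matrices with $\|A_i\|<1$ (Euclidean operator norm), let $t_1,\dots,t_N\in\mathbb{R}^2$, and let $f_i(x)=A_ix+t_i$. Let $(p_1,\dots,p_N)$ be a probability vector, let $\nu$ and $\widehat\nu$ be the corresponding Bernoulli measures on $\{1,\dots,N\}^{\mathbb{N}}$ and on $\Sigma=\{1,\dots,N\}^{\mathbb{Z}}$, and let $\mu=\nu\circ\pi_+^{-1}$ be the self-affine measure, where $\pi_+(i_0,i_1,\dots)=\lim_{n\to\infty}f_{i_0}\circ\cdots\circ f_{i_n}(0)$. Assume: 1. (Dominated splitting) There are $C,\delta>0$ such that $\alpha_1(A_{i_1}\cdots A_{i_n})/\alpha_2(A_{i_1}\cdots A_{i_n})\ge Ce^{\delta n}$ for all finite words $(i_1,\dots,i_n)$, where $\alpha_1\ge\alpha_2$ denote the singular values. 2. (Strong separation) There is a non-empty bounded open set $\mathcal{O}\subset\mathbb{R}^2$ such that $f_i(\overline{\mathcal{O}})\subseteq\mathcal{O}$ for all $i$ and $f_i(\overline{\mathcal{O}})\cap f_j(\overline{\mathcal{O}})=\emptyset$ for all $i\ne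 j$. For $\mathbf{j}\in\Sigma$ put $A^{(n)}(\mathbf{j})=A_{j_{n-1}}\cdots A_{j_0}$, and let $\sigma$ be the left shift on $\Sigma$. For a measure $m$, let $\dim_H m=\inf\{\dim_H S: m(S^c)=0\}$. Then $\mu$ is exact dimensional: for $\mu$-almost every $x$, $\lim_{r\to0+}\log\mu(B_r(x))/\log r$ exists and equals $\dim_H\mu$. Moreover, there are families $e_s(\mathbf{j}),e_{ss}(\mathbf{j})$, $\mathbf{j}\in\Sigma$, of one-dimensional subspaces of $\mathbb{R}^2$ such that $$A_{j_0}e_s(\mathbf{j})=e_s(\sigma\mathbf{j}),\quad A_{j_0}e_{ss}(\mathbf{j})=e_{ss}(\sigma\mathbf{j}),\quad \frac{\|A^{(n)}(\mathbf{j})|e_s(\mathbf{j})\|}{\|A^{(n)}(\mathbf{j})|e_{ss}(\mathbf{j})\|}\ge C'e^{\delta' n}\quad(\mathbf{j}\in\Sigma,\ n\ge1)$$ for some constants $C',\delta'>0$, and for all such families the following holds. There are constants $0<\chi_s<\chi_{ss}$ (the Lyapunov exponents) with $$\chi_s=-\lim_{n\to\infty}\tfrac1n\log\|A^{(n)}(\mathbf{j})|e_s(\mathbf{j})\|,\qquad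 \chi_{ss}=-\lim_{n\to\infty}\tfrac1n\log\|A^{(n)}(\mathbf{j})|e_{ss}(\mathbf{j})\|\qquad\text{for }\widehat\nu\text{-a.e. }\mathbf{j},$$ and for $\nu$-almost every $\mathbf{i}$ and every $\mathbf{j}\in\Sigma$ with $j_n=i_n$ for all $n\ge0$, $$\dim_H\mu=\frac{h_\nu}{\chi_{ss}}+\left(1-\frac{\chi_s}{\chi_{ss}}\right)\dim_H\mu^T_{\mathbf{i}},$$ where $h_\nu=-\sum_i p_i\log p_i$ (with $0\log 0=0$) and $\mu^T_{\mathbf{i}}$ is the image of $\mu$ under the orthogonal projection of $\mathbb{R}^2$ onto the orthogonal complement of $e_{ss}(\mathbf{j})$. -/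

import Mathlib

open MeasureTheory Filter Topology
open scoped ENNReal

noncomputable section

namespace SelfAffine

/-- The Euclidean plane. -/
abbrev Plane : Type := EuclideanSpace ℝ (Fin 2)

/-- A `2 × 2` matrix acting on the Euclidean plane; its norm is the operator norm induced by the
Euclidean norm. -/
abbrev act (M : Matrix (Fin 2) (Fin 2) ℝ) : Plane →L[ℝ] Plane :=
  Matrix.toEuclideanCLM (n := Fin 2) (𝕜 := ℝ) M

/-- The larger singular value of a matrix. -/
def alpha₁ (M : Matrix (Fin 2) (Fin 2) ℝ) : ℝ :=
  LinearMap.singularValues (act M : Plane →ₗ[ℝ] Plane) 0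

/-- The smaller singular value of a matrix. -/
def alpha₂ (M : Matrix (Fin 2) (Fin 2) ℝ) : ℝ :=
  LinearMap.singularValues (act M : Plane →ₗ[ℝ] Plane) 1

/-! ### Hausdorff dimension of measures and exact dimensionality -/

section Dimension

variable {X : Type*} [MetricSpace X] [MeasurableSpace X]

/-- The Hausdorff dimension of a measure: `inf {dim_H S : μ(Sᶜ) = 0}`. -/
def dimHMeasure (μ : Measure X) : ℝ≥0∞ :=
  ⨅ (S : Set X) (_ : μ Sᶜ = 0), dimH S

/-- `μ` is exact dimensional: at `μ`-almost every point the local dimension exists (as a limit)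
and equals the Hausdorff dimension of `μ`. -/
def IsExactDimensional (μ : Measure X) : Prop :=
  dimHMeasure μ ≠ ∞ ∧
    ∀ᵐ x ∂μ, Tendsto (fun r : ℝ => Real.log (μ.real (Metric.closedBall x r)) / Real.log r)
      (𝓝[>] 0) (𝓝 (dimHMeasure μ).toReal)

end Dimension

/-! ### Affine iterated function systems on the plane -/

section IFS

variable {N : ℕ}

/-- The affine map `f_i(x) = A_i x + t_i`. -/
def affMap (A : Fin N → Matrix (Fin 2) (Fin 2) ℝ) (t : Fin N → Plane) (i : Fin N) (x : Plane) :
    Plane :=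
  act (A i) x + t i

/-- The strong separation condition. -/
def StrongSeparation (A : Fin N → Matrix (Fin 2) (Fin 2) ℝ) (t : Fin N → Plane) : Prop :=
  ∃ O : Set Plane, IsOpen O ∧ O.Nonempty ∧ Bornology.IsBounded O ∧
    (∀ i, affMap A t i '' closure O ⊆ O) ∧
    ∀ i j, i ≠ j → Disjoint (affMap A t i '' closure O) (affMap A t j '' closure O)

/-- The dominated splitting condition: there are `C, δ > 0` such that
`α₁(A_w) / α₂(A_w) ≥ C e^{δ n}` for every finite word `w` of length `n`, where
`A_w = A_{w_1} ⋯ A_{w_n}`. -/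
def DominatedSplitting (A : Fin N → Matrix (Fin 2) (Fin 2) ℝ) : Prop :=
  ∃ C δ : ℝ, 0 < C ∧ 0 < δ ∧ ∀ w : List (Fin N),
    C * Real.exp (δ * w.length) ≤ alpha₁ (w.map A).prod / alpha₂ (w.map A).prod

/-- The composition `f_{i_0} ∘ ⋯ ∘ f_{i_{n-1}}`. -/
def prefixMap (A : Fin N → Matrix (Fin 2) (Fin 2) ℝ) (t : Fin N → Plane) (i : ℕ → Fin N) :
    ℕ → Plane → Plane
  | 0 => id
  | n + 1 => prefixMap A t i n ∘ affMap A t (i n)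

/-- The natural projection `π₊(i) = lim_n f_{i_0} ∘ ⋯ ∘ f_{i_n}(0)`. -/
def natProj (A : Fin N → Matrix (Fin 2) (Fin 2) ℝ) (t : Fin N → Plane) (i : ℕ → Fin N) : Plane :=
  limUnder atTop (fun n => prefixMap A t i n 0)

/-- The measure on the symbols `1, …, N` with weights `p`. -/
def symbolMeasure (p : Fin N → ℝ) : Measure (Fin N) :=
  ∑ i, ENNReal.ofReal (p i) • Measure.dirac i

/-- The Bernoulli measure `ν` on one-sided infinite words. -/
def bernoulliMeasure (p : Fin N → ℝ) : Measure (ℕ → Fin N) :=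
  Measure.infinitePi (fun _ : ℕ => symbolMeasure p)

/-- The natural extension of the Bernoulli measure to two-sided infinite words. -/
def bernoulliTwoSided (p : Fin N → ℝ) : Measure (ℤ → Fin N) :=
  Measure.infinitePi (fun _ : ℤ => symbolMeasure p)

/-- The self-affine measure `μ = ν ∘ π₊⁻¹`. -/
def selfAffineMeasure (A : Fin N → Matrix (Fin 2) (Fin 2) ℝ) (t : Fin N → Plane)
    (p : Fin N → ℝ) : Measure Plane :=
  (bernoulliMeasure p).map (natProj A t)

/-- The entropy `h_ν = -∑ p_i log p_i` of the Bernoulli measure (with `0 log 0 = 0`). -/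
def entropy (p : Fin N → ℝ) : ℝ := ∑ i, Real.negMulLog (p i)

/-! ### Stable directions, Lyapunov exponents and transversal measures -/

/-- The left shift on two-sided infinite words. -/
def shift (j : ℤ → Fin N) : ℤ → Fin N := fun n => j (n + 1)

/-- The product `A^{(n)}(j) = A_{j_{n-1}} ⋯ A_{j_1} A_{j_0}`. -/
def cocycle (A : Fin N → Matrix (Fin 2) (Fin 2) ℝ) (j : ℤ → Fin N) :
    ℕ → Matrix (Fin 2) (Fin 2) ℝ
  | 0 => 1
  | n + 1 => A (j n) * cocycle A j n

/-- The norm `‖M | L‖` of the restriction of `M` to the subspace `L`. -/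
def restrictNorm (M : Matrix (Fin 2) (Fin 2) ℝ) (L : Submodule ℝ Plane) : ℝ :=
  ‖(act M).comp L.subtypeL‖

/-- `es`, `ess` are the stable and the strong stable directions of the matrices `A`: families of
one-dimensional subspaces indexed by two-sided words that are invariant under the cocycle, and
for which the restriction to `es` uniformly exponentially dominates the restriction to `ess`. -/
structure IsSplitting (A : Fin N → Matrix (Fin 2) (Fin 2) ℝ)
    (es ess : (ℤ → Fin N) → Submodule ℝ Plane) : Prop where
  finrank_s : ∀ j, Module.finrank ℝ (es j) = 1
  finrank_ss : ∀ j, Module.finrank ℝ (ess j) = 1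
  map_s : ∀ j, (es j).map (act (A (j 0)) : Plane →ₗ[ℝ] Plane) = es (shift j)
  map_ss : ∀ j, (ess j).map (act (A (j 0)) : Plane →ₗ[ℝ] Plane) = ess (shift j)
  dominated : ∃ C δ : ℝ, 0 < C ∧ 0 < δ ∧ ∀ (j : ℤ → Fin N) (n : ℕ), 1 ≤ n →
    C * Real.exp (δ * n) ≤
      restrictNorm (cocycle A j n) (es j) / restrictNorm (cocycle A j n) (ess j)

/-- `χ` is the Lyapunov exponent along the family of directions `e`:
`χ = -lim_n (1/n) log ‖A^{(n)}(j) | e(j)‖` for almost every two-sided word `j`. -/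
def IsLyapunovExponent (A : Fin N → Matrix (Fin 2) (Fin 2) ℝ) (p : Fin N → ℝ)
    (e : (ℤ → Fin N) → Submodule ℝ Plane) (χ : ℝ) : Prop :=
  ∀ᵐ j ∂(bernoulliTwoSided p),
    Tendsto (fun n : ℕ => -(1 / (n : ℝ)) * Real.log (restrictNorm (cocycle A j n) (e j)))
      atTop (𝓝 χ)

/-- The transversal measure: the image of `μ` under the orthogonal projection of the plane onto
the orthogonal complement of `L`. It is regarded as a measure on the plane carried by `Lᗮ`. -/
def transversalMeasure (μ : Measure Plane) (L : Submodule ℝ Plane) : Measure Plane :=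
  μ.map (Lᗮ.starProjection)

end IFS

end SelfAffine

end

open SelfAffine

/-! A two-sided word j splits into its past, which codes a point x of the attractor, and its future,
which determines the strong stable line spanned by u(j). Write s_n and t_n for the contraction of
the product along the first n symbols of the past (`cocycle A (shiftBy (-n) j) n`), respectively
along and transversally to the strong stable line. By strong separation a ball at x of radius
comparable to s_n meets only the n-cylinder of x. Pulled back by the product, it becomes a strip of
half-width about s_n / t_n around the point coded by `shiftBy (-n) j`, in the direction of `u
(shiftBy (-n) j)`. Hence the mass of the ball is, up to constants in the radius, the weight of the
cylinder times the mass of this strip (`exists_measure_closedBall_le`,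
`exists_le_measure_closedBall`).

Strip masses are computed by telescoping. The part of a strip in the first-level cylinder of its
centre is an exact copy of a strip for the shifted word (`stripPart_succ`), so minus the log of a
strip mass is an orbit sum of symbol informations and logarithms of `stripRatio`
(`neg_log_stripMass`). For a fixed future all strips are parallel, and the ratios are quotients of
projected measures on intervals. They converge by Besicovitch differentiation
(`ae_future_tendsto_stripRatio`), and their logarithms have an integrable envelope by a maximal
inequality (`exists_ratio_tail_future`, `exists_envelope`). Maker's theorem
(`ae_tendsto_sum_abs_sub_div`) then gives a number β such that a strip reached by going from depth n
to depth m has mass exp(-(m - n)β + o(m)), uniformly in n ≤ m (`exists_stripAsymptotics`).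

Taking n = 0 shows that almost every transversal measure has local dimension β / χ_s
(`hasLocalDim_transversal`). Choosing m with t_m about s_n, so that m χ_s is about n χ_ss, gives the
ball the mass exp(-(n h + (m - n)β)) at radius exp(-n χ_ss). Dividing yields h / χ_ss + (1 - χ_s /
χ_ss) β / χ_s (`tendsto_div_of_two_scales`, `hasLocalDim_codedMeasure`). An almost surely constant
local dimension is the Hausdorff dimension (`dimHMeasure_eq_of_hasLocalDim`).

The splitting consists of the line contracted by the products of the future and the line contracted
by the inverse products of the past. Both are limits of most contracted vectors
(`exists_contracted`). Their angle is bounded below because otherwise a product across the origin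
would violate domination (`exists_transversality`). -/

noncomputable section

namespace SelfAffine

/-! ### Planar linear algebra -/

/-- The planar cross product `x₀ y₁ - x₁ y₀`. -/
def cross (x y : Plane) : ℝ := x 0 * y 1 - x 1 * y 0

lemma norm_sq_plane (x : Plane) : ‖x‖ ^ 2 = x 0 ^ 2 + x 1 ^ 2 := by
  rw [EuclideanSpace.norm_sq_eq, Fin.sum_univ_two]; simp

lemma inner_plane (x y : Plane) : inner ℝ x y = x 0 * y 0 + x 1 * y 1 := by
  simp [PiLp.inner_apply, Fin.sum_univ_two, mul_comm]

lemma act_apply_zero (M : Matrix (Fin 2) (Fin 2) ℝ) (x : Plane) :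
    act M x 0 = M 0 0 * x 0 + M 0 1 * x 1 := by
  simp [act, Matrix.mulVec, dotProduct, Fin.sum_univ_two]

lemma act_apply_one (M : Matrix (Fin 2) (Fin 2) ℝ) (x : Plane) :
    act M x 1 = M 1 0 * x 0 + M 1 1 * x 1 := by
  simp [act, Matrix.mulVec, dotProduct, Fin.sum_univ_two]

lemma act_mul (M M' : Matrix (Fin 2) (Fin 2) ℝ) : act (M * M') = act M * act M' := map_mul _ _ _

lemma act_mul_apply (M M' : Matrix (Fin 2) (Fin 2) ℝ) (x : Plane) :
    act (M * M') x = act M (act M' x) := by rw [act_mul]; rfl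

lemma act_one : act 1 = 1 := map_one _

lemma act_one_apply (x : Plane) : act 1 x = x := by rw [act_one]; rfl

lemma norm_act_mul_le (M M' : Matrix (Fin 2) (Fin 2) ℝ) :
    ‖act (M * M')‖ ≤ ‖act M‖ * ‖act M'‖ := by rw [act_mul]; exact norm_mul_le _ _

lemma act_inv_act {M : Matrix (Fin 2) (Fin 2) ℝ} (h : M.det ≠ 0) (x : Plane) :
    act M⁻¹ (act M x) = x := by
  rw [← act_mul_apply, Matrix.nonsing_inv_mul _ (isUnit_iff_ne_zero.2 h), act_one_apply]

lemma act_act_inv {M : Matrix (Fin 2) (Fin 2) ℝ} (h : M.det ≠ 0) (x : Plane) :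
    act M (act M⁻¹ x) = x := by
  rw [← act_mul_apply, Matrix.mul_nonsing_inv _ (isUnit_iff_ne_zero.2 h), act_one_apply]

lemma act_ne_zero {M : Matrix (Fin 2) (Fin 2) ℝ} (h : M.det ≠ 0) {x : Plane} (hx : x ≠ 0) :
    act M x ≠ 0 := by
  intro h0
  apply hx
  rw [← act_inv_act h x, h0, map_zero]

lemma cross_sub_left (x y z : Plane) : cross (x - y) z = cross x z - cross y z := by
  simp [cross]; ring

lemma cross_smul_left (c : ℝ) (x y : Plane) : cross (c • x) y = c * cross x y := by
  simp [cross]; ring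

lemma cross_smul_right (c : ℝ) (x y : Plane) : cross x (c • y) = c * cross x y := by
  simp [cross]; ring

lemma cross_self (x : Plane) : cross x x = 0 := by simp [cross]; ring

lemma cross_swap (x y : Plane) : cross x y = -cross y x := by simp [cross]; ring

lemma abs_cross_comm (x y : Plane) : |cross x y| = |cross y x| := by rw [cross_swap, abs_neg]

lemma cross_act (M : Matrix (Fin 2) (Fin 2) ℝ) (x y : Plane) :
    cross (act M x) (act M y) = M.det * cross x y := by
  simp only [cross, act_apply_zero, act_apply_one, Matrix.det_fin_two]; ring

lemma cross_sq_add_inner_sq (x y : Plane) :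
    cross x y ^ 2 + (inner ℝ x y) ^ 2 = ‖x‖ ^ 2 * ‖y‖ ^ 2 := by
  rw [inner_plane, norm_sq_plane, norm_sq_plane, cross]; ring

lemma abs_cross_le (x y : Plane) : |cross x y| ≤ ‖x‖ * ‖y‖ := by
  apply abs_le_of_sq_le_sq _ (by positivity)
  nlinarith [cross_sq_add_inner_sq x y, sq_nonneg (inner ℝ x y : ℝ)]

lemma det_mul_cross_le (M : Matrix (Fin 2) (Fin 2) ℝ) (x y : Plane) :
    |M.det| * |cross x y| ≤ ‖act M x‖ * ‖act M y‖ := by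
  rw [← abs_mul, ← cross_act]; exact abs_cross_le _ _

/-- Rotation by a right angle. -/
def perp (x : Plane) : Plane := !₂[-x 1, x 0]

lemma norm_perp (x : Plane) : ‖perp x‖ = ‖x‖ := by
  rw [← sq_eq_sq₀ (norm_nonneg _) (norm_nonneg _), norm_sq_plane, norm_sq_plane]
  simp [perp]; ring

lemma cross_perp (x : Plane) : cross x (perp x) = ‖x‖ ^ 2 := by
  rw [norm_sq_plane]; simp [cross, perp]; ring

/-- Pairing x with its rotation by a right angle turns the area bound `det_mul_cross_le` into the
fact that the smaller singular value is at least |det M| / ‖M‖. -/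
lemma det_mul_norm_le (M : Matrix (Fin 2) (Fin 2) ℝ) (x : Plane) :
    |M.det| * ‖x‖ ≤ ‖act M‖ * ‖act M x‖ := by
  rcases (norm_nonneg x).eq_or_lt with h | h
  · rw [← h, mul_zero]; exact mul_nonneg (norm_nonneg _) (norm_nonneg _)
  have h1 := det_mul_cross_le M x (perp x)
  rw [cross_perp, abs_of_nonneg (sq_nonneg ‖x‖)] at h1
  have h2 := (act M).le_opNorm (perp x)
  rw [norm_perp] at h2
  have h3 : ‖act M x‖ * ‖act M (perp x)‖ ≤ ‖act M x‖ * (‖act M‖ * ‖x‖) := by gcongr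
  have h4 : (|M.det| * ‖x‖) * ‖x‖ ≤ (‖act M‖ * ‖act M x‖) * ‖x‖ := by nlinarith
  exact le_of_mul_le_mul_right h4 h

lemma abs_det_le (M : Matrix (Fin 2) (Fin 2) ℝ) : |M.det| ≤ ‖act M‖ ^ 2 := by
  have h := det_mul_norm_le M (EuclideanSpace.single 0 1)
  have h2 := (act M).le_opNorm (EuclideanSpace.single (0 : Fin 2) (1 : ℝ))
  simp only [PiLp.norm_single, norm_one, mul_one] at h h2
  nlinarith [norm_nonneg (act M)]

lemma norm_act_pos {M : Matrix (Fin 2) (Fin 2) ℝ} (h : M.det ≠ 0) : 0 < ‖act M‖ := by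
  have := abs_det_le M
  have h2 := abs_pos.2 h
  rcases (norm_nonneg (act M)).eq_or_lt with h3 | h3
  · rw [← h3] at this; norm_num at this; exact absurd this h
  · exact h3

lemma norm_act_inv {M : Matrix (Fin 2) (Fin 2) ℝ} (h : M.det ≠ 0) :
    ‖act M⁻¹‖ = ‖act M‖ / |M.det| := by
  have key : ∀ M : Matrix (Fin 2) (Fin 2) ℝ, M.det ≠ 0 → ‖act M⁻¹‖ ≤ ‖act M‖ / |M.det| := by
    intro M h
    refine ContinuousLinearMap.opNorm_le_bound _ (by positivity) fun x => ?_
    have := det_mul_norm_le M (act M⁻¹ x)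
    rw [act_act_inv h] at this
    rw [div_mul_eq_mul_div, le_div_iff₀ (abs_pos.2 h)]
    linarith
  refine le_antisymm (key M h) ?_
  have h' : M⁻¹.det ≠ 0 := by rw [Matrix.det_nonsing_inv]; simpa using h
  have := key _ h'
  rw [Matrix.nonsing_inv_nonsing_inv _ (isUnit_iff_ne_zero.2 h), Matrix.det_nonsing_inv,
    Ring.inverse_eq_inv', abs_inv, div_inv_eq_mul] at this
  rwa [div_le_iff₀ (abs_pos.2 h)]

/-- For unit vectors the cross product is the sine of the angle, and the addition formula for the
sine applies. Thus |cross| serves as a sign-free distance between directions. -/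
lemma abs_cross_triangle {x y z : Plane} (hx : ‖x‖ = 1) (hy : ‖y‖ = 1) (hz : ‖z‖ = 1) :
    |cross x z| ≤ |cross x y| + |cross y z| := by
  have h : cross x z = cross x y * inner ℝ y z + inner ℝ x y * cross y z := by
    have : cross x z = cross x z * ‖y‖ ^ 2 := by rw [hy]; ring
    rw [this, norm_sq_plane, inner_plane, inner_plane]; simp only [cross]; ring
  have h1 : |(inner ℝ y z : ℝ)| ≤ 1 := by simpa [hy, hz] using abs_real_inner_le_norm y z
  have h2 : |(inner ℝ x y : ℝ)| ≤ 1 := by simpa [hx, hy] using abs_real_inner_le_norm x y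
  rw [h]
  refine (abs_add_le _ _).trans ?_
  rw [abs_mul, abs_mul]
  nlinarith [abs_nonneg (cross x y), abs_nonneg (cross y z)]

/-- Cramer's rule: the expansion of x in the basis v, u. -/
lemma cross_smul_eq (x v u : Plane) : cross v u • x = cross x u • v - cross x v • u := by
  ext i; fin_cases i <;> simp [cross] <;> ring_nf

/-- By Cramer's rule a matrix is controlled by its values on two independent unit vectors, at the
price of the sine of their angle. -/
lemma norm_act_mul_cross_le (M : Matrix (Fin 2) (Fin 2) ℝ) {v u : Plane} (hv : ‖v‖ = 1)
    (hu : ‖u‖ = 1) : ‖act M‖ * |cross v u| ≤ ‖act M v‖ + ‖act M u‖ := by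
  rcases (abs_nonneg (cross v u)).eq_or_lt with h | h
  · rw [← h]; simp; positivity
  rw [← le_div_iff₀ h]
  refine ContinuousLinearMap.opNorm_le_bound _ (by positivity) fun x => ?_
  rw [div_mul_eq_mul_div, le_div_iff₀ h]
  have h1 : ‖act M x‖ * |cross v u| = ‖cross x u • act M v - cross x v • act M u‖ := by
    rw [← map_smul, ← map_smul, ← map_sub, ← cross_smul_eq, map_smul, norm_smul, Real.norm_eq_abs]
    ring
  have h2 := abs_cross_le x u
  have h3 := abs_cross_le x v
  rw [hu, mul_one] at h2
  rw [hv, mul_one] at h3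
  rw [h1]
  refine (norm_sub_le _ _).trans ?_
  rw [norm_smul, norm_smul, Real.norm_eq_abs, Real.norm_eq_abs]
  nlinarith [norm_nonneg (act M v), norm_nonneg (act M u)]

lemma eq_inner_smul_add (x : Plane) {u : Plane} (hu : ‖u‖ = 1) :
    x = (inner ℝ u x : ℝ) • u + cross u x • perp u := by
  have h : u 0 ^ 2 + u 1 ^ 2 = 1 := by rw [← norm_sq_plane, hu]; norm_num
  ext i
  fin_cases i
  · simp [inner_plane, cross, perp]; linear_combination -(x 0) * h
  · simp [inner_plane, cross, perp]; linear_combination -(x 1) * h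

/-- The component of x orthogonal to u has length |cross x u|. A vector close to a contracted
direction is therefore contracted as well. -/
lemma norm_act_le_of_unit (M : Matrix (Fin 2) (Fin 2) ℝ) (x : Plane) {u : Plane} (hu : ‖u‖ = 1) :
    ‖act M x‖ ≤ ‖x‖ * ‖act M u‖ + |cross x u| * ‖act M‖ := by
  conv_lhs => rw [eq_inner_smul_add x hu]
  rw [map_add, map_smul, map_smul]
  refine (norm_add_le _ _).trans ?_
  rw [norm_smul, norm_smul, Real.norm_eq_abs, Real.norm_eq_abs, abs_cross_comm u x]
  have h1 := abs_real_inner_le_norm u x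
  have h2 := (act M).le_opNorm (perp u)
  rw [norm_perp, hu, mul_one] at h2
  rw [hu, one_mul] at h1
  gcongr

lemma exists_norm_act_eq (M : Matrix (Fin 2) (Fin 2) ℝ) : ∃ v : Plane, ‖v‖ = 1 ∧
    ∀ x : Plane, ‖act M x‖ ≤ ‖act M v‖ * ‖x‖ := by
  obtain ⟨v, hv, hmax⟩ := (isCompact_sphere (0 : Plane) 1).exists_isMaxOn
    (NormedSpace.sphere_nonempty.2 zero_le_one)
    (f := fun x => ‖act M x‖) (by fun_prop)
  refine ⟨v, by simpa using hv, fun x => ?_⟩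
  rcases eq_or_ne x 0 with rfl | hx
  · simp
  have h := hmax (show ‖x‖⁻¹ • x ∈ Metric.sphere (0 : Plane) 1 by
    simp [norm_smul, inv_mul_cancel₀ (norm_ne_zero_iff.2 hx)])
  simp only [Set.mem_ofPred_eq, map_smul, norm_smul, norm_inv, norm_norm] at h
  rwa [inv_mul_le_iff₀ (norm_pos_iff.2 hx), mul_comm] at h

/-- A most contracted unit vector. -/
lemma exists_norm_mul_eq_det (M : Matrix (Fin 2) (Fin 2) ℝ) : ∃ u : Plane, ‖u‖ = 1 ∧
    ‖act M‖ * ‖act M u‖ = |M.det| := by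
  obtain ⟨v, hv, hmax⟩ := exists_norm_act_eq M
  have hn : ‖act M‖ = ‖act M v‖ := by
    refine le_antisymm (ContinuousLinearMap.opNorm_le_bound _ (norm_nonneg _) hmax) ?_
    simpa [hv] using (act M).le_opNorm v
  refine ⟨perp v, by rw [norm_perp, hv], ?_⟩
  set a := act M v
  set b := act M (perp v)
  -- First variation: were the images of v and its rotation not orthogonal, tilting v slightly would
  -- lengthen its image beyond the maximum.
  have horth : (inner ℝ a b : ℝ) = 0 := by
    have hτ : ∀ τ : ℝ, 2 * τ * inner ℝ a b + τ ^ 2 * ‖b‖ ^ 2 ≤ τ ^ 2 * ‖a‖ ^ 2 := by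
      intro τ
      have h := hmax (v + τ • perp v)
      have h2 := pow_le_pow_left₀ (norm_nonneg _) h 2
      have h3 : ‖v + τ • perp v‖ ^ 2 = 1 + τ ^ 2 := by
        have hv2 : v 0 ^ 2 + v 1 ^ 2 = 1 := by rw [← norm_sq_plane, hv]; norm_num
        rw [norm_sq_plane]; simp [perp]; linear_combination (1 + τ ^ 2) * hv2
      have h4 : ‖act M (v + τ • perp v)‖ ^ 2 = ‖a‖ ^ 2 + 2 * τ * inner ℝ a b + τ ^ 2 * ‖b‖ ^ 2 := by
        rw [map_add, map_smul, norm_add_sq_real, norm_smul, mul_pow, inner_smul_right,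
          Real.norm_eq_abs, sq_abs]; ring
      rw [mul_pow, h3, h4] at h2
      linarith
    by_contra hne
    set c : ℝ := inner ℝ a b
    set K := ‖a‖ ^ 2 + ‖b‖ ^ 2 + 1
    have hK : 0 < K := by positivity
    -- K exceeds ‖a‖² - ‖b‖², so at τ = c / K the quadratic term is at most half of the linear one.
    have h := hτ (c / K)
    have h5 : 2 * c ^ 2 / K ≤ c ^ 2 / K ^ 2 * (‖a‖ ^ 2 - ‖b‖ ^ 2) := by
      have e1 : 2 * c ^ 2 / K = 2 * (c / K) * c := by ring
      have e2 : c ^ 2 / K ^ 2 = (c / K) ^ 2 := (div_pow c K 2).symm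
      rw [e1, e2]; linarith
    have h6 : c ^ 2 / K ^ 2 * (‖a‖ ^ 2 - ‖b‖ ^ 2) ≤ c ^ 2 / K ^ 2 * K := by
      gcongr
      simp only [K]
      nlinarith [sq_nonneg ‖b‖]
    have h7 : c ^ 2 / K ^ 2 * K = c ^ 2 / K := by field_simp
    have h8 : 0 < c ^ 2 / K := by positivity
    have h9 : 2 * c ^ 2 / K = 2 * (c ^ 2 / K) := by ring
    linarith
  have h1 := cross_sq_add_inner_sq a b
  rw [horth, cross_act, cross_perp, hv] at h1
  rw [hn, ← abs_of_nonneg (mul_nonneg (norm_nonneg a) (norm_nonneg b))]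
  rw [← sq_eq_sq_iff_abs_eq_abs]
  nlinarith

/-- Eigenvectors of the adjoint composed with M realise both singular values, which then compare
with ‖M‖ and |det M| / ‖M‖. Only this inequality is needed to transfer the domination hypothesis to
`singRatio`. -/
lemma alpha_ratio_le {M : Matrix (Fin 2) (Fin 2) ℝ} (h : M.det ≠ 0) :
    alpha₁ M / alpha₂ M ≤ ‖act M‖ ^ 2 / |M.det| := by
  have key : ∀ n : ℕ, n < 2 → ∃ v : Plane, v ≠ 0 ∧
      ‖act M v‖ = LinearMap.singularValues (act M : Plane →ₗ[ℝ] Plane) n * ‖v‖ := by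
    intro n hn
    have hn' : n < Module.finrank ℝ Plane := by simpa using hn
    obtain ⟨v, hv⟩ := (LinearMap.hasEigenvalue_adjoint_comp_self_sq_singularValues
      (act M : Plane →ₗ[ℝ] Plane) hn').exists_hasEigenvector
    refine ⟨v, hv.2, ?_⟩
    have h1 := hv.apply_eq_smul
    have h2 : (inner ℝ ((LinearMap.adjoint (act M : Plane →ₗ[ℝ] Plane)) (act M v)) v : ℝ)
        = ‖act M v‖ ^ 2 := by
      rw [LinearMap.adjoint_inner_left]; simp
    rw [← sq_eq_sq₀ (norm_nonneg _) (mul_nonneg (LinearMap.singularValues_nonneg _ _)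
      (norm_nonneg _)), ← h2]
    have h3 : (LinearMap.adjoint (act M : Plane →ₗ[ℝ] Plane)) (act M v) =
      (LinearMap.singularValues (act M : Plane →ₗ[ℝ] Plane) n ^ 2 : ℝ) • v := h1
    rw [h3, real_inner_smul_left, real_inner_self_eq_norm_sq]; ring
  obtain ⟨v, hv, hv1⟩ := key 0 (by norm_num)
  obtain ⟨w, hw, hw1⟩ := key 1 (by norm_num)
  change _ = alpha₁ M * _ at hv1
  change _ = alpha₂ M * _ at hw1
  have hv0 := norm_pos_iff.2 hv
  have hw0 := norm_pos_iff.2 hw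
  have hd := abs_pos.2 h
  have hM := norm_act_pos h
  have h1 : alpha₁ M ≤ ‖act M‖ := by
    have := (act M).le_opNorm v
    rw [hv1] at this
    exact le_of_mul_le_mul_right this hv0
  have h2 : |M.det| / ‖act M‖ ≤ alpha₂ M := by
    have := det_mul_norm_le M w
    rw [hw1, ← mul_assoc] at this
    rw [div_le_iff₀ hM, mul_comm]
    exact le_of_mul_le_mul_right this hw0
  have h3 : (0 : ℝ) ≤ alpha₁ M := LinearMap.singularValues_nonneg _ _
  calc alpha₁ M / alpha₂ M ≤ ‖act M‖ / (|M.det| / ‖act M‖) := by gcongr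
    _ = _ := by field_simp

/-! ### Lines in the plane -/

lemma exists_unit_span {L : Submodule ℝ Plane} (h : Module.finrank ℝ L = 1) :
    ∃ u : Plane, ‖u‖ = 1 ∧ L = Submodule.span ℝ {u} := by
  obtain ⟨v, hv, hspan⟩ := finrank_eq_one_iff'.1 h
  have hv' : (v : Plane) ≠ 0 := by simpa using hv
  refine ⟨‖(v : Plane)‖⁻¹ • (v : Plane), ?_, ?_⟩
  · rw [norm_smul, norm_inv, norm_norm, inv_mul_cancel₀ (norm_ne_zero_iff.2 hv')]
  · rw [Submodule.span_singleton_smul_eq (isUnit_iff_ne_zero.2 (by simpa using hv))]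
    refine le_antisymm (fun w hw => ?_) ?_
    · obtain ⟨c, hc⟩ := hspan ⟨w, hw⟩
      exact Submodule.mem_span_singleton.2 ⟨c, by simpa using congrArg Subtype.val hc⟩
    · rw [Submodule.span_singleton_le_iff_mem]; exact v.2

lemma restrictNorm_span (M : Matrix (Fin 2) (Fin 2) ℝ) {u : Plane} (hu : ‖u‖ = 1) :
    restrictNorm M (Submodule.span ℝ {u}) = ‖act M u‖ := by
  refine le_antisymm (ContinuousLinearMap.opNorm_le_bound _ (norm_nonneg _) ?_) ?_
  · rintro ⟨x, hx⟩
    obtain ⟨c, rfl⟩ := Submodule.mem_span_singleton.1 hx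
    simp [norm_smul, hu, mul_comm]
  · have := ((act M).comp (Submodule.span ℝ {u}).subtypeL).le_opNorm
      ⟨u, Submodule.mem_span_singleton_self u⟩
    simpa [hu, restrictNorm] using this

lemma norm_starProjection_orthogonal_span (x : Plane) {u : Plane} (hu : ‖u‖ = 1) :
    ‖(Submodule.span ℝ {u})ᗮ.starProjection x‖ = |cross x u| := by
  have h : (Submodule.span ℝ {u})ᗮ.starProjection x = cross u x • perp u := by
    have h1 : (Submodule.span ℝ {u}).starProjection x = (inner ℝ u x : ℝ) • u :=
      Submodule.starProjection_unit_singleton ℝ hu x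
    have h2 : (Submodule.span ℝ {u}).starProjection x + (Submodule.span ℝ {u})ᗮ.starProjection x = x :=
      Submodule.starProjection_add_starProjection_orthogonal _
    rw [h1] at h2
    exact add_left_cancel (h2.trans (eq_inner_smul_add x hu))
  rw [h, norm_smul, norm_perp, hu, mul_one, Real.norm_eq_abs, abs_cross_comm]

lemma eq_smul_of_cross_eq_zero {v u : Plane} (hu : ‖u‖ = 1) (h : cross v u = 0) :
    v = (inner ℝ u v : ℝ) • u := by
  have h1 := eq_inner_smul_add v hu
  rw [cross_swap, h] at h1
  simpa using h1

lemma span_eq_of_cross_eq_zero {v u : Plane} (hu : ‖u‖ = 1) (hv : v ≠ 0) (h : cross v u = 0) :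
    Submodule.span ℝ {v} = Submodule.span ℝ {u} := by
  have h1 := eq_smul_of_cross_eq_zero hu h
  have h2 : (inner ℝ u v : ℝ) ≠ 0 := by
    intro h0; rw [h0, zero_smul] at h1; exact hv h1
  rw [h1, Submodule.span_singleton_smul_eq (isUnit_iff_ne_zero.2 h2)]

end SelfAffine

end

noncomputable section

namespace SelfAffine

/-! ### Dominated sequences of matrices -/

/-- The quotient `‖M‖² / |det M|` of the singular values. -/
def singRatio (M : Matrix (Fin 2) (Fin 2) ℝ) : ℝ := ‖act M‖ ^ 2 / |M.det|

lemma singRatio_one : singRatio 1 = 1 := by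
  simp [singRatio]

lemma singRatio_inv {M : Matrix (Fin 2) (Fin 2) ℝ} (h : M.det ≠ 0) :
    singRatio M⁻¹ = singRatio M := by
  have := abs_pos.2 h
  rw [singRatio, singRatio, norm_act_inv h, Matrix.det_nonsing_inv, Ring.inverse_eq_inv', abs_inv]
  field_simp

/-- The products `G_{n-1} ⋯ G_0`. -/
def prodSeq (G : ℕ → Matrix (Fin 2) (Fin 2) ℝ) : ℕ → Matrix (Fin 2) (Fin 2) ℝ
  | 0 => 1
  | n + 1 => G n * prodSeq G n

lemma prodSeq_succ' (G : ℕ → Matrix (Fin 2) (Fin 2) ℝ) (n : ℕ) :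
    prodSeq G (n + 1) = prodSeq (fun k => G (k + 1)) n * G 0 := by
  induction n with
  | zero => simp [prodSeq]
  | succ n ih => rw [prodSeq, ih, prodSeq, mul_assoc]

/-- Sequences of matrices, bounded together with their inverses, whose products have
exponentially diverging singular values. -/
structure DominatedSeq (c δ B : ℝ) (G : ℕ → Matrix (Fin 2) (Fin 2) ℝ) : Prop where
  det : ∀ k, (G k).det ≠ 0
  norm_le : ∀ k, ‖act (G k)‖ ≤ B
  norm_inv_le : ∀ k, ‖act (G k)⁻¹‖ ≤ B
  dom : ∀ n : ℕ, c * Real.exp (δ * n) ≤ singRatio (prodSeq G n)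

/-- The tails of the series of the inverse singular ratios. -/
def ratioTail (G : ℕ → Matrix (Fin 2) (Fin 2) ℝ) (m : ℕ) : ℝ :=
  ∑' k : ℕ, (singRatio (prodSeq G (m + k)))⁻¹

namespace DominatedSeq

variable {c δ B : ℝ} {G : ℕ → Matrix (Fin 2) (Fin 2) ℝ}

lemma det_prod (h : DominatedSeq c δ B G) (n : ℕ) : (prodSeq G n).det ≠ 0 := by
  induction n with
  | zero => simp [prodSeq]
  | succ n ih => rw [prodSeq, Matrix.det_mul]; exact mul_ne_zero (h.det n) ih

lemma norm_prod_pos (h : DominatedSeq c δ B G) (n : ℕ) : 0 < ‖act (prodSeq G n)‖ :=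
  norm_act_pos (h.det_prod n)

lemma ratio_pos (h : DominatedSeq c δ B G) (n : ℕ) : 0 < singRatio (prodSeq G n) :=
  div_pos (pow_pos (h.norm_prod_pos n) 2) (abs_pos.2 (h.det_prod n))

lemma norm_prod_succ_le (h : DominatedSeq c δ B G) (n : ℕ) :
    ‖act (prodSeq G (n + 1))‖ ≤ B * ‖act (prodSeq G n)‖ :=
  (norm_act_mul_le _ _).trans (mul_le_mul_of_nonneg_right (h.norm_le n) (norm_nonneg _))

lemma norm_prod_le_succ (h : DominatedSeq c δ B G) (n : ℕ) :
    ‖act (prodSeq G n)‖ ≤ B * ‖act (prodSeq G (n + 1))‖ := by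
  have : prodSeq G n = (G n)⁻¹ * prodSeq G (n + 1) := by
    rw [prodSeq, ← mul_assoc, Matrix.nonsing_inv_mul _ (isUnit_iff_ne_zero.2 (h.det n)), one_mul]
  conv_lhs => rw [this]
  exact (norm_act_mul_le _ _).trans (mul_le_mul_of_nonneg_right (h.norm_inv_le n) (norm_nonneg _))

/-- One further factor raises the squared norm by at most B² and shrinks the determinant by at most
B². Hence the ratio cannot jump far over a given level. -/
lemma ratio_succ_le (h : DominatedSeq c δ B G) (n : ℕ) :
    singRatio (prodSeq G (n + 1)) ≤ B ^ 4 * singRatio (prodSeq G n) := by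
  have h1 := h.norm_prod_succ_le n
  have h2 := abs_det_le (G n)⁻¹
  have h3 := h.norm_inv_le n
  rw [Matrix.det_nonsing_inv, Ring.inverse_eq_inv', abs_inv] at h2
  have hd := abs_pos.2 (h.det n)
  have hdp := abs_pos.2 (h.det_prod n)
  have h4 : 1 ≤ B ^ 2 * |(G n).det| := by
    rw [← div_le_iff₀ hd, one_div]
    exact h2.trans (by gcongr)
  rw [singRatio, singRatio, prodSeq, Matrix.det_mul, abs_mul, div_le_iff₀ (by positivity)]
  calc ‖act (G n * prodSeq G n)‖ ^ 2 ≤ (B * ‖act (prodSeq G n)‖) ^ 2 := by gcongr; exact h1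
    _ = B ^ 2 * ‖act (prodSeq G n)‖ ^ 2 * 1 := by ring
    _ ≤ B ^ 2 * ‖act (prodSeq G n)‖ ^ 2 * (B ^ 2 * |(G n).det|) := by gcongr
    _ = _ := by field_simp

lemma one_le_bound (h : DominatedSeq c δ B G) : 1 ≤ B := by
  have h1 := norm_act_mul_le (G 0) (G 0)⁻¹
  rw [Matrix.mul_nonsing_inv _ (isUnit_iff_ne_zero.2 (h.det 0))] at h1
  have h0 : ‖act 1‖ = 1 := by rw [act_one]; exact norm_one
  have h2 := h.norm_le 0
  have h3 := h.norm_inv_le 0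
  have := norm_nonneg (act (G 0))
  have := norm_nonneg (act (G 0)⁻¹)
  rw [h0] at h1
  nlinarith

lemma ratio_le_pow (h : DominatedSeq c δ B G) (n : ℕ) :
    singRatio (prodSeq G n) ≤ (B ^ 4) ^ n := by
  have := h.one_le_bound
  induction n with
  | zero => simp [prodSeq, singRatio_one]
  | succ n ih =>
    refine (h.ratio_succ_le n).trans ?_
    rw [pow_succ' (B ^ 4)]
    gcongr

lemma inv_ratio_le (h : DominatedSeq c δ B G) (hc : 0 < c) (n : ℕ) :
    (singRatio (prodSeq G n))⁻¹ ≤ c⁻¹ * Real.exp (-δ) ^ n := by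
  have h1 := h.dom n
  rw [← Real.exp_nat_mul, mul_neg, Real.exp_neg, ← mul_inv, mul_comm (n : ℝ)]
  gcongr

lemma summable_geom (c : ℝ) (hδ : 0 < δ) (m : ℕ) :
    Summable fun k : ℕ => c⁻¹ * Real.exp (-δ) ^ (m + k) := by
  simp_rw [pow_add]
  exact ((summable_geometric_of_lt_one (Real.exp_pos _).le
    (by simpa using hδ)).mul_left _).mul_left _

lemma tsum_geom (c : ℝ) (hδ : 0 < δ) (m : ℕ) :
    ∑' k : ℕ, c⁻¹ * Real.exp (-δ) ^ (m + k) =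
      c⁻¹ * (1 - Real.exp (-δ))⁻¹ * Real.exp (-δ) ^ m := by
  simp_rw [pow_add]
  rw [tsum_mul_left, tsum_mul_left, tsum_geometric_of_lt_one (Real.exp_pos _).le
    (by simpa using hδ)]
  ring

lemma summable_inv_ratio (h : DominatedSeq c δ B G) (hc : 0 < c) (hδ : 0 < δ) (m : ℕ) :
    Summable fun k : ℕ => (singRatio (prodSeq G (m + k)))⁻¹ :=
  Summable.of_nonneg_of_le (fun _ => (inv_pos.2 (h.ratio_pos _)).le)
    (fun _ => h.inv_ratio_le hc _) (summable_geom c hδ m)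

lemma ratioTail_nonneg (h : DominatedSeq c δ B G) (m : ℕ) : 0 ≤ ratioTail G m :=
  tsum_nonneg fun _ => (inv_pos.2 (h.ratio_pos _)).le

lemma ratioTail_le (h : DominatedSeq c δ B G) (hc : 0 < c) (hδ : 0 < δ) (m : ℕ) :
    ratioTail G m ≤ c⁻¹ * (1 - Real.exp (-δ))⁻¹ * Real.exp (-δ) ^ m := by
  rw [← tsum_geom c hδ]
  exact (h.summable_inv_ratio hc hδ m).tsum_le_tsum (fun _ => h.inv_ratio_le hc _)
    (summable_geom c hδ m)

lemma ratioTail_eq (h : DominatedSeq c δ B G) (hc : 0 < c) (hδ : 0 < δ) (m K : ℕ) :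
    ratioTail G m = ∑ k ∈ Finset.range K, (singRatio (prodSeq G (m + k)))⁻¹ +
      ratioTail G (m + K) := by
  rw [ratioTail, ratioTail, ← (h.summable_inv_ratio hc hδ m).sum_add_tsum_nat_add K]
  congr 2; ext k; congr 3; ring

lemma inv_ratio_le_ratioTail (h : DominatedSeq c δ B G) (hc : 0 < c) (hδ : 0 < δ) (m : ℕ) :
    (singRatio (prodSeq G m))⁻¹ ≤ ratioTail G m := by
  have := h.ratioTail_eq hc hδ m 1
  have h2 := h.ratioTail_nonneg (m + 1)
  simp at this
  linarith

/-- A unit vector whose orbit is uniformly negligible. -/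
lemma exists_contracted (h : DominatedSeq c δ B G) (hc : 0 < c) (hδ : 0 < δ) :
    ∃ u : Plane, ‖u‖ = 1 ∧ ∀ m, ‖act (prodSeq G m) u‖ ≤
      2 * B ^ 2 * ‖act (prodSeq G m)‖ * ratioTail G m := by
  have hB := h.one_le_bound
  choose u hu hmin using fun n => exists_norm_mul_eq_det (prodSeq G n)
  have hmin' : ∀ n, ‖act (prodSeq G n) (u n)‖ =
      ‖act (prodSeq G n)‖ * (singRatio (prodSeq G n))⁻¹ := by
    intro n
    have := h.norm_prod_pos n
    rw [singRatio, ← hmin n]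
    have hd := abs_pos.2 (h.det_prod n)
    rw [← hmin n] at hd
    have : ‖act (prodSeq G n) (u n)‖ ≠ 0 := fun h0 => by rw [h0] at hd; simp at hd
    field_simp
  -- The next product still contracts u n almost optimally, and the determinant bound forces such
  -- vectors to lie near its own contracted direction. The successive angles are thus summable.
  have hstep : ∀ n, |cross (u n) (u (n + 1))| ≤ B ^ 2 * (singRatio (prodSeq G n))⁻¹ := by
    intro n
    have h1 := det_mul_cross_le (prodSeq G (n + 1)) (u n) (u (n + 1))
    rw [← hmin (n + 1)] at h1
    have hd := abs_pos.2 (h.det_prod (n + 1))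
    rw [← hmin (n + 1)] at hd
    have hpos : 0 < ‖act (prodSeq G (n + 1)) (u (n + 1))‖ :=
      pos_of_mul_pos_right hd (norm_nonneg _)
    have h2 : ‖act (prodSeq G (n + 1))‖ * |cross (u n) (u (n + 1))| ≤
        ‖act (prodSeq G (n + 1)) (u n)‖ := by
      refine le_of_mul_le_mul_right ?_ hpos
      linarith
    have h3 : ‖act (prodSeq G (n + 1)) (u n)‖ ≤ B * ‖act (prodSeq G n) (u n)‖ := by
      rw [prodSeq, act_mul_apply]
      exact ((act (G n)).le_opNorm _).trans (by gcongr; exact h.norm_le n)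
    rw [hmin' n] at h3
    have h4 := h.norm_prod_le_succ n
    have h5 := h.norm_prod_pos (n + 1)
    have h6 := inv_pos.2 (h.ratio_pos n)
    refine le_of_mul_le_mul_left (h2.trans (h3.trans ?_)) h5
    calc B * (‖act (prodSeq G n)‖ * (singRatio (prodSeq G n))⁻¹)
        ≤ B * ((B * ‖act (prodSeq G (n + 1))‖) * (singRatio (prodSeq G n))⁻¹) := by gcongr
      _ = _ := by ring
  have hdist : ∀ m k, |cross (u m) (u (m + k))| ≤
      B ^ 2 * ∑ i ∈ Finset.range k, (singRatio (prodSeq G (m + i)))⁻¹ := by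
    intro m k
    induction k with
    | zero => simp [cross_self]
    | succ k ih =>
      refine (abs_cross_triangle (hu m) (hu (m + k)) (hu _)).trans ?_
      rw [Finset.sum_range_succ, mul_add]
      exact add_le_add ih (hstep (m + k))
  have hdist' : ∀ m k, |cross (u m) (u (m + k))| ≤ B ^ 2 * ratioTail G m := by
    intro m k
    refine (hdist m k).trans ?_
    rw [h.ratioTail_eq hc hδ m k]
    have := h.ratioTail_nonneg (m + k)
    gcongr
    linarith
  have hbound : ∀ m n, m ≤ n → ‖act (prodSeq G m) (u n)‖ ≤
      2 * B ^ 2 * ‖act (prodSeq G m)‖ * ratioTail G m := by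
    intro m n hmn
    obtain ⟨k, rfl⟩ := Nat.exists_eq_add_of_le hmn
    have h1 := norm_act_le_of_unit (prodSeq G m) (u (m + k)) (hu m)
    rw [hu, one_mul, hmin' m, abs_cross_comm] at h1
    have h2 := hdist' m k
    have h3 := h.inv_ratio_le_ratioTail hc hδ m
    have h4 := h.norm_prod_pos m
    have h5 := h.ratioTail_nonneg m
    calc _ ≤ _ := h1
      _ ≤ ‖act (prodSeq G m)‖ * ratioTail G m + B ^ 2 * ratioTail G m * ‖act (prodSeq G m)‖ := by
        gcongr
      _ ≤ _ := by
        have : 1 ≤ B ^ 2 := one_le_pow₀ hB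
        have : 0 ≤ ‖act (prodSeq G m)‖ * ratioTail G m := by positivity
        nlinarith
  -- The vectors u n are controlled only up to sign, so a subsequential limit is taken. The bound at
  -- each fixed m is a closed condition and passes to it.
  obtain ⟨v, hv, φ, hφ, hlim⟩ := (isCompact_sphere (0 : Plane) 1).tendsto_subseq
    (x := u) (fun n => by simp [hu])
  refine ⟨v, by simpa using hv, fun m => ?_⟩
  refine le_of_tendsto (((act (prodSeq G m)).continuous.norm.tendsto v).comp hlim) ?_
  filter_upwards [eventually_ge_atTop m] with n hn
  exact hbound m _ (hn.trans (hφ.id_le n))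

end DominatedSeq

/-- The orbit of `v` is negligible with respect to the norms of the products. -/
def Negligible (G : ℕ → Matrix (Fin 2) (Fin 2) ℝ) (v : Plane) : Prop :=
  Tendsto (fun m => ‖act (prodSeq G m) v‖ / ‖act (prodSeq G m)‖) atTop (𝓝 0)

lemma Negligible.smul {G : ℕ → Matrix (Fin 2) (Fin 2) ℝ} {v : Plane} (h : Negligible G v) (a : ℝ) :
    Negligible G (a • v) := by
  have := h.const_mul |a|
  rw [mul_zero] at this
  refine this.congr fun m => ?_
  rw [map_smul, norm_smul, Real.norm_eq_abs]; ring

/-- Two independent vectors control the operator norm by `norm_act_mul_cross_le`, so they cannot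
both be negligible. This uniqueness later yields the invariance of the two lines. -/
lemma Negligible.cross_eq_zero {c δ B : ℝ} {G : ℕ → Matrix (Fin 2) (Fin 2) ℝ}
    (hG : DominatedSeq c δ B G) {u v : Plane} (hu : Negligible G u) (hv : Negligible G v) :
    cross u v = 0 := by
  rcases eq_or_ne u 0 with rfl | hu0
  · simp [cross]
  rcases eq_or_ne v 0 with rfl | hv0
  · simp [cross]
  have hu1 := hu.smul ‖u‖⁻¹
  have hv1 := hv.smul ‖v‖⁻¹
  have key : |cross (‖u‖⁻¹ • u) (‖v‖⁻¹ • v)| ≤ 0 := by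
    refine ge_of_tendsto (by simpa using Tendsto.add hu1 hv1) (Eventually.of_forall fun m => ?_)
    have h := norm_act_mul_cross_le (prodSeq G m) (v := ‖u‖⁻¹ • u) (u := ‖v‖⁻¹ • v)
      (by simp [norm_smul, hu0]) (by simp [norm_smul, hv0])
    rw [← add_div, le_div_iff₀ (hG.norm_prod_pos m), mul_comm, ← map_smul, ← map_smul]
    exact h
  have := abs_nonpos_iff.1 key
  rw [cross_smul_left, cross_smul_right] at this
  simpa [hu0, hv0] using this

lemma DominatedSeq.exists_negligible {c δ B : ℝ} {G : ℕ → Matrix (Fin 2) (Fin 2) ℝ}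
    (h : DominatedSeq c δ B G) (hc : 0 < c) (hδ : 0 < δ) {u : Plane}
    (hu : ∀ m, ‖act (prodSeq G m) u‖ ≤ 2 * B ^ 2 * ‖act (prodSeq G m)‖ * ratioTail G m) :
    Negligible G u := by
  have h0 : Tendsto (fun m : ℕ => 2 * B ^ 2 * (c⁻¹ * (1 - Real.exp (-δ))⁻¹ * Real.exp (-δ) ^ m))
      atTop (𝓝 0) := by
    have := tendsto_pow_atTop_nhds_zero_of_lt_one (Real.exp_pos (-δ)).le (by simpa using hδ)
    simpa using (this.const_mul (c⁻¹ * (1 - Real.exp (-δ))⁻¹)).const_mul (2 * B ^ 2)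
  refine squeeze_zero (fun m => by positivity) (fun m => ?_) h0
  rw [div_le_iff₀ (h.norm_prod_pos m)]
  refine (hu m).trans ?_
  have := h.ratioTail_le hc hδ m
  have h2 := h.norm_prod_pos m
  calc 2 * B ^ 2 * ‖act (prodSeq G m)‖ * ratioTail G m
      ≤ 2 * B ^ 2 * ‖act (prodSeq G m)‖ *
        (c⁻¹ * (1 - Real.exp (-δ))⁻¹ * Real.exp (-δ) ^ m) := by gcongr
    _ = _ := by ring

/-- For a level `exp (δ K)`, a time at which the singular ratio is comparable to the level while
the tail of the inverse ratios is almost inversely proportional to it. -/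
lemma DominatedSeq.exists_level {c δ B : ℝ} {G : ℕ → Matrix (Fin 2) (Fin 2) ℝ}
    (h : DominatedSeq c δ B G) (hc : 0 < c) (hδ : 0 < δ) (K : ℕ) :
    ∃ n, singRatio (prodSeq G n) ≤ Real.exp (δ * K) ∧
      Real.exp (δ * K) ≤ (B ^ 4) ^ (n + 1) ∧
      ratioTail G n ≤ (B ^ 4 + K + c⁻¹ * (1 - Real.exp (-δ))⁻¹) * Real.exp (-(δ * K)) := by
  set Q := Real.exp (δ * K)
  have hQ : 1 ≤ Q := Real.one_le_exp (by positivity)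
  have hfin : ∃ n₀, ∀ n ≥ n₀, Q < singRatio (prodSeq G n) := by
    have h1 : Tendsto (fun n : ℕ => c * Real.exp (δ * n)) atTop atTop :=
      (Real.tendsto_exp_atTop.comp (tendsto_natCast_atTop_atTop.const_mul_atTop hδ)).const_mul_atTop
        hc
    obtain ⟨n₀, hn₀⟩ := eventually_atTop.1 (h1.eventually_gt_atTop Q)
    exact ⟨n₀, fun n hn => (hn₀ n hn).trans_le (h.dom n)⟩
  classical
  -- From n₀ on the ratio stays above Q forever. The ratio at time 0 is 1 ≤ Q, so n₀ has a
  -- predecessor n, the last time at which the ratio is at most Q.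
  set n₀ := Nat.find hfin
  have hn₀ : ∀ n ≥ n₀, Q < singRatio (prodSeq G n) := Nat.find_spec hfin
  have hn₀pos : n₀ ≠ 0 := by
    intro h0
    have := hn₀ 0 (by omega)
    rw [prodSeq, singRatio_one] at this
    linarith
  obtain ⟨n, hn⟩ := Nat.exists_eq_succ_of_ne_zero hn₀pos
  have hnle : singRatio (prodSeq G n) ≤ Q := by
    by_contra! hlt
    refine Nat.find_min hfin (m := n) (by change n < n₀; omega) fun k hk => ?_
    rcases hk.eq_or_lt with rfl | hk
    · exact hlt
    · exact hn₀ k (by omega)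
  have hsucc := hn₀ (n + 1) (by omega)
  refine ⟨n, hnle, hsucc.le.trans (h.ratio_le_pow _), ?_⟩
  have hinv : Real.exp (-(δ * K)) = Q⁻¹ := Real.exp_neg _
  rw [hinv]
  have hQ0 : 0 < Q := by positivity
  -- The tail from n splits into its first term, K terms below Q⁻¹ because they come after the last
  -- visit, and a geometric remainder which is of order Q⁻¹ because its exponent is at least K.
  have h1 : (singRatio (prodSeq G n))⁻¹ ≤ B ^ 4 * Q⁻¹ := by
    rw [← div_eq_mul_inv, inv_eq_one_div, div_le_div_iff₀ (h.ratio_pos n) hQ0, one_mul]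
    exact hsucc.le.trans (h.ratio_succ_le n)
  have h2 : ∑ k ∈ Finset.range K, (singRatio (prodSeq G (n + 1 + k)))⁻¹ ≤ K * Q⁻¹ := by
    have := Finset.sum_le_card_nsmul (Finset.range K)
      (fun k => (singRatio (prodSeq G (n + 1 + k)))⁻¹) Q⁻¹ (fun k _ => by
        have := hn₀ (n + 1 + k) (by omega)
        gcongr)
    simpa using this
  have h3 := h.ratioTail_le hc hδ (n + 1 + K)
  have h4 := h.ratioTail_eq hc hδ n 1
  have h5 := h.ratioTail_eq hc hδ (n + 1) K
  simp only [Finset.range_one, Finset.sum_singleton, add_zero] at h4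
  have h6 : Real.exp (-δ) ^ (n + 1 + K) ≤ Q⁻¹ := by
    rw [← hinv, show -(δ * K) = (K : ℝ) * (-δ) by ring, Real.exp_nat_mul]
    exact pow_le_pow_of_le_one (Real.exp_pos _).le (by simpa using hδ.le) (by omega)
  have h7 : 0 ≤ (1 - Real.exp (-δ))⁻¹ := inv_nonneg.2 (by simpa using hδ.le)
  have h8 : c⁻¹ * (1 - Real.exp (-δ))⁻¹ * Real.exp (-δ) ^ (n + 1 + K) ≤
    c⁻¹ * (1 - Real.exp (-δ))⁻¹ * Q⁻¹ := by gcongr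
  rw [h4, h5]
  linarith

/-- The negligible directions of two sequences are uniformly transversal when the concatenated
products are uniformly dominated. -/
lemma exists_transversality {c δ B : ℝ} (hc : 0 < c) (hδ : 0 < δ) (hB : 1 < B) :
    ∃ ε > 0, ∀ G H : ℕ → Matrix (Fin 2) (Fin 2) ℝ, DominatedSeq c δ B G → DominatedSeq c δ B H →
      (∀ n m : ℕ, c * Real.exp (δ * (n + m)) ≤
        singRatio (prodSeq G n * (prodSeq H m)⁻¹)) →
      ∀ u v : Plane, ‖u‖ = 1 → ‖v‖ = 1 →
      (∀ m, ‖act (prodSeq G m) u‖ ≤ 2 * B ^ 2 * ‖act (prodSeq G m)‖ * ratioTail G m) →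
      (∀ m, ‖act (prodSeq H m) v‖ ≤ 2 * B ^ 2 * ‖act (prodSeq H m)‖ * ratioTail H m) →
      ε ≤ |cross u v| := by
  set β := Real.log B
  have hβ : 0 < β := Real.log_pos hB
  set C₁ := c⁻¹ * (1 - Real.exp (-δ))⁻¹
  have hC₁ : 0 ≤ C₁ := mul_nonneg (inv_nonneg.2 hc.le) (inv_nonneg.2 (by simpa using hδ.le))
  set D := 4 * B ^ 2
  -- At the levels below, Q ≤ (B ^ 4) ^ (n + 1) forces n + 1 ≥ δK / (4β), and likewise for m. Thus
  -- δ(n + m) ≥ ηK - 2δ.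
  set η := δ ^ 2 / (2 * β)
  have hη : 0 < η := by positivity
  -- An exponential beats a polynomial in K. The left side will bound the ratio of the concatenated
  -- product if the angle is below exp(-δK), the right side is what domination demands.
  obtain ⟨K, hK⟩ : ∃ K : ℕ, (D * (B ^ 4 + K + C₁) + 1) ^ 2 <
      c * Real.exp (-(2 * δ)) * Real.exp (η * K) := by
    have hlim : Tendsto (fun x : ℝ => (D * (B ^ 4 + x + C₁) + 1) ^ 2 / Real.exp (η * x)) atTop
        (𝓝 0) := by
      have h1 : ∀ s : ℕ, Tendsto (fun x : ℝ => x ^ s / Real.exp (η * x)) atTop (𝓝 0) := by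
        intro s
        have h2 := tendsto_rpow_mul_exp_neg_mul_atTop_nhds_zero s η hη
        refine h2.congr' ?_
        filter_upwards with x
        rw [Real.rpow_natCast, neg_mul, Real.exp_neg, div_eq_mul_inv]
      have h2 := (((h1 2).const_mul (D ^ 2)).add ((h1 1).const_mul
        (2 * D * (D * (B ^ 4 + C₁) + 1)))).add ((h1 0).const_mul ((D * (B ^ 4 + C₁) + 1) ^ 2))
      simp only [mul_zero, add_zero] at h2
      refine h2.congr fun x => ?_
      field_simp
      ring
    have hlim' := hlim.comp tendsto_natCast_atTop_atTop
    have hpos : 0 < c * Real.exp (-(2 * δ)) := by positivity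
    obtain ⟨K, hK⟩ := (hlim'.eventually_lt_const hpos).exists
    refine ⟨K, ?_⟩
    simp only [Function.comp] at hK
    rwa [div_lt_iff₀ (Real.exp_pos _)] at hK
  refine ⟨Real.exp (-(δ * K)), Real.exp_pos _, ?_⟩
  intro G H hG hH hGH u v hu hv hGu hHv
  by_contra! hlt
  obtain ⟨n, hn1, hn2, hn3⟩ := hG.exists_level hc hδ K
  obtain ⟨m, hm1, hm2, hm3⟩ := hH.exists_level hc hδ K
  set Q := Real.exp (δ * K)
  have hinv : Real.exp (-(δ * K)) = Q⁻¹ := Real.exp_neg _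
  rw [hinv] at hn3 hm3 hlt
  have hQ0 : 0 < Q := Real.exp_pos _
  set P := prodSeq G n
  set R := prodSeq H m
  set L := (B ^ 4 + K + C₁)
  have hL : 0 ≤ L := by positivity
  have hPp := hG.norm_prod_pos n
  have hRp := hH.norm_prod_pos m
  have hRdet := hH.det_prod m
  have hRd := abs_pos.2 hRdet
  have hPd := abs_pos.2 (hG.det_prod n)
  -- The inverse of R sends every vector near the direction v, and v is close to u, which P nearly
  -- annihilates. The norm is smaller than the product of the norms by a factor of order 1/Q.
  have hnorm : ‖act (P * R⁻¹)‖ ≤ ‖act P‖ * ‖act R⁻¹‖ * ((D * L + 1) * Q⁻¹) := by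
    refine ContinuousLinearMap.opNorm_le_bound _ (by positivity) fun x => ?_
    rw [act_mul_apply]
    set y := act R⁻¹ x
    have h1 := norm_act_le_of_unit P y hv
    have hy : ‖y‖ ≤ ‖act R⁻¹‖ * ‖x‖ := (act R⁻¹).le_opNorm x
    have h2 : ‖act P v‖ ≤ ‖act P‖ * ((2 * B ^ 2 * L + 1) * Q⁻¹) := by
      have h3 := norm_act_le_of_unit P v hu
      rw [hv, one_mul, abs_cross_comm] at h3
      have h4 := hGu n
      calc ‖act P v‖ ≤ 2 * B ^ 2 * ‖act P‖ * (L * Q⁻¹) + Q⁻¹ * ‖act P‖ := by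
            refine h3.trans (add_le_add (h4.trans ?_) ?_)
            · gcongr
            · gcongr
        _ = _ := by ring
    have h5 : |cross y v| ≤ ‖act R⁻¹‖ * ‖x‖ * (2 * B ^ 2 * L * Q⁻¹) := by
      have h6 := det_mul_cross_le R y v
      rw [act_act_inv hRdet] at h6
      have h7 := hHv m
      rw [norm_act_inv hRdet]
      rw [div_mul_eq_mul_div, div_mul_eq_mul_div, le_div_iff₀ hRd]
      calc |cross y v| * |R.det| ≤ ‖x‖ * ‖act R v‖ := by linarith
        _ ≤ ‖x‖ * (2 * B ^ 2 * ‖act R‖ * (L * Q⁻¹)) := by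
          gcongr
          refine h7.trans ?_
          gcongr
        _ = _ := by ring
    calc ‖act P y‖ ≤ (‖act R⁻¹‖ * ‖x‖) * (‖act P‖ * ((2 * B ^ 2 * L + 1) * Q⁻¹)) +
          ‖act R⁻¹‖ * ‖x‖ * (2 * B ^ 2 * L * Q⁻¹) * ‖act P‖ := by
          refine h1.trans ?_
          gcongr
      _ = _ := by simp only [D]; ring
  -- The two ratios contribute at most Q each, and the square of the gain 1/Q cancels them.
  have hupper : singRatio (P * R⁻¹) ≤ (D * L + 1) ^ 2 := by
    have h1 : singRatio (P * R⁻¹) ≤ singRatio P * singRatio R⁻¹ * ((D * L + 1) * Q⁻¹) ^ 2 := by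
      rw [singRatio, singRatio, singRatio, Matrix.det_mul, abs_mul, div_mul_div_comm,
        div_mul_eq_mul_div, ← mul_pow, ← mul_pow]
      gcongr
    rw [singRatio_inv hRdet] at h1
    refine h1.trans ?_
    have := hH.ratio_pos m
    calc singRatio P * singRatio R * ((D * L + 1) * Q⁻¹) ^ 2
        ≤ Q * Q * ((D * L + 1) * Q⁻¹) ^ 2 := by gcongr
      _ = _ := by field_simp
  have hlower := hGH n m
  have hexp : ∀ n : ℕ, Q ≤ (B ^ 4) ^ (n + 1) → δ * K / (4 * β) ≤ n + 1 := by
    intro n hn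
    have h1 := Real.log_le_log hQ0 hn
    rw [Real.log_exp, Real.log_pow, Real.log_pow] at h1
    rw [div_le_iff₀ (by positivity)]
    push_cast at h1
    linarith
  have h1 := hexp n hn2
  have h2 := hexp m hm2
  have h3 : -(2 * δ) + η * K ≤ δ * (n + m) := by
    have h4 : δ * (δ * K / (4 * β) + δ * K / (4 * β)) ≤ δ * ((n + 1) + (m + 1)) := by gcongr
    have h5 : δ * (δ * K / (4 * β) + δ * K / (4 * β)) = η * K := by
      simp only [η]; field_simp; ring
    linarith
  have h4 : c * Real.exp (-(2 * δ)) * Real.exp (η * K) ≤ c * Real.exp (δ * (n + m)) := by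
    rw [mul_assoc, ← Real.exp_add]
    gcongr
  linarith

end SelfAffine

end

noncomputable section

namespace SelfAffine

/-! ### Existence of the splitting -/

section Splitting

variable {N : ℕ} {A : Fin N → Matrix (Fin 2) (Fin 2) ℝ}

/-- The translate of a two-sided word. -/
def shiftBy (m : ℤ) (j : ℤ → Fin N) : ℤ → Fin N := fun n => j (n + m)

lemma shift_eq_shiftBy (j : ℤ → Fin N) : shift j = shiftBy 1 j := rfl

lemma shiftBy_shiftBy (m n : ℤ) (j : ℤ → Fin N) : shiftBy m (shiftBy n j) = shiftBy (m + n) j := by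
  ext k; simp [shiftBy, add_assoc]

lemma shiftBy_zero (j : ℤ → Fin N) : shiftBy 0 j = j := by ext k; simp [shiftBy]

lemma cocycle_add (j : ℤ → Fin N) (m n : ℕ) :
    cocycle A j (m + n) = cocycle A (shiftBy m j) n * cocycle A j m := by
  induction n with
  | zero => simp [cocycle]
  | succ n ih =>
    rw [← add_assoc, cocycle, ih, cocycle, mul_assoc]
    simp [shiftBy, add_comm]

lemma cocycle_succ' (j : ℤ → Fin N) (n : ℕ) :
    cocycle A j (n + 1) = cocycle A (shift j) n * A (j 0) := by
  rw [add_comm, cocycle_add]; simp [cocycle, shift_eq_shiftBy]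

lemma det_cocycle_ne_zero (hdet : ∀ i, (A i).det ≠ 0) (j : ℤ → Fin N) (n : ℕ) :
    (cocycle A j n).det ≠ 0 := by
  induction n with
  | zero => simp [cocycle]
  | succ n ih => rw [cocycle, Matrix.det_mul]; exact mul_ne_zero (hdet _) ih

lemma cocycle_eq_list_prod (j : ℤ → Fin N) (n : ℕ) :
    ∃ w : List (Fin N), w.length = n ∧ (w.map A).prod = cocycle A j n := by
  induction n with
  | zero => exact ⟨[], rfl, rfl⟩
  | succ n ih =>
    obtain ⟨w, hw, hw'⟩ := ih
    exact ⟨j n :: w, by simp [hw], by simp [hw', cocycle]⟩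

lemma cocycle_congr {j j' : ℤ → Fin N} {n : ℕ} (h : ∀ k : ℕ, k < n → j k = j' k) :
    cocycle A j n = cocycle A j' n := by
  induction n with
  | zero => rfl
  | succ n ih => rw [cocycle, cocycle, ih (fun k hk => h k (by omega)), h n (by omega)]

/-- The matrices read to the right of the origin. -/
def forwardSeq (A : Fin N → Matrix (Fin 2) (Fin 2) ℝ) (j : ℤ → Fin N) :
    ℕ → Matrix (Fin 2) (Fin 2) ℝ := fun k => A (j k)

/-- The inverse matrices read to the left of the origin. -/
def backwardSeq (A : Fin N → Matrix (Fin 2) (Fin 2) ℝ) (j : ℤ → Fin N) :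
    ℕ → Matrix (Fin 2) (Fin 2) ℝ := fun k => (A (j (-1 - k)))⁻¹

lemma prodSeq_forwardSeq (j : ℤ → Fin N) (n : ℕ) : prodSeq (forwardSeq A j) n = cocycle A j n := by
  induction n with
  | zero => rfl
  | succ n ih => rw [prodSeq, ih]; rfl

lemma prodSeq_backwardSeq (j : ℤ → Fin N) (m : ℕ) :
    prodSeq (backwardSeq A j) m = (cocycle A (shiftBy (-m) j) m)⁻¹ := by
  induction m with
  | zero => simp [prodSeq, cocycle]
  | succ m ih =>
    have e1 : shift (shiftBy (-((m + 1 : ℕ) : ℤ)) j) = shiftBy (-m) j := by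
      rw [shift_eq_shiftBy, shiftBy_shiftBy]
      congr 1
      push_cast
      ring
    have e2 : shiftBy (-((m + 1 : ℕ) : ℤ)) j 0 = j (-1 - m) := by
      simp only [shiftBy]
      congr 1
      push_cast
      ring
    rw [prodSeq, ih, cocycle_succ', Matrix.mul_inv_rev, e1, e2]
    rfl

lemma DominatedSplitting.singRatio_cocycle (hdet : ∀ i, (A i).det ≠ 0) {C δ : ℝ}
    (h : ∀ w : List (Fin N),
      C * Real.exp (δ * w.length) ≤ alpha₁ (w.map A).prod / alpha₂ (w.map A).prod)
    (j : ℤ → Fin N) (n : ℕ) : C * Real.exp (δ * n) ≤ singRatio (cocycle A j n) := by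
  obtain ⟨w, hw, hw'⟩ := cocycle_eq_list_prod (A := A) j n
  have := h w
  rw [hw, hw'] at this
  exact this.trans (alpha_ratio_le (det_cocycle_ne_zero hdet j n))

lemma exists_norm_bound (A : Fin N → Matrix (Fin 2) (Fin 2) ℝ) :
    ∃ B : ℝ, 1 < B ∧ ∀ i, ‖act (A i)‖ ≤ B ∧ ‖act (A i)⁻¹‖ ≤ B := by
  have h1 : ∀ i, 0 ≤ ‖act (A i)‖ + ‖act (A i)⁻¹‖ := fun i => by positivity
  have h2 : 0 ≤ ∑ i, (‖act (A i)‖ + ‖act (A i)⁻¹‖) := Finset.sum_nonneg fun i _ => h1 i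
  refine ⟨2 + ∑ i, (‖act (A i)‖ + ‖act (A i)⁻¹‖), by linarith, fun i => ?_⟩
  have h3 := Finset.single_le_sum (fun i _ => h1 i) (Finset.mem_univ i)
  have h4 := norm_nonneg (act (A i))
  have h5 := norm_nonneg (act (A i)⁻¹)
  exact ⟨by linarith, by linarith⟩

lemma map_span_eq {M : Matrix (Fin 2) (Fin 2) ℝ} {u u' : Plane} (hM : M.det ≠ 0) (hu : ‖u‖ = 1)
    (hu' : ‖u'‖ = 1) (h : cross (act M u) u' = 0) :
    (Submodule.span ℝ {u}).map (act M : Plane →ₗ[ℝ] Plane) = Submodule.span ℝ {u'} := by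
  rw [Submodule.map_span, Set.image_singleton]
  exact span_eq_of_cross_eq_zero hu' (act_ne_zero hM (by rintro rfl; simp at hu)) h

lemma finrank_span_unit {u : Plane} (hu : ‖u‖ = 1) :
    Module.finrank ℝ (Submodule.span ℝ {u}) = 1 :=
  finrank_span_singleton (by rintro rfl; simp at hu)

/-- Uniformly transversal directions, one of which is exponentially negligible, dominate. -/
lemma dominated_of_transversal {M : Matrix (Fin 2) (Fin 2) ℝ} (hM : M.det ≠ 0) {u v : Plane}
    (hu : ‖u‖ = 1) (hv : ‖v‖ = 1) {ε x : ℝ} (hε : 0 < ε) (hcross : ε ≤ |cross u v|)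
    (hx0 : 0 < x) (hx : ‖act M u‖ ≤ x * ‖act M‖) (hxε : x ≤ ε / 2) :
    ε / 2 * x⁻¹ ≤ ‖act M v‖ / ‖act M u‖ := by
  have hu0 : 0 < ‖act M u‖ := norm_pos_iff.2 (act_ne_zero hM (by rintro rfl; simp at hu))
  have h1 := norm_act_mul_cross_le M hv hu
  rw [abs_cross_comm] at h1
  have h2 : ‖act M‖ * ε ≤ ‖act M v‖ + ‖act M u‖ :=
    (mul_le_mul_of_nonneg_left hcross (norm_nonneg _)).trans h1
  have h3 : ‖act M u‖ ≤ ε / 2 * ‖act M‖ := hx.trans (by gcongr)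
  have h4 : ε / 2 * ‖act M‖ ≤ ‖act M v‖ := by linarith
  rw [le_div_iff₀ hu0]
  calc ε / 2 * x⁻¹ * ‖act M u‖ ≤ ε / 2 * x⁻¹ * (x * ‖act M‖) := by gcongr
    _ = ε / 2 * ‖act M‖ := by field_simp
    _ ≤ _ := h4

/-- The strong stable line is the one contracted by the future, the stable line the one contracted
by the inverse products of the past. Uniqueness of negligible lines gives invariance, and domination
follows from the uniform angle between them through `dominated_of_transversal`. -/
theorem exists_splitting (hdet : ∀ i, (A i).det ≠ 0) (hdom : DominatedSplitting A) :
    ∃ es ess : (ℤ → Fin N) → Submodule ℝ Plane, IsSplitting A es ess := by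
  obtain ⟨C, δ, hC, hδ, hw⟩ := hdom
  obtain ⟨B, hB1, hB⟩ := exists_norm_bound A
  have hq := DominatedSplitting.singRatio_cocycle hdet hw
  have hF : ∀ j, DominatedSeq C δ B (forwardSeq A j) := fun j =>
    ⟨fun k => hdet _, fun k => (hB _).1, fun k => (hB _).2, fun n => by
      rw [prodSeq_forwardSeq]; exact hq j n⟩
  have hR : ∀ j, DominatedSeq C δ B (backwardSeq A j) := fun j =>
    ⟨fun k => by
        rw [backwardSeq, Matrix.det_nonsing_inv, Ring.inverse_eq_inv']
        exact inv_ne_zero (hdet _),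
      fun k => (hB _).2, fun k => by
        rw [backwardSeq, Matrix.nonsing_inv_nonsing_inv _ (isUnit_iff_ne_zero.2 (hdet _))]
        exact (hB _).1,
      fun n => by
        rw [prodSeq_backwardSeq, singRatio_inv (det_cocycle_ne_zero hdet _ _)]
        exact hq _ n⟩
  choose u hu hub using fun j => (hF j).exists_contracted hC hδ
  choose v hv hvb using fun j => (hR j).exists_contracted hC hδ
  obtain ⟨ε, hε, htrans⟩ := exists_transversality hC hδ hB1
  -- The forward product of length n times the inverse of the backward product of length m is the
  -- cocycle of length m + n started at position -m.
  have hcross : ∀ j, ε ≤ |cross (u j) (v j)| := by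
    intro j
    refine htrans _ _ (hF j) (hR j) (fun n m => ?_) _ _ (hu j) (hv j) (hub j) (hvb j)
    rw [prodSeq_forwardSeq, prodSeq_backwardSeq, Matrix.nonsing_inv_nonsing_inv _
      (isUnit_iff_ne_zero.2 (det_cocycle_ne_zero hdet _ _))]
    have h1 := hq (shiftBy (-m) j) (m + n)
    rw [cocycle_add, shiftBy_shiftBy] at h1
    have e1 : ((m : ℤ) + -m) = 0 := by ring
    rw [e1, shiftBy_zero] at h1
    push_cast at h1
    rwa [add_comm (m : ℝ)] at h1
  have hun : ∀ j, Negligible (forwardSeq A j) (u j) := fun j =>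
    (hF j).exists_negligible hC hδ (hub j)
  have hvn : ∀ j, Negligible (backwardSeq A j) (v j) := fun j =>
    (hR j).exists_negligible hC hδ (hvb j)
  have hB0 : 0 < B := by linarith
  have hmapu : ∀ j, cross (act (A (j 0)) (u j)) (u (shift j)) = 0 := by
    intro j
    refine Negligible.cross_eq_zero (hF (shift j)) ?_ (hun _)
    have h1 := ((tendsto_add_atTop_iff_nat 1).2 (hun j)).const_mul B
    rw [mul_zero] at h1
    refine squeeze_zero (fun m => by positivity) (fun m => ?_) h1
    have e : prodSeq (forwardSeq A j) (m + 1) = prodSeq (forwardSeq A (shift j)) m * A (j 0) := by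
      rw [prodSeq_forwardSeq, prodSeq_forwardSeq, cocycle_succ']
    have h2 := norm_act_mul_le (prodSeq (forwardSeq A (shift j)) m) (A (j 0))
    have h3 := (hF j).norm_prod_pos (m + 1)
    have h4 := (hF (shift j)).norm_prod_pos m
    rw [← act_mul_apply, ← e, ← mul_div_assoc, div_le_div_iff₀ h4 h3]
    rw [← e] at h2
    have h5 : ‖act (prodSeq (forwardSeq A j) (m + 1))‖ ≤
      ‖act (prodSeq (forwardSeq A (shift j)) m)‖ * B := h2.trans (by gcongr; exact (hB _).1)
    calc _ ≤ ‖act (prodSeq (forwardSeq A j) (m + 1)) (u j)‖ *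
          (‖act (prodSeq (forwardSeq A (shift j)) m)‖ * B) := by gcongr
      _ = _ := by ring
  have hmapv : ∀ j, cross (act (A (j 0)) (v j)) (v (shift j)) = 0 := by
    intro j
    refine Negligible.cross_eq_zero (hR (shift j)) ?_ (hvn _)
    -- The shift moves one symbol from the future to the past, so the backward products of `shift j`
    -- have one factor more than those of j.
    refine (tendsto_add_atTop_iff_nat 1).1 ?_
    have h1 := (hvn j).const_mul B
    rw [mul_zero] at h1
    refine squeeze_zero (fun m => by positivity) (fun m => ?_) h1
    have e0 : ∀ m, prodSeq (backwardSeq A (shift j)) (m + 1) =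
        prodSeq (backwardSeq A j) m * (A (j 0))⁻¹ := by
      intro m
      rw [prodSeq_succ']
      congr 1
      · congr 1
        ext k : 1
        simp only [backwardSeq, shift]; congr 3; push_cast; ring
    have e : prodSeq (backwardSeq A j) m = prodSeq (backwardSeq A (shift j)) (m + 1) * A (j 0) := by
      rw [e0, mul_assoc, Matrix.nonsing_inv_mul _ (isUnit_iff_ne_zero.2 (hdet _)), mul_one]
    have h2 := norm_act_mul_le (prodSeq (backwardSeq A (shift j)) (m + 1)) (A (j 0))
    have h3 := (hR j).norm_prod_pos m
    have h4 := (hR (shift j)).norm_prod_pos (m + 1)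
    rw [← act_mul_apply, ← e, ← mul_div_assoc, div_le_div_iff₀ h4 h3]
    rw [← e] at h2
    have h5 : ‖act (prodSeq (backwardSeq A j) m)‖ ≤
      ‖act (prodSeq (backwardSeq A (shift j)) (m + 1))‖ * B := h2.trans (by gcongr; exact (hB _).1)
    calc _ ≤ ‖act (prodSeq (backwardSeq A j) m) (v j)‖ *
          (‖act (prodSeq (backwardSeq A (shift j)) (m + 1))‖ * B) := by gcongr
      _ = _ := by ring
  refine ⟨fun j => Submodule.span ℝ {v j}, fun j => Submodule.span ℝ {u j},
    fun j => finrank_span_unit (hv j), fun j => finrank_span_unit (hu j),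
    fun j => map_span_eq (hdet _) (hv j) (hv _) (hmapv j),
    fun j => map_span_eq (hdet _) (hu j) (hu _) (hmapu j), ?_⟩
  set D := 2 * B ^ 2 * (C⁻¹ * (1 - Real.exp (-δ))⁻¹)
  have hD : 0 < D := by
    have : 0 < 1 - Real.exp (-δ) := by simpa using hδ
    positivity
  set x : ℕ → ℝ := fun n => D * Real.exp (-δ) ^ n
  have hx0 : ∀ n, 0 < x n := fun n => by positivity
  have hxlim : Tendsto x atTop (𝓝 0) := by
    have := tendsto_pow_atTop_nhds_zero_of_lt_one (Real.exp_pos (-δ)).le (by simpa using hδ)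
    simpa using this.const_mul D
  obtain ⟨n₀, hn₀⟩ := eventually_atTop.1 (hxlim.eventually_le_const (half_pos hε))
  have hxinv : ∀ n, (x n)⁻¹ = D⁻¹ * Real.exp (δ * n) := by
    intro n
    simp only [x]
    rw [mul_inv, ← Real.exp_nat_mul, ← Real.exp_neg]; congr 2; ring
  -- The first entry of the minimum serves n ≥ n₀. The second serves the finitely many earlier
  -- times, where the crude bounds B⁻ⁿ and Bⁿ for the two norms suffice.
  refine ⟨min (ε / 2 * D⁻¹) ((B ^ 2)⁻¹ ^ n₀ * Real.exp (-(δ * n₀))), δ, by positivity, hδ, ?_⟩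
  intro j n _
  rw [restrictNorm_span _ (hv j), restrictNorm_span _ (hu j)]
  rcases le_or_gt n₀ n with hn | hn
  · have h1 : ‖act (cocycle A j n) (u j)‖ ≤ x n * ‖act (cocycle A j n)‖ := by
      have h2 := hub j n
      have h3 := (hF j).ratioTail_le hC hδ n
      rw [prodSeq_forwardSeq] at h2
      calc _ ≤ _ := h2
        _ ≤ 2 * B ^ 2 * ‖act (cocycle A j n)‖ *
          (C⁻¹ * (1 - Real.exp (-δ))⁻¹ * Real.exp (-δ) ^ n) := by gcongr
        _ = _ := by simp only [x, D]; ring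
    refine le_trans ?_ (dominated_of_transversal (det_cocycle_ne_zero hdet _ _) (hu j) (hv j) hε
      (hcross j) (hx0 n) h1 (hn₀ n hn))
    rw [hxinv, ← mul_assoc]
    gcongr
    exact min_le_left _ _
  · have hlow : ∀ n : ℕ, (B⁻¹) ^ n ≤ ‖act (cocycle A j n) (v j)‖ := by
      intro n
      induction n with
      | zero => simp [cocycle, hv]
      | succ n ih =>
        rw [cocycle, act_mul_apply, pow_succ', inv_mul_le_iff₀ hB0]
        refine ih.trans ?_
        conv_lhs => rw [← act_inv_act (hdet (j n)) (act (cocycle A j n) (v j))]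
        exact ((act (A (j n))⁻¹).le_opNorm _).trans (by gcongr; exact (hB _).2)
    have hupp : ∀ n : ℕ, ‖act (cocycle A j n) (u j)‖ ≤ B ^ n := by
      intro n
      induction n with
      | zero => simp [cocycle, hu]
      | succ n ih =>
        rw [cocycle, act_mul_apply, pow_succ']
        exact ((act (A (j n))).le_opNorm _).trans (by gcongr; exact (hB _).1)
    have hu0 : 0 < ‖act (cocycle A j n) (u j)‖ :=
      norm_pos_iff.2 (act_ne_zero (det_cocycle_ne_zero hdet _ _)
        (by intro h; have := hu j; rw [h] at this; simp at this))
    calc _ ≤ ((B ^ 2)⁻¹ ^ n₀ * Real.exp (-(δ * n₀))) * Real.exp (δ * n) := by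
          gcongr; exact min_le_right _ _
      _ ≤ (B ^ 2)⁻¹ ^ n₀ := by
        rw [mul_assoc, ← Real.exp_add]
        refine mul_le_of_le_one_right (by positivity) (Real.exp_le_one_iff.2 ?_)
        have : (n : ℝ) ≤ n₀ := by exact_mod_cast hn.le
        nlinarith
      _ ≤ (B ^ 2)⁻¹ ^ n := by
        refine pow_le_pow_of_le_one (by positivity) (inv_le_one_of_one_le₀ ?_) hn.le
        exact one_le_pow₀ hB1.le
      _ = (B⁻¹) ^ n / B ^ n := by rw [inv_pow, inv_pow, ← pow_mul, mul_comm 2 n, pow_mul]; field_simp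
      _ ≤ _ := by
        gcongr
        · exact hlow n
        · exact hupp n

end Splitting

end SelfAffine

end

noncomputable section

namespace SelfAffine

/-! ### Pointwise ergodic theorems -/

section Birkhoff

variable {Ω : Type*} {T : Ω → Ω}

/-- The running maxima `max_{k ≤ n} S_k f` of the Birkhoff sums. -/
def birkhoffMax (T : Ω → Ω) (f : Ω → ℝ) : ℕ → Ω → ℝ
  | 0 => fun _ => 0
  | n + 1 => fun x => max 0 (f x + birkhoffMax T f n (T x))

lemma birkhoffMax_nonneg (f : Ω → ℝ) (n : ℕ) (x : Ω) : 0 ≤ birkhoffMax T f n x := by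
  cases n with
  | zero => exact le_rfl
  | succ n => exact le_max_left _ _

lemma birkhoffSum_le_birkhoffMax (f : Ω → ℝ) (n : ℕ) (x : Ω) :
    birkhoffSum T f n x ≤ birkhoffMax T f n x := by
  induction n generalizing x with
  | zero => simp [birkhoffMax]
  | succ n ih =>
    rw [birkhoffSum_succ']
    exact (add_le_add_right (ih (T x)) (f x)).trans (le_max_right _ _)

lemma birkhoffMax_mono (f : Ω → ℝ) (x : Ω) : Monotone fun n => birkhoffMax T f n x := by
  refine monotone_nat_of_le_succ fun n => ?_
  induction n generalizing x with
  | zero => exact birkhoffMax_nonneg f 1 x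
  | succ n ih => exact max_le_max le_rfl (add_le_add_right (ih (T x)) (f x))

lemma birkhoffSum_sub_const (f : Ω → ℝ) (c : ℝ) (n : ℕ) (x : Ω) :
    birkhoffSum T (fun y => f y - c) n x = birkhoffSum T f n x - n * c := by
  simp [birkhoffSum, Finset.sum_sub_distrib]

variable [MeasurableSpace Ω] {μ : Measure Ω}

lemma measurable_birkhoffMax (hT : Measurable T) {f : Ω → ℝ} (hf : Measurable f) (n : ℕ) :
    Measurable (birkhoffMax T f n) := by
  induction n with
  | zero => exact measurable_const
  | succ n ih => exact measurable_const.max (hf.add (ih.comp hT))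

lemma integrable_birkhoffMax (hT : MeasurePreserving T μ μ) {f : Ω → ℝ} (hfi : Integrable f μ)
    [IsFiniteMeasure μ] (n : ℕ) : Integrable (birkhoffMax T f n) μ := by
  induction n with
  | zero => exact integrable_const _
  | succ n ih =>
    exact (integrable_const (0 : ℝ)).sup (hfi.add ((hT.integrable_comp ih.1).2 ih))

/-- Birkhoff sums of a function of negative mean are almost surely bounded above. -/
lemma ae_exists_birkhoffSum_le [IsProbabilityMeasure μ] (hT : Ergodic T μ) {f : Ω → ℝ}
    (hf : Measurable f) (hfi : Integrable f μ) (hneg : ∫ x, f x ∂μ < 0) :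
    ∀ᵐ x ∂μ, ∃ c : ℝ, ∀ n, birkhoffSum T f n x ≤ c := by
  have hTm := hT.toMeasurePreserving
  -- The set where the running maxima are unbounded is invariant, hence null or of full measure.
  set A : Set Ω := {x | ∀ c : ℕ, ∃ n, (c : ℝ) < birkhoffMax T f n x}
  have hA : MeasurableSet A := by
    have : A = ⋂ c : ℕ, ⋃ n, {x | (c : ℝ) < birkhoffMax T f n x} := by ext; simp [A]
    rw [this]
    exact MeasurableSet.iInter fun c => MeasurableSet.iUnion fun n =>
      measurableSet_lt measurable_const (measurable_birkhoffMax hTm.measurable hf n)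
  have hinv : T ⁻¹' A = A := by
    ext x
    simp only [A, Set.mem_preimage, Set.mem_ofPred_eq]
    constructor
    · intro h c
      obtain ⟨d, hd⟩ := exists_nat_ge ((c : ℝ) - f x)
      obtain ⟨n, hn⟩ := h d
      exact ⟨n + 1, (show (c : ℝ) < f x + birkhoffMax T f n (T x) by linarith).trans_le
        (le_max_right _ _)⟩
    · intro h c
      -- Taking the maximum with 0 rules out the branch where the running maximum is 0.
      obtain ⟨d, hd⟩ := exists_nat_ge (max ((c : ℝ) + f x) 0)
      obtain ⟨n, hn⟩ := h d
      have hn' := hn.trans_le (birkhoffMax_mono f x (Nat.le_succ n))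
      refine ⟨n, ?_⟩
      rcases lt_max_iff.1 hn' with h1 | h1
      · have := le_max_right ((c : ℝ) + f x) 0; linarith
      · have := le_max_left ((c : ℝ) + f x) 0; linarith
  -- The increments M_{n+1} - M_n ∘ T equal max(-M_n ∘ T, f). Their integrals over A are
  -- non-negative by invariance, and on A they tend to f. If A had full measure this would
  -- contradict the negative mean.
  have hint : 0 ≤ ∫ x in A, f x ∂μ := by
    have hTA : MeasurePreserving T (μ.restrict A) (μ.restrict A) := by
      have := hTm.restrict_preimage hA
      rwa [hinv] at this
    have hMi : ∀ n, Integrable (birkhoffMax T f n) (μ.restrict A) := fun n =>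
      (integrable_birkhoffMax hTm hfi n).restrict
    have hMTi : ∀ n, Integrable (fun x => birkhoffMax T f n (T x)) (μ.restrict A) := fun n =>
      (hTA.integrable_comp (hMi n).1).2 (hMi n)
    have hMT : ∀ n, ∫ x in A, birkhoffMax T f n (T x) ∂μ = ∫ x in A, birkhoffMax T f n x ∂μ := by
      intro n
      conv_rhs => rw [← hTA.map_eq]
      rw [integral_map hTA.measurable.aemeasurable
        (measurable_birkhoffMax hTm.measurable hf n).aestronglyMeasurable]
    have hpos : ∀ n, 0 ≤ ∫ x in A, (birkhoffMax T f (n + 1) x - birkhoffMax T f n (T x)) ∂μ := by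
      intro n
      rw [integral_sub (hMi _) (hMTi n), hMT, sub_nonneg]
      exact integral_mono (hMi n) (hMi _) fun x => birkhoffMax_mono f x (Nat.le_succ n)
    have heq : ∀ n x, birkhoffMax T f (n + 1) x - birkhoffMax T f n (T x) =
        max (-birkhoffMax T f n (T x)) (f x) := by
      intro n x
      change max 0 (f x + birkhoffMax T f n (T x)) - birkhoffMax T f n (T x) = _
      rw [← max_sub_sub_right]
      simp
    have hlim : Tendsto (fun n => ∫ x in A, (birkhoffMax T f (n + 1) x - birkhoffMax T f n (T x)) ∂μ)
        atTop (𝓝 (∫ x in A, f x ∂μ)) := by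
      refine tendsto_integral_of_dominated_convergence (fun x => |f x|)
        (fun n => ((hMi _).sub (hMTi n)).1) hfi.abs.restrict (fun n => Eventually.of_forall fun x => ?_)
        ((ae_restrict_iff' hA).2 (Eventually.of_forall fun x hx => ?_))
      · rw [heq, Real.norm_eq_abs]
        refine abs_le.2 ⟨(neg_abs_le _).trans (le_max_right _ _), max_le ?_ (le_abs_self _)⟩
        have := birkhoffMax_nonneg (T := T) f n (T x)
        have := abs_nonneg (f x)
        linarith
      · have hx' : T x ∈ A := by rwa [← hinv] at hx
        obtain ⟨d, hd⟩ := exists_nat_ge (-f x)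
        obtain ⟨n₀, hn₀⟩ := hx' d
        refine tendsto_const_nhds.congr' ?_
        filter_upwards [eventually_ge_atTop n₀] with n hn
        rw [heq, max_eq_right]
        have := birkhoffMax_mono (T := T) f (T x) hn
        simp only at this
        linarith
    exact ge_of_tendsto hlim (Eventually.of_forall hpos)
  rcases hT.toPreErgodic.measure_self_or_compl_eq_zero hA hinv with h0 | h0
  · have : ∀ᵐ x ∂μ, x ∉ A := measure_eq_zero_iff_ae_notMem.1 h0
    filter_upwards [this] with x hx
    simp only [A, Set.mem_ofPred_eq, not_forall, not_exists, not_lt] at hx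
    obtain ⟨c, hc⟩ := hx
    exact ⟨c, fun n => (birkhoffSum_le_birkhoffMax f n x).trans (hc n)⟩
  · exfalso
    have : ∫ x in A, f x ∂μ = ∫ x, f x ∂μ := by
      rw [Measure.restrict_eq_self_of_ae_mem (measure_eq_zero_iff_ae_notMem.1 h0 |>.mono
        fun x hx => by simpa using hx)]
    linarith

/-- Subtracting slightly more than the mean leaves a function of negative mean, whose sums are
bounded above. The excesses 1/(k + 1) are countably many, so a single null set works for all b. -/
lemma ae_eventually_birkhoffSum_le [IsProbabilityMeasure μ] (hT : Ergodic T μ) {f : Ω → ℝ}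
    (hf : Measurable f) (hfi : Integrable f μ) :
    ∀ᵐ x ∂μ, ∀ b : ℝ, ∫ x, f x ∂μ < b → ∀ᶠ n : ℕ in atTop, birkhoffSum T f n x / n < b := by
  have h1 : ∀ k : ℕ, ∀ᵐ x ∂μ, ∃ c : ℝ, ∀ n,
      birkhoffSum T (fun y => f y - (∫ x, f x ∂μ + 1 / ((k : ℝ) + 1))) n x ≤ c := by
    intro k
    refine ae_exists_birkhoffSum_le hT (hf.sub_const _) (hfi.sub (integrable_const _)) ?_
    rw [integral_sub hfi (integrable_const _)]
    simp only [integral_const, probReal_univ, one_smul]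
    have : (0 : ℝ) < 1 / ((k : ℝ) + 1) := by positivity
    linarith
  filter_upwards [ae_all_iff.2 h1] with x hx b hb
  obtain ⟨k, hk⟩ := exists_nat_one_div_lt (sub_pos.2 hb)
  obtain ⟨c, hc⟩ := hx k
  have hlim : Tendsto (fun n : ℕ => c / n + (∫ x, f x ∂μ + 1 / ((k : ℝ) + 1))) atTop
      (𝓝 (0 + (∫ x, f x ∂μ + 1 / ((k : ℝ) + 1)))) :=
    (tendsto_const_nhds.div_atTop tendsto_natCast_atTop_atTop).add tendsto_const_nhds
  filter_upwards [hlim.eventually_lt_const (show _ < b by linarith), eventually_gt_atTop 0]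
    with n hn hn0
  refine lt_of_le_of_lt ?_ hn
  have h2 := hc n
  rw [birkhoffSum_sub_const] at h2
  have hn0' : (0 : ℝ) < n := by exact_mod_cast hn0
  rw [div_add' _ _ _ hn0'.ne', div_le_div_iff_of_pos_right hn0']
  linarith

/-- **Birkhoff's pointwise ergodic theorem** for ergodic transformations. -/
theorem ae_tendsto_birkhoffSum_div [IsProbabilityMeasure μ] (hT : Ergodic T μ) {f : Ω → ℝ}
    (hf : Measurable f) (hfi : Integrable f μ) :
    ∀ᵐ x ∂μ, Tendsto (fun n : ℕ => birkhoffSum T f n x / n) atTop (𝓝 (∫ x, f x ∂μ)) := by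
  filter_upwards [ae_eventually_birkhoffSum_le hT hf hfi,
    ae_eventually_birkhoffSum_le hT hf.neg hfi.neg] with x h1 h2
  refine tendsto_order.2 ⟨fun a ha => ?_, h1⟩
  have h3 := h2 (-a) (by simp only [Pi.neg_apply, integral_neg]; linarith)
  filter_upwards [h3] with n hn
  have : birkhoffSum T (-f) n x = - birkhoffSum T f n x := by simp [birkhoffSum]
  rw [this, neg_div] at hn
  linarith

/-- **Maker's ergodic theorem** along the reversed index, in an `ℓ¹` form. -/
theorem ae_tendsto_sum_abs_sub_div [IsProbabilityMeasure μ] (hT : Ergodic T μ)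
    {g : ℕ → Ω → ℝ} {g' G : Ω → ℝ} (hg : ∀ l, Measurable (g l)) (hg' : Measurable g')
    (hG : Measurable G) (hGi : Integrable G μ) (hbound : ∀ᵐ x ∂μ, ∀ l, |g l x| ≤ G x)
    (hlim : ∀ᵐ x ∂μ, Tendsto (fun l => g l x) atTop (𝓝 (g' x))) :
    ∀ᵐ x ∂μ, Tendsto (fun m : ℕ =>
      (∑ k ∈ Finset.range m, |g (m - k) (T^[k] x) - g' (T^[k] x)|) / m) atTop (𝓝 0) := by
  -- The truncation makes the suprema D finite everywhere. Almost surely it changes nothing, since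
  -- both terms are bounded by G.
  set h : ℕ → Ω → ℝ := fun l x => min |g l x - g' x| |2 * G x|
  have hh0 : ∀ l x, 0 ≤ h l x := fun l x => le_min (abs_nonneg _) (abs_nonneg _)
  have hhG : ∀ l x, h l x ≤ |2 * G x| := fun l x => min_le_right _ _
  have hhm : ∀ l, Measurable (h l) := fun l =>
    ((hg l).sub hg').abs.min (hG.const_mul 2).abs
  set D : ℕ → Ω → ℝ := fun K x => ⨆ l, h (K + l) x
  have hbdd : ∀ K x, BddAbove (Set.range fun l => h (K + l) x) := fun K x =>
    ⟨|2 * G x|, by rintro _ ⟨l, rfl⟩; exact hhG _ _⟩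
  have hD0 : ∀ K x, 0 ≤ D K x := fun K x => Real.iSup_nonneg fun l => hh0 _ _
  have hDG : ∀ K x, D K x ≤ |2 * G x| := fun K x => ciSup_le fun l => hhG _ _
  have hle : ∀ K l x, K ≤ l → h l x ≤ D K x := by
    intro K l x hl
    obtain ⟨i, rfl⟩ := Nat.exists_eq_add_of_le hl
    exact le_ciSup (hbdd K x) i
  have hDm : ∀ K, Measurable (D K) := fun K => Measurable.iSup fun l => hhm _
  have hGi2 : Integrable (fun x => |2 * G x|) μ := (hGi.const_mul 2).abs
  have hDi : ∀ K, Integrable (D K) μ := fun K =>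
    hGi2.mono' (hDm K).aestronglyMeasurable (Eventually.of_forall fun x => by
      rw [Real.norm_eq_abs, abs_of_nonneg (hD0 K x)]; exact hDG K x)
  have hgood : ∀ᵐ x ∂μ, ∀ l, |g l x - g' x| = h l x := by
    filter_upwards [hbound, hlim] with x h1 h2 l
    have h3 : |g' x| ≤ G x := le_of_tendsto h2.abs (Eventually.of_forall h1)
    refine (min_eq_left ?_).symm
    refine le_trans ?_ (le_abs_self _)
    have := abs_sub (g l x) (g' x)
    have := h1 l
    linarith
  have hDlim : Tendsto (fun K => ∫ x, D K x ∂μ) atTop (𝓝 0) := by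
    have : Tendsto (fun K => ∫ x, D K x ∂μ) atTop (𝓝 (∫ _, (0 : ℝ) ∂μ)) := by
      refine tendsto_integral_of_dominated_convergence _ (fun K => (hDi K).1) hGi2
        (fun K => Eventually.of_forall fun x => by
          rw [Real.norm_eq_abs, abs_of_nonneg (hD0 K x)]; exact hDG K x) ?_
      filter_upwards [hgood, hlim] with x h1 h2
      rw [Metric.tendsto_atTop]
      intro ε hε
      obtain ⟨K₀, hK₀⟩ := Metric.tendsto_atTop.1 h2 (ε / 2) (by positivity)
      refine ⟨K₀, fun K hK => ?_⟩
      rw [Real.dist_eq, sub_zero, abs_of_nonneg (hD0 K x)]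
      refine lt_of_le_of_lt (ciSup_le fun l => ?_) (half_lt_self hε)
      rw [← h1, ← Real.dist_eq]
      exact (hK₀ _ (by omega)).le
    simpa using this
  have hTae : ∀ᵐ x ∂μ, ∀ k, ∀ l, |g l (T^[k] x) - g' (T^[k] x)| = h l (T^[k] x) :=
    ae_all_iff.2 fun k => (hT.toMeasurePreserving.iterate k).quasiMeasurePreserving.ae hgood
  have hDbirk : ∀ᵐ x ∂μ, ∀ K, Tendsto (fun n : ℕ => birkhoffSum T (D K) n x / n) atTop
      (𝓝 (∫ x, D K x ∂μ)) :=
    ae_all_iff.2 fun K => ae_tendsto_birkhoffSum_div hT (hDm K) (hDi K)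
  filter_upwards [hTae, hDbirk] with x h1 h2
  -- For k < m - K the index m - k exceeds K and D K dominates. The last K terms are dominated by D
  -- 0, and their sum is a difference of two Birkhoff sums, which is o(m).
  have hub : ∀ K m : ℕ, K ≤ m → (∑ k ∈ Finset.range m, |g (m - k) (T^[k] x) - g' (T^[k] x)|) / m ≤
      birkhoffSum T (D K) m x / m + (birkhoffSum T (D 0) m x / m -
        birkhoffSum T (D 0) (m - K) x / m) := by
    intro K m hKm
    rw [← sub_div, ← add_div]
    gcongr
    have h3 : birkhoffSum T (D 0) m x - birkhoffSum T (D 0) (m - K) x =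
        ∑ k ∈ Finset.range m, if m - K ≤ k then D 0 (T^[k] x) else 0 := by
      rw [← Finset.sum_filter, birkhoffSum, birkhoffSum, sub_eq_iff_eq_add,
        ← Finset.sum_filter_not_add_sum_filter (Finset.range m) (fun k => m - K ≤ k), add_comm]
      congr 2
      ext k; simp; omega
    rw [h3, birkhoffSum, ← Finset.sum_add_distrib]
    refine Finset.sum_le_sum fun k hk => ?_
    have hk' := Finset.mem_range.1 hk
    rw [h1]
    split_ifs with hc
    · have := hle 0 (m - k) (T^[k] x) (Nat.zero_le _)
      have := hD0 K (T^[k] x)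
      linarith
    · rw [add_zero]
      exact hle K _ _ (by omega)
  have hublim : ∀ K : ℕ, Tendsto (fun m : ℕ => birkhoffSum T (D K) m x / m +
      (birkhoffSum T (D 0) m x / m - birkhoffSum T (D 0) (m - K) x / m)) atTop
      (𝓝 (∫ x, D K x ∂μ)) := by
    intro K
    have h4 : Tendsto (fun m : ℕ => birkhoffSum T (D 0) (m - K) x / m) atTop
        (𝓝 (∫ x, D 0 x ∂μ)) := by
      have h5 := (h2 0).comp (tendsto_sub_atTop_nat K)
      have h6 : Tendsto (fun m : ℕ => (((m - K : ℕ) : ℝ) / m)) atTop (𝓝 1) := by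
        have : Tendsto (fun m : ℕ => 1 - (K : ℝ) / m) atTop (𝓝 (1 - 0)) :=
          tendsto_const_nhds.sub (tendsto_const_nhds.div_atTop tendsto_natCast_atTop_atTop)
        rw [sub_zero] at this
        refine this.congr' ?_
        filter_upwards [eventually_ge_atTop K, eventually_gt_atTop 0] with m hm hm0
        have : (m : ℝ) ≠ 0 := by positivity
        rw [Nat.cast_sub hm]
        field_simp
      have h7 := h5.mul h6
      rw [mul_one] at h7
      refine h7.congr' ?_
      filter_upwards [eventually_gt_atTop K] with m hm
      have : ((m - K : ℕ) : ℝ) ≠ 0 := by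
        have : m - K ≠ 0 := by omega
        exact_mod_cast this
      simp only [Function.comp]
      field_simp
    simpa using (h2 K).add ((h2 0).sub h4)
  refine tendsto_order.2 ⟨fun a ha => Eventually.of_forall fun m => ha.trans_le (by positivity),
    fun b hb => ?_⟩
  obtain ⟨K, hK⟩ := (hDlim.eventually_lt_const hb).exists
  filter_upwards [(hublim K).eventually_lt_const hK, eventually_ge_atTop K] with m hm hmK
  exact (hub K m hmK).trans_lt hm

end Birkhoff

end SelfAffine

end

noncomputable section

namespace SelfAffine

/-! ### Product measures on spaces of words -/

section Words

variable {F : Type*}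

/-- Glue two families along a partition of the index set. -/
def glueAlong {ι₁ ι₂ ι : Type*} (e : ι₁ ⊕ ι₂ ≃ ι) (x : (ι₁ → F) × (ι₂ → F)) : ι → F :=
  fun i => Sum.elim x.1 x.2 (e.symm i)

/-- The two-sided word with prescribed future and past. -/
def glue (x : (ℕ → F) × (ℕ → F)) : ℤ → F := glueAlong Equiv.intEquivNatSumNat.symm x

@[simp] lemma glue_natCast (x : (ℕ → F) × (ℕ → F)) (n : ℕ) : glue x (n : ℤ) = x.1 n := rfl

lemma glue_neg (x : (ℕ → F) × (ℕ → F)) (n : ℕ) : glue x (-1 - n : ℤ) = x.2 n := by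
  rw [show (-1 - n : ℤ) = Int.negSucc n by omega]; rfl

variable [MeasurableSpace F] (κ : Measure F) [IsProbabilityMeasure κ]

/-- The preimage of a finite box is a product of two finite boxes, and a product measure is
determined by its values on boxes. -/
lemma measurePreserving_glueAlong {ι₁ ι₂ ι : Type*} (e : ι₁ ⊕ ι₂ ≃ ι) :
    MeasurePreserving (glueAlong (F := F) e)
      ((Measure.infinitePi fun _ : ι₁ => κ).prod (Measure.infinitePi fun _ : ι₂ => κ))
      (Measure.infinitePi fun _ : ι => κ) := by
  classical
  have hm : Measurable (glueAlong (F := F) e) := by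
    refine measurable_pi_lambda _ fun i => ?_
    simp only [glueAlong]
    rcases e.symm i with k | k
    · exact (measurable_pi_apply k).comp measurable_fst
    · exact (measurable_pi_apply k).comp measurable_snd
  refine ⟨hm, Measure.eq_infinitePi _ fun s t ht => ?_⟩
  have hset : glueAlong (F := F) e ⁻¹' ((s : Set ι).pi t) =
      ((s.map e.symm.toEmbedding).toLeft : Set ι₁).pi (fun k => t (e (Sum.inl k))) ×ˢ
      ((s.map e.symm.toEmbedding).toRight : Set ι₂).pi (fun k => t (e (Sum.inr k))) := by
    ext ⟨x, y⟩
    simp only [glueAlong, Set.mem_preimage, Set.mem_pi, SetLike.mem_coe, Set.mem_prod,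
      Finset.mem_toLeft, Finset.mem_toRight, Finset.mem_map_equiv, Equiv.symm_symm]
    constructor
    · intro h
      exact ⟨fun k hk => by simpa using h _ hk, fun k hk => by simpa using h _ hk⟩
    · rintro ⟨h1, h2⟩ i hi
      obtain ⟨k | k, rfl⟩ := e.surjective i
      · simpa using h1 k hi
      · simpa using h2 k hi
  rw [Measure.map_apply hm (MeasurableSet.pi s.countable_toSet fun i _ => ht i), hset,
    Measure.prod_prod, Measure.infinitePi_pi _ (fun i _ => ht _),
    Measure.infinitePi_pi _ (fun i _ => ht _)]
  have h1 := Finset.prod_sum_eq_prod_toLeft_mul_prod_toRight (s.map e.symm.toEmbedding)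
    (fun k => κ (t (e k)))
  rw [← h1, Finset.prod_map]
  simp

lemma measurePreserving_glue :
    MeasurePreserving (glue (F := F))
      ((Measure.infinitePi fun _ : ℕ => κ).prod (Measure.infinitePi fun _ : ℕ => κ))
      (Measure.infinitePi fun _ : ℤ => κ) :=
  measurePreserving_glueAlong κ Equiv.intEquivNatSumNat.symm

lemma measurePreserving_past :
    MeasurePreserving (fun (j : ℤ → F) (k : ℕ) => j (-1 - k))
      (Measure.infinitePi fun _ : ℤ => κ) (Measure.infinitePi fun _ : ℕ => κ) := by
  refine ⟨measurable_pi_lambda _ fun k => measurable_pi_apply _, ?_⟩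
  rw [← (measurePreserving_glue κ).map_eq, Measure.map_map (measurable_pi_lambda _ fun k =>
    measurable_pi_apply _) (measurePreserving_glue κ).measurable]
  have : (fun (j : ℤ → F) (k : ℕ) => j (-1 - k)) ∘ glue = Prod.snd := by
    ext x k; exact glue_neg x k
  rw [this]
  exact measurePreserving_snd.map_eq

lemma infinitePi_cons_apply {S : Set F} {E : Set (ℕ → F)}
    (hS : MeasurableSet S) (hE : MeasurableSet E) :
    (Measure.infinitePi fun _ : ℕ => κ) {a | a 0 ∈ S ∧ (fun k => a (k + 1)) ∈ E} =
      κ S * (Measure.infinitePi fun _ : ℕ => κ) E := by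
  -- This equivalence puts the extra point at 0 and moves k to k + 1.
  have hmp := measurePreserving_glueAlong κ Equiv.natSumPUnitEquivNat.{0}
  have hm : MeasurableSet {a : ℕ → F | a 0 ∈ S ∧ (fun k => a (k + 1)) ∈ E} :=
    (measurable_pi_apply 0 hS).inter
      ((measurable_pi_lambda _ fun k => measurable_pi_apply (k + 1)) hE)
  rw [← hmp.measure_preimage hm.nullMeasurableSet]
  have hset : glueAlong Equiv.natSumPUnitEquivNat.{0} ⁻¹'
      {a : ℕ → F | a 0 ∈ S ∧ (fun k => a (k + 1)) ∈ E} = E ×ˢ (Function.eval PUnit.unit ⁻¹' S) := by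
    ext x
    simp only [Set.mem_preimage, Set.mem_ofPred_eq, Set.mem_prod, and_comm]
    rfl
  rw [hset, Measure.prod_prod, mul_comm]
  congr 1
  exact (measurePreserving_eval_infinitePi (fun _ : PUnit.{1} => κ) PUnit.unit).measure_preimage
    hS.nullMeasurableSet

end Words

/-! ### Mixing and ergodicity of the two-sided shift. -/

section Shift

variable {N : ℕ} (κ : Measure (Fin N)) [IsProbabilityMeasure κ]

lemma measurable_shiftBy (c : ℤ) : Measurable (shiftBy (N := N) c) :=
  measurable_pi_lambda _ fun _ => measurable_pi_apply _

lemma iterate_shiftBy (c : ℤ) (n : ℕ) : (shiftBy (N := N) c)^[n] = shiftBy (n * c) := by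
  induction n with
  | zero => ext j : 1; simp [shiftBy_zero]
  | succ n ih =>
    ext j : 1
    rw [Function.iterate_succ_apply', ih, shiftBy_shiftBy]
    congr 1; push_cast; ring

lemma preimage_shiftBy_pi (m : ℤ) (s : Finset ℤ) (t : ℤ → Set (Fin N)) :
    shiftBy m ⁻¹' ((s : Set ℤ).pi t) =
      ((s.map (Equiv.addRight m).toEmbedding : Finset ℤ) : Set ℤ).pi (fun k => t (k - m)) := by
  ext j
  simp only [shiftBy, Set.mem_preimage, Set.mem_pi, SetLike.mem_coe, Finset.mem_map_equiv,
    Equiv.addRight_symm, Equiv.coe_addRight]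
  refine ⟨fun h i hi => by simpa [sub_eq_add_neg] using h _ hi, fun h i hi => ?_⟩
  simpa using h (i + m) (by simpa using hi)

lemma measurePreserving_shiftBy (m : ℤ) :
    MeasurePreserving (shiftBy (N := N) m) (Measure.infinitePi fun _ : ℤ => κ)
      (Measure.infinitePi fun _ : ℤ => κ) := by
  refine ⟨measurable_shiftBy m, Measure.eq_infinitePi _ fun s t ht => ?_⟩
  rw [Measure.map_apply (measurable_shiftBy m)
    (MeasurableSet.pi s.countable_toSet fun i _ => ht i), preimage_shiftBy_pi,
    Measure.infinitePi_pi _ (fun i _ => ht _), Finset.prod_map]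
  simp

/-- Once the translation exceeds the spread of the two finite windows, they are disjoint and the two
events depend on different coordinates. -/
lemma infinitePi_inter_shiftBy (s s' : Finset ℤ) (t t' : ℤ → Set (Fin N)) {c : ℤ} (hc : c ≠ 0) :
    ∀ᶠ n : ℕ in atTop, (Measure.infinitePi fun _ : ℤ => κ)
      ((s : Set ℤ).pi t ∩ shiftBy (n * c) ⁻¹' ((s' : Set ℤ).pi t')) =
      (Measure.infinitePi fun _ : ℤ => κ) ((s : Set ℤ).pi t) *
        (Measure.infinitePi fun _ : ℤ => κ) ((s' : Set ℤ).pi t') := by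
  classical
  obtain ⟨b, hb⟩ := (s ∪ s').finite_toSet.isBounded.exists_norm_le
  obtain ⟨n₀, hn₀⟩ := exists_nat_gt (2 * b)
  filter_upwards [eventually_ge_atTop n₀] with n hn
  set S := s'.map (Equiv.addRight ((n : ℤ) * c)).toEmbedding
  have hdisj : Disjoint s S := by
    rw [Finset.disjoint_left]
    intro k hk hkS
    simp only [S, Finset.mem_map_equiv, Equiv.addRight_symm, Equiv.coe_addRight] at hkS
    have h1 := hb k (by simp [hk])
    have h2 := hb _ (show k + -(n * c) ∈ (↑(s ∪ s') : Set ℤ) by simp [hkS])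
    have h3 : ((n : ℤ) * c) = k - (k + -(n * c)) := by ring
    have h4 : ‖((n : ℤ) * c)‖ ≤ b + b := by
      rw [h3]; exact (norm_sub_le _ _).trans (add_le_add h1 h2)
    have h5 : (n : ℝ) ≤ ‖((n : ℤ) * c)‖ := by
      rw [Int.norm_eq_abs]
      push_cast
      rw [abs_mul, Nat.abs_cast]
      have : (1 : ℝ) ≤ |(c : ℝ)| := by exact_mod_cast Int.one_le_abs hc
      nlinarith [(Nat.cast_nonneg n : (0 : ℝ) ≤ n)]
    have h6 : (n₀ : ℝ) ≤ n := by exact_mod_cast hn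
    linarith
  set u : ℤ → Set (Fin N) := fun k => if k ∈ s then t k else t' (k - n * c)
  have hset : (s : Set ℤ).pi t ∩ shiftBy (n * c) ⁻¹' ((s' : Set ℤ).pi t') =
      ((s.disjUnion S hdisj : Finset ℤ) : Set ℤ).pi u := by
    rw [preimage_shiftBy_pi, Finset.coe_disjUnion, Set.union_pi]
    refine congrArg₂ _ (Set.pi_congr rfl fun k hk => ?_) (Set.pi_congr rfl fun k hk => ?_)
    · simp [u, Finset.mem_coe.1 hk]
    · simp only [u]
      rw [if_neg]
      exact fun h => (Finset.disjoint_left.1 hdisj h) hk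
  have hall : ∀ v : Set (Fin N), MeasurableSet v := fun v => v.toFinite.measurableSet
  rw [hset, Measure.infinitePi_pi _ (fun _ _ => hall _), Measure.infinitePi_pi _ (fun _ _ => hall _),
    Measure.infinitePi_pi _ (fun _ _ => hall _), Finset.prod_disjUnion]
  congr 1
  · exact Finset.prod_congr rfl fun k hk => by simp [u, hk]
  · rw [Finset.prod_map]
    refine Finset.prod_congr rfl fun k hk => ?_
    simp only [u]
    rw [if_neg]
    · simp
    · exact fun h => (Finset.disjoint_left.1 hdisj h) (Finset.mem_map_of_mem _ hk)

/-- Mixing, with one event kept a box: an induction over the second event alone is enough for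
ergodicity. Dominated convergence handles countable unions. -/
lemma tendsto_measure_inter_shiftBy (s : Finset ℤ) (t : ℤ → Set (Fin N)) {c : ℤ} (hc : c ≠ 0)
    {E : Set (ℤ → Fin N)} (hE : MeasurableSet E) :
    Tendsto (fun n : ℕ => (Measure.infinitePi fun _ : ℤ => κ).real
      ((s : Set ℤ).pi t ∩ shiftBy (n * c) ⁻¹' E)) atTop
      (𝓝 ((Measure.infinitePi fun _ : ℤ => κ).real ((s : Set ℤ).pi t) *
        (Measure.infinitePi fun _ : ℤ => κ).real E)) := by
  set P := Measure.infinitePi fun _ : ℤ => κ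
  have hall : ∀ v : Set (Fin N), MeasurableSet v := fun v => v.toFinite.measurableSet
  induction E, hE using MeasurableSpace.induction_on_inter (generateFrom_squareCylinders).symm
    (isPiSystem_squareCylinders (fun _ => MeasurableSpace.isPiSystem_measurableSet)
      (fun _ => MeasurableSet.univ)) with
  | empty => simp
  | basic E hE =>
    obtain ⟨s', t', -, rfl⟩ := hE
    refine tendsto_const_nhds.congr' ?_
    filter_upwards [infinitePi_inter_shiftBy κ s s' t t' hc] with n hn
    rw [measureReal_def, measureReal_def, measureReal_def, hn, ENNReal.toReal_mul]
  | compl E hE ih =>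
    have h1 : ∀ n : ℕ, P.real ((s : Set ℤ).pi t ∩ shiftBy (n * c) ⁻¹' Eᶜ) =
        P.real ((s : Set ℤ).pi t) - P.real ((s : Set ℤ).pi t ∩ shiftBy (n * c) ⁻¹' E) := by
      intro n
      have := measureReal_inter_add_sdiff (μ := P) (s := (s : Set ℤ).pi t)
        (measurable_shiftBy (n * c) hE)
      rw [Set.preimage_compl, ← Set.sdiff_eq]
      linarith
    simp_rw [h1]
    have h2 : P.real Eᶜ = 1 - P.real E := probReal_compl_eq_one_sub hE
    rw [h2, mul_sub, mul_one]
    exact tendsto_const_nhds.sub ih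
  | iUnion f hdisj hf ih =>
    have hsum : ∀ (f : ℕ → Set (ℤ → Fin N)), Pairwise (Function.onFun Disjoint f) →
        (∀ i, MeasurableSet (f i)) → HasSum (fun i => P.real (f i)) (P.real (⋃ i, f i)) := by
      intro f hd hm
      simp only [measureReal_def]
      rw [measure_iUnion hd hm, ENNReal.tsum_toReal_eq fun i => measure_ne_top _ _]
      refine ENNReal.hasSum_toReal ?_
      rw [← measure_iUnion hd hm]
      exact measure_ne_top _ _
    have h1 : ∀ n : ℕ, P.real ((s : Set ℤ).pi t ∩ shiftBy (n * c) ⁻¹' ⋃ i, f i) =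
        ∑' i, P.real ((s : Set ℤ).pi t ∩ shiftBy (n * c) ⁻¹' f i) := by
      intro n
      rw [Set.preimage_iUnion, Set.inter_iUnion]
      refine (hsum _ (fun i k hik => ?_) fun i => ?_).tsum_eq.symm
      · exact ((hdisj hik).preimage _).mono Set.inter_subset_right Set.inter_subset_right
      · exact (MeasurableSet.pi s.countable_toSet fun i _ => hall _).inter
          (measurable_shiftBy _ (hf i))
    simp_rw [h1]
    rw [← (hsum f hdisj hf).tsum_eq, ← tsum_mul_left]
    refine tendsto_tsum_of_dominated_convergence (hsum f hdisj hf).summable ih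
      (Eventually.of_forall fun n i => ?_)
    rw [Real.norm_eq_abs, abs_of_nonneg measureReal_nonneg]
    refine (measureReal_mono Set.inter_subset_right).trans_eq ?_
    rw [measureReal_def, measureReal_def,
      (measurePreserving_shiftBy κ (n * c)).measure_preimage (hf i).nullMeasurableSet]

/-- Nontrivial shifts of a Bernoulli measure are ergodic. -/
theorem ergodic_shiftBy {c : ℤ} (hc : c ≠ 0) :
    Ergodic (shiftBy (N := N) c) (Measure.infinitePi fun _ : ℤ => κ) := by
  set P := Measure.infinitePi fun _ : ℤ => κ
  refine ⟨measurePreserving_shiftBy κ c, ⟨fun E hE hinv => ?_⟩⟩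
  have hinv' : ∀ n : ℕ, shiftBy (n * c) ⁻¹' E = E := by
    intro n
    rw [← iterate_shiftBy]
    induction n with
    | zero => rfl
    | succ n ih => rw [Function.iterate_succ, Set.preimage_comp, ih, hinv]
  -- For an invariant E the mixing sequence is constant, so E is independent of every box.
  have h1 : ∀ (s : Finset ℤ) (t : ℤ → Set (Fin N)),
      P.real ((s : Set ℤ).pi t ∩ E) = P.real ((s : Set ℤ).pi t) * P.real E := by
    intro s t
    have h := tendsto_measure_inter_shiftBy κ s t hc hE
    simp_rw [hinv'] at h
    exact tendsto_nhds_unique tendsto_const_nhds h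
  -- Boxes generate, so E is independent of every event, in particular of itself.
  have h2 : P.restrict E = P E • P := by
    refine ext_of_generate_finite _ (generateFrom_squareCylinders).symm
      (isPiSystem_squareCylinders (fun _ => MeasurableSpace.isPiSystem_measurableSet)
        (fun _ => MeasurableSet.univ (α := Fin N))) ?_ (by simp)
    rintro _ ⟨s, t, -, rfl⟩
    have h := h1 s t
    rw [Measure.restrict_apply (MeasurableSet.pi s.countable_toSet fun i _ =>
      (t i).toFinite.measurableSet), Measure.smul_apply, smul_eq_mul, mul_comm]
    rw [measureReal_def, measureReal_def, measureReal_def, ← ENNReal.toReal_mul] at h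
    exact (ENNReal.toReal_eq_toReal_iff' (measure_ne_top _ _)
      (ENNReal.mul_ne_top (measure_ne_top _ _) (measure_ne_top _ _))).1 h
  have h3 : P E = P E * P E := by
    have := congrArg (fun m => m E) h2
    simpa using this
  have h4 : P E = 0 ∨ P E = 1 := by
    by_cases h0 : P E = 0
    · exact Or.inl h0
    · right
      have := (ENNReal.mul_eq_left h0 (measure_ne_top P E)).1 h3.symm
      exact this
  rw [eventuallyConst_set]
  rcases h4 with h0 | h0
  · exact Or.inr (measure_eq_zero_iff_ae_notMem.1 h0)
  · exact Or.inl ((mem_ae_iff_prob_eq_one hE).2 h0)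

end Shift

/-! ### The weights on the symbols. -/

lemma isProbabilityMeasure_symbolMeasure {N : ℕ} {p : Fin N → ℝ} (hp : ∀ i, 0 ≤ p i)
    (hp1 : ∑ i, p i = 1) : IsProbabilityMeasure (symbolMeasure p) := by
  refine ⟨?_⟩
  simp only [symbolMeasure, Measure.coe_finsetSum, Finset.sum_apply, Measure.smul_apply,
    measure_univ, smul_eq_mul, mul_one]
  rw [← ENNReal.ofReal_sum_of_nonneg fun i _ => hp i, hp1, ENNReal.ofReal_one]

lemma symbolMeasure_singleton {N : ℕ} (p : Fin N → ℝ) (b : Fin N) :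
    symbolMeasure p {b} = ENNReal.ofReal (p b) := by
  simp only [symbolMeasure, Measure.coe_finsetSum, Finset.sum_apply, Measure.smul_apply,
    smul_eq_mul]
  rw [Finset.sum_eq_single b]
  · simp
  · intro i _ hi; simp [hi]
  · simp

lemma integral_symbolMeasure {N : ℕ} {p : Fin N → ℝ} (hp : ∀ i, 0 ≤ p i) (g : Fin N → ℝ) :
    ∫ i, g i ∂(symbolMeasure p) = ∑ i, p i * g i := by
  rw [symbolMeasure, integral_finsetSum_measure fun i _ =>
    (integrable_dirac (by simp)).smul_measure (by simp)]
  simp [ENNReal.toReal_ofReal (hp _)]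

end SelfAffine

end

noncomputable section

namespace SelfAffine

/-! ### Growth rates of monotone functions -/

/-- Each comparison may lose a factor θ ≠ 1 in the scale. Continuity of F at 1 recovers the exact
limit. -/
lemma tendsto_div_of_bounds {g F : ℝ → ℝ} (hF : ContinuousAt F 1)
    (hlow : ∀ᶠ θ in 𝓝[<] (1 : ℝ), ∃ L : ℝ → ℝ, (∀ᶠ t in atTop, L t ≤ g t) ∧
      Tendsto (fun t => L t / t) atTop (𝓝 (F θ)))
    (hupp : ∀ᶠ θ in 𝓝[>] (1 : ℝ), ∃ U : ℝ → ℝ, (∀ᶠ t in atTop, g t ≤ U t) ∧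
      Tendsto (fun t => U t / t) atTop (𝓝 (F θ))) :
    Tendsto (fun t => g t / t) atTop (𝓝 (F 1)) := by
  refine tendsto_order.2 ⟨fun a ha => ?_, fun a ha => ?_⟩
  · have h1 : ∀ᶠ θ in 𝓝[<] (1 : ℝ), a < F θ :=
      (hF.tendsto.mono_left nhdsWithin_le_nhds).eventually_const_lt ha
    obtain ⟨θ, hθ, L, hL, hLt⟩ := (h1.and hlow).exists
    filter_upwards [hL, hLt.eventually_const_lt hθ, eventually_gt_atTop 0] with t ht1 ht2 ht3
    exact ht2.trans_le (by gcongr)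
  · have h1 : ∀ᶠ θ in 𝓝[>] (1 : ℝ), F θ < a :=
      (hF.tendsto.mono_left nhdsWithin_le_nhds).eventually_lt_const ha
    obtain ⟨θ, hθ, U, hU, hUt⟩ := (h1.and hupp).exists
    filter_upwards [hU, hUt.eventually_lt_const hθ, eventually_gt_atTop 0] with t ht1 ht2 ht3
    exact lt_of_le_of_lt (by gcongr) ht2

lemma tendsto_floor_atTop {a : ℝ} (ha : 0 < a) :
    Tendsto (fun t : ℝ => ⌊a * t⌋₊) atTop atTop :=
  tendsto_nat_floor_atTop.comp (tendsto_id.const_mul_atTop ha)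

lemma tendsto_comp_floor_div {x : ℕ → ℝ} {X a : ℝ} (ha : 0 < a)
    (hx : Tendsto (fun n : ℕ => x n / n) atTop (𝓝 X)) :
    Tendsto (fun t : ℝ => x ⌊a * t⌋₊ / t) atTop (𝓝 (a * X)) := by
  have h1 := (tendsto_nat_floor_mul_div_atTop ha.le).mul (hx.comp (tendsto_floor_atTop ha))
  refine h1.congr' ?_
  filter_upwards [eventually_gt_atTop 0, (tendsto_floor_atTop ha).eventually_gt_atTop 0]
    with t ht hn
  have : ((⌊a * t⌋₊ : ℕ) : ℝ) ≠ 0 := by positivity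
  simp only [Function.comp]
  field_simp

/-- With n = ⌊θt/χ⌋ the value τ n is about θt, hence below t for θ < 1 and above t for θ > 1.
Monotonicity of g then transfers the limit, and τ itself need not be monotone. -/
lemma tendsto_div_of_tendsto_subseq {g : ℝ → ℝ} (hg : Monotone g) {τ : ℕ → ℝ} {χ G : ℝ}
    (hχ : 0 < χ) (hτ : Tendsto (fun n : ℕ => τ n / n) atTop (𝓝 χ))
    (hG : Tendsto (fun n : ℕ => g (τ n) / n) atTop (𝓝 G)) :
    Tendsto (fun t => g t / t) atTop (𝓝 (G / χ)) := by
  have key : Tendsto (fun t => g t / t) atTop (𝓝 ((fun θ => θ / χ * G) 1)) := by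
    refine tendsto_div_of_bounds (F := fun θ => θ / χ * G) (by fun_prop) ?_ ?_
    · filter_upwards [self_mem_nhdsWithin,
        nhdsWithin_le_nhds (lt_mem_nhds (zero_lt_one (α := ℝ)))] with θ hθ hθ0
      have ha : 0 < θ / χ := div_pos hθ0 hχ
      refine ⟨fun t => g (τ ⌊θ / χ * t⌋₊), ?_, tendsto_comp_floor_div ha hG⟩
      have h1 := tendsto_comp_floor_div ha hτ
      rw [div_mul_cancel₀ _ hχ.ne'] at h1
      filter_upwards [h1.eventually_lt_const hθ, eventually_gt_atTop 0] with t ht ht0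
      exact hg ((div_lt_one ht0).1 ht).le
    · filter_upwards [self_mem_nhdsWithin] with θ hθ
      have ha : 0 < θ / χ := div_pos (zero_lt_one.trans hθ) hχ
      refine ⟨fun t => g (τ ⌊θ / χ * t⌋₊), ?_, tendsto_comp_floor_div ha hG⟩
      have h1 := tendsto_comp_floor_div ha hτ
      rw [div_mul_cancel₀ _ hχ.ne'] at h1
      filter_upwards [h1.eventually_const_lt hθ, eventually_gt_atTop 0] with t ht ht0
      exact hg ((one_lt_div ht0).1 ht).le
  convert key using 2
  simp only; ring

/-- The growth rate of a monotone function controlled along two independent scales. -/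
lemma tendsto_div_of_two_scales {g : ℝ → ℝ} (hg : Monotone g) {τ ς P b E : ℕ → ℝ}
    {χ χ' h β c₁ c₂ : ℝ} (hχ : 0 < χ) (hχ' : χ < χ')
    (hτ : Tendsto (fun n : ℕ => τ n / n) atTop (𝓝 χ'))
    (hς : Tendsto (fun n : ℕ => ς n / n) atTop (𝓝 χ))
    (hP : Tendsto (fun n : ℕ => P n / n) atTop (𝓝 h))
    (hb : Tendsto (fun n : ℕ => b n / n) atTop (𝓝 β))
    (hE : Tendsto (fun n : ℕ => E n / n) atTop (𝓝 0))
    (hlow : ∀ n m, n ≤ m → ς m ≤ τ n + c₁ → P n + b m - b n - E m ≤ g (τ n + c₁))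
    (hupp : ∀ n m, n ≤ m → τ n ≤ ς m → g (τ n + c₂) ≤ P n + b m - b n + E m) :
    Tendsto (fun t => g t / t) atTop (𝓝 (h / χ' + (1 - χ / χ') * (β / χ))) := by
  have hχ'0 : 0 < χ' := hχ.trans hχ'
  set F : ℝ → ℝ := fun θ => θ / χ' * h + θ ^ 2 / χ * β - θ / χ' * β
  -- The times are n = ⌊θt/χ'⌋ and m = ⌊θ²t/χ⌋, so that τ n is about θt and ς m about θ²t. The
  -- square makes the comparison of τ n with ς m strict in the direction required on either side of
  -- θ = 1, and χ/χ' < θ ensures n ≤ m.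
  have hlim : ∀ θ : ℝ, χ / χ' < θ →
      (Tendsto (fun t => τ ⌊θ / χ' * t⌋₊ / t) atTop (𝓝 θ)) ∧
      (Tendsto (fun t => ς ⌊θ ^ 2 / χ * t⌋₊ / t) atTop (𝓝 (θ ^ 2))) ∧
      (∀ᶠ t in atTop, ⌊θ / χ' * t⌋₊ ≤ ⌊θ ^ 2 / χ * t⌋₊) ∧
      Tendsto (fun t => (P ⌊θ / χ' * t⌋₊ + b ⌊θ ^ 2 / χ * t⌋₊ - b ⌊θ / χ' * t⌋₊) / t)
        atTop (𝓝 (F θ)) ∧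
      Tendsto (fun t => E ⌊θ ^ 2 / χ * t⌋₊ / t) atTop (𝓝 0) := by
    intro θ hθ
    have hθ0 : 0 < θ := (div_pos hχ hχ'0).trans hθ
    have ha : 0 < θ / χ' := div_pos hθ0 hχ'0
    have ha2 : 0 < θ ^ 2 / χ := by positivity
    refine ⟨?_, ?_, ?_, ?_, ?_⟩
    · simpa [div_mul_cancel₀ _ hχ'0.ne'] using tendsto_comp_floor_div ha hτ
    · simpa [div_mul_cancel₀ _ hχ.ne'] using tendsto_comp_floor_div ha2 hς
    · filter_upwards [eventually_gt_atTop 0] with t ht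
      refine Nat.floor_le_floor ?_
      refine mul_le_mul_of_nonneg_right ?_ ht.le
      rw [div_le_div_iff₀ hχ'0 hχ]
      rw [div_lt_iff₀ hχ'0] at hθ
      nlinarith
    · have := ((tendsto_comp_floor_div ha hP).add (tendsto_comp_floor_div ha2 hb)).sub
        (tendsto_comp_floor_div ha hb)
      refine this.congr fun t => ?_
      ring
    · simpa using tendsto_comp_floor_div ha2 hE
  have hr : χ / χ' < 1 := (div_lt_one hχ'0).2 hχ'
  have hc : ∀ c : ℝ, Tendsto (fun t : ℝ => c / t) atTop (𝓝 0) := fun c =>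
    tendsto_const_nhds.div_atTop tendsto_id
  have key : Tendsto (fun t => g t / t) atTop (𝓝 (F 1)) := by
    refine tendsto_div_of_bounds (by fun_prop) ?_ ?_
    · filter_upwards [self_mem_nhdsWithin, nhdsWithin_le_nhds (lt_mem_nhds hr)] with θ hθ hθ0
      replace hθ : θ < 1 := hθ
      obtain ⟨h1, h2, h3, h4, h5⟩ := hlim θ hθ0
      have hθpos : 0 < θ := (div_pos hχ hχ'0).trans hθ0
      refine ⟨fun t => P ⌊θ / χ' * t⌋₊ + b ⌊θ ^ 2 / χ * t⌋₊ - b ⌊θ / χ' * t⌋₊ -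
        E ⌊θ ^ 2 / χ * t⌋₊, ?_, ?_⟩
      · have h6 := h1.add (hc c₁)
        have h7 := h6.sub h2
        rw [add_zero] at h6 h7
        have h8 : 0 < θ - θ ^ 2 := by nlinarith
        filter_upwards [h3, h6.eventually_lt_const hθ, h7.eventually_const_lt h8,
          eventually_gt_atTop 0] with t ht1 ht2 ht3 ht4
        rw [← add_div, div_lt_one ht4] at ht2
        rw [← add_div, ← sub_div, div_pos_iff_of_pos_right ht4] at ht3
        exact (hlow _ _ ht1 (by linarith)).trans (hg ht2.le)
      · have := h4.sub h5
        rw [sub_zero] at this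
        refine this.congr fun t => ?_
        ring
    · filter_upwards [self_mem_nhdsWithin] with θ hθ
      replace hθ : 1 < θ := hθ
      obtain ⟨h1, h2, h3, h4, h5⟩ := hlim θ (hr.trans hθ)
      refine ⟨fun t => P ⌊θ / χ' * t⌋₊ + b ⌊θ ^ 2 / χ * t⌋₊ - b ⌊θ / χ' * t⌋₊ +
        E ⌊θ ^ 2 / χ * t⌋₊, ?_, ?_⟩
      · have h6 := h1.add (hc c₂)
        have h7 := h2.sub h1
        rw [add_zero] at h6
        have h8 : 0 < θ ^ 2 - θ := by nlinarith
        filter_upwards [h3, h6.eventually_const_lt hθ, h7.eventually_const_lt h8,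
          eventually_gt_atTop 0] with t ht1 ht2 ht3 ht4
        rw [← add_div, one_lt_div ht4] at ht2
        rw [← sub_div, div_pos_iff_of_pos_right ht4] at ht3
        exact (hg ht2.le).trans (hupp _ _ ht1 (by linarith))
      · have := h4.add h5
        rw [add_zero] at this
        refine this.congr fun t => ?_
        ring
  convert key using 2
  simp only [F]; field_simp; ring

/-! ### Local dimensions -/

section LocalDim

/-- `d` is the local dimension of `μ` at the point `z` of its support. -/
def HasLocalDim (μ : Measure Plane) (z : Plane) (d : ℝ) : Prop :=
  (∀ n : ℕ, 0 < μ.real (Metric.closedBall z (Real.exp (-n)))) ∧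
    Tendsto (fun n : ℕ => -Real.log (μ.real (Metric.closedBall z (Real.exp (-n)))) / n) atTop (𝓝 d)

/-- The function `t ↦ -log μ(B(z, e^{-t}))`. -/
def logBall (μ : Measure Plane) (z : Plane) (t : ℝ) : ℝ :=
  -Real.log (μ.real (Metric.closedBall z (Real.exp (-t))))

lemma hasLocalDim_of_tendsto {μ : Measure Plane} {z : Plane} {d : ℝ}
    (h : ∀ n : ℕ, 0 < μ.real (Metric.closedBall z (Real.exp (-n))))
    (ht : Tendsto (fun t => logBall μ z t / t) atTop (𝓝 d)) : HasLocalDim μ z d :=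
  ⟨h, ht.comp tendsto_natCast_atTop_atTop⟩

variable {μ : Measure Plane} [IsProbabilityMeasure μ]

lemma measurable_measureReal_closedBall (r : ℝ) :
    Measurable fun z => μ.real (Metric.closedBall z r) := by
  have h : MeasurableSet {q : Plane × Plane | dist q.2 q.1 ≤ r} :=
    (isClosed_le (by fun_prop) continuous_const).measurableSet
  exact (measurable_measure_prodMk_left h).ennreal_toReal

/-- Only the countably many radii exp(-n) enter the definition of `HasLocalDim`. -/
lemma measurableSet_hasLocalDim (d : ℝ) : MeasurableSet {z | HasLocalDim μ z d} := by
  have h : {z | HasLocalDim μ z d} =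
      (⋂ n : ℕ, {z | 0 < μ.real (Metric.closedBall z (Real.exp (-n)))}) ∩
      {z | Tendsto (fun n : ℕ => -Real.log (μ.real (Metric.closedBall z (Real.exp (-n)))) / n)
        atTop (𝓝 d)} := by
    ext z; simp [HasLocalDim]
  rw [h]
  refine (MeasurableSet.iInter fun n => measurableSet_lt measurable_const
    (measurable_measureReal_closedBall _)).inter (measurableSet_tendsto _ fun n => ?_)
  exact ((measurable_measureReal_closedBall _).log.neg).div_const _

lemma measureReal_closedBall_pos {z : Plane}
    (h : ∀ n : ℕ, 0 < μ.real (Metric.closedBall z (Real.exp (-n)))) (t : ℝ) :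
    0 < μ.real (Metric.closedBall z (Real.exp (-t))) := by
  obtain ⟨n, hn⟩ := exists_nat_ge t
  refine (h n).trans_le (measureReal_mono (Metric.closedBall_subset_closedBall ?_))
  gcongr

lemma logBall_mono {z : Plane} (h : ∀ n : ℕ, 0 < μ.real (Metric.closedBall z (Real.exp (-n)))) :
    Monotone (logBall μ z) := by
  intro s t hst
  refine neg_le_neg (Real.log_le_log (measureReal_closedBall_pos h t)
    (measureReal_mono (Metric.closedBall_subset_closedBall ?_)))
  gcongr

lemma HasLocalDim.tendsto_log_div_log {z : Plane} {d : ℝ} (h : HasLocalDim μ z d) :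
    Tendsto (fun r : ℝ => Real.log (μ.real (Metric.closedBall z r)) / Real.log r)
      (𝓝[>] 0) (𝓝 d) := by
  have h1 : Tendsto (fun t => logBall μ z t / t) atTop (𝓝 (d / 1)) := by
    refine tendsto_div_of_tendsto_subseq (logBall_mono h.1) (τ := fun n => n) one_pos ?_ h.2
    refine tendsto_const_nhds.congr' ?_
    filter_upwards [eventually_gt_atTop 0] with n hn
    have : (n : ℝ) ≠ 0 := by positivity
    field_simp
  rw [div_one] at h1
  have h2 : Tendsto (fun r : ℝ => -Real.log r) (𝓝[>] 0) atTop :=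
    tendsto_neg_atBot_atTop.comp Real.tendsto_log_nhdsGT_zero
  refine (h1.comp h2).congr' ?_
  filter_upwards [self_mem_nhdsWithin] with r hr
  simp only [Function.comp, logBall, neg_neg, Real.exp_log hr]
  rw [neg_div_neg_eq]

lemma HasLocalDim.nonneg {z : Plane} {d : ℝ} (h : HasLocalDim μ z d) : 0 ≤ d := by
  refine ge_of_tendsto' h.2 fun n => div_nonneg (neg_nonneg.2 ?_) (Nat.cast_nonneg n)
  exact Real.log_nonpos measureReal_nonneg measureReal_le_one

/-- Mass distribution principle: for s < d some set G n of points with mass at most exp(-ks) at all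
scales k ≥ n has positive measure, and μ restricted to it is dominated by a multiple of the
s-dimensional Hausdorff measure. -/
lemma ofReal_le_dimH {d : ℝ} (h : ∀ᵐ z ∂μ, HasLocalDim μ z d) {S : Set Plane} (hS : μ Sᶜ = 0) :
    ENNReal.ofReal d ≤ dimH S := by
  refine ENNReal.le_of_forall_nnreal_lt fun s hs => ?_
  rcases eq_or_ne s 0 with rfl | hs0
  · simp
  have hspos : (0 : ℝ) < s := by positivity
  have hsd : (s : ℝ) < d := by
    rw [← ENNReal.ofReal_coe_nnreal] at hs
    exact (ENNReal.ofReal_lt_ofReal_iff_of_nonneg s.2).1 hs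
  set G : ℕ → Set Plane := fun n =>
    {z | ∀ k ≥ n, μ.real (Metric.closedBall z (Real.exp (-(k : ℝ)))) ≤ Real.exp (-(k * s))}
  have hGm : ∀ n, MeasurableSet (G n) := by
    intro n
    have : G n = ⋂ k : ℕ, ⋂ _ : k ≥ n,
        {z | μ.real (Metric.closedBall z (Real.exp (-(k : ℝ)))) ≤ Real.exp (-(k * s))} := by
      ext; simp [G]
    rw [this]
    exact MeasurableSet.iInter fun k => MeasurableSet.iInter fun _ =>
      measurableSet_le (measurable_measureReal_closedBall _) measurable_const
  have hGU : ∀ᵐ z ∂μ, z ∈ ⋃ n, G n := by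
    filter_upwards [h] with z hz
    obtain ⟨n, hn⟩ := eventually_atTop.1 ((hz.2.eventually_const_lt hsd).and
      (eventually_gt_atTop 0))
    refine Set.mem_iUnion.2 ⟨n, fun k hk => ?_⟩
    obtain ⟨h1, h2⟩ := hn k hk
    have h2' : (0 : ℝ) < k := by exact_mod_cast h2
    rw [lt_div_iff₀ h2'] at h1
    rw [← Real.log_le_iff_le_exp (hz.1 k)]
    linarith
  obtain ⟨n, hn⟩ : ∃ n, μ (G n) ≠ 0 := by
    by_contra! h0
    have h1 := measure_iUnion_null h0
    have h2 := (prob_compl_eq_zero_iff (MeasurableSet.iUnion hGm)).1 hGU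
    rw [h1] at h2
    exact zero_ne_one h2
  refine le_dimH_of_hausdorffMeasure_ne_zero ?_
  -- The factor exp(-s) pays for rounding the logarithmic scale of a set down to an integer.
  set c : ℝ≥0∞ := ENNReal.ofReal (Real.exp (-s))
  have hc : c ≠ 0 := by simp [c, Real.exp_pos]
  have hle : c • μ.restrict (G n) ≤ μH[s] := by
    refine Measure.le_hausdorffMeasure _ _ (ENNReal.ofReal (Real.exp (-n)))
      (by simp [Real.exp_pos]) fun U hU => ?_
    rw [Measure.smul_apply, Measure.restrict_apply' (hGm n), smul_eq_mul]
    rcases (U ∩ G n).eq_empty_or_nonempty with he | ⟨z, hzU, hzG⟩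
    · rw [he]; simp
    have hsub : ∀ k : ℕ, Metric.ediam U ≤ ENNReal.ofReal (Real.exp (-(k : ℝ))) →
        U ∩ G n ⊆ Metric.closedBall z (Real.exp (-(k : ℝ))) := by
      intro k hk y hy
      rw [Metric.mem_closedBall, ← ENNReal.ofReal_le_ofReal_iff (Real.exp_pos _).le, ← edist_dist]
      exact (Metric.edist_le_ediam_of_mem hy.1 hzU).trans hk
    have hmeas : ∀ k : ℕ, n ≤ k → Metric.ediam U ≤ ENNReal.ofReal (Real.exp (-(k : ℝ))) →
        μ (U ∩ G n) ≤ ENNReal.ofReal (Real.exp (-(k * s))) := by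
      intro k hk hk'
      refine (measure_mono (hsub k hk')).trans ?_
      rw [← ofReal_measureReal]
      exact ENNReal.ofReal_le_ofReal (hzG k hk)
    -- A set of diameter 0 lies in balls of all scales around z, so its part in G n has mass 0
    -- because s > 0.
    rcases eq_or_ne (Metric.ediam U) 0 with h0 | h0
    · have h1 : μ (U ∩ G n) ≤ 0 := by
        have h2 : Tendsto (fun k : ℕ => ENNReal.ofReal (Real.exp (-(k * s)))) atTop (𝓝 0) := by
          rw [← ENNReal.ofReal_zero]
          refine ENNReal.tendsto_ofReal ?_
          refine Real.tendsto_exp_neg_atTop_nhds_zero.comp ?_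
          exact tendsto_natCast_atTop_atTop.atTop_mul_const hspos
        refine ge_of_tendsto h2 ?_
        filter_upwards [eventually_ge_atTop n] with k hk
        exact hmeas k hk (by rw [h0]; exact zero_le)
      rw [nonpos_iff_eq_zero.1 h1]
      simp
    · have htop : Metric.ediam U ≠ ∞ := ne_top_of_le_ne_top ENNReal.ofReal_ne_top hU
      set x := (Metric.ediam U).toReal
      have hx : Metric.ediam U = ENNReal.ofReal x := (ENNReal.ofReal_toReal htop).symm
      have hx0 : 0 < x := ENNReal.toReal_pos h0 htop
      rw [hx, ENNReal.ofReal_le_ofReal_iff (Real.exp_pos _).le] at hU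
      have hlog : (n : ℝ) ≤ -Real.log x := by
        have := Real.log_le_log hx0 hU
        rw [Real.log_exp] at this
        linarith
      set k := ⌊-Real.log x⌋₊
      have hnk : n ≤ k := Nat.le_floor hlog
      have hk1 : (k : ℝ) ≤ -Real.log x := Nat.floor_le ((Nat.cast_nonneg n).trans hlog)
      have hk2 : -Real.log x < k + 1 := Nat.lt_floor_add_one _
      have h1 : x ≤ Real.exp (-(k : ℝ)) := by
        rw [← Real.log_le_iff_le_exp hx0]; linarith
      have h2 := hmeas k hnk (by rw [hx]; exact ENNReal.ofReal_le_ofReal h1)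
      calc c * μ (U ∩ G n) ≤ c * ENNReal.ofReal (Real.exp (-(k * s))) := by gcongr
        _ = ENNReal.ofReal (Real.exp (-s + -(k * s))) := by
          rw [← ENNReal.ofReal_mul (Real.exp_pos _).le, ← Real.exp_add]
        _ ≤ ENNReal.ofReal (x ^ (s : ℝ)) := by
          refine ENNReal.ofReal_le_ofReal ?_
          rw [Real.rpow_def_of_pos hx0]
          gcongr
          nlinarith
        _ = _ := by rw [hx, ENNReal.ofReal_rpow_of_pos hx0]
  have h3 : (c • μ.restrict (G n)) S ≤ μH[s] S := hle S
  intro h0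
  rw [h0, nonpos_iff_eq_zero, Measure.smul_apply, smul_eq_mul, mul_eq_zero,
    or_iff_right hc, Measure.restrict_apply' (hGm n)] at h3
  refine hn ?_
  refine measure_mono_null (t := (S ∩ G n) ∪ Sᶜ) (fun z hz => ?_) (measure_union_null h3 hS)
  by_cases hzS : z ∈ S
  · exact Or.inl ⟨hzS, hz⟩
  · exact Or.inr hzS

/-- A 2r-separated subset of S of maximal cardinality: its r-balls are disjoint and have mass at
least a, while maximality makes the 2r-balls cover. -/
lemma exists_finset_cover {S : Set Plane} {r a : ℝ} (ha : 0 < a)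
    (hS : ∀ z ∈ S, a ≤ μ.real (Metric.closedBall z r)) :
    ∃ u : Finset Plane, (u.card : ℝ) ≤ a⁻¹ ∧ S ⊆ ⋃ z : u, Metric.closedBall (z : Plane) (2 * r) := by
  classical
  set 𝒰 : Set (Finset Plane) := {u | (∀ z ∈ u, z ∈ S) ∧
    (u : Set Plane).Pairwise fun y z => 2 * r < dist y z}
  have hcard : ∀ u ∈ 𝒰, (u.card : ℝ) ≤ a⁻¹ := by
    rintro u ⟨hu1, hu2⟩
    have h1 : ∑ z ∈ u, μ.real (Metric.closedBall z r) ≤ 1 := by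
      rw [← measureReal_biUnion_finset]
      · exact measureReal_le_one
      · intro y hy z hz hyz
        exact Metric.closedBall_disjoint_closedBall (by have := hu2 hy hz hyz; linarith)
      · exact fun z _ => Metric.isClosed_closedBall.measurableSet
    have h2 : (u.card : ℝ) * a ≤ 1 := by
      refine le_trans ?_ h1
      rw [← nsmul_eq_mul]
      exact Finset.card_nsmul_le_sum _ _ _ fun z hz => hS z (hu1 z hz)
    rwa [← one_div, le_div_iff₀ ha]
  have hne : (Finset.card '' 𝒰).Nonempty := ⟨0, ∅, by simp [𝒰], rfl⟩
  have hbdd : BddAbove (Finset.card '' 𝒰) := by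
    obtain ⟨K, hK⟩ := exists_nat_ge a⁻¹
    refine ⟨K, ?_⟩
    rintro _ ⟨u, hu, rfl⟩
    exact_mod_cast (hcard u hu).trans hK
  obtain ⟨u, hu, hmax⟩ := Nat.sSup_mem hne hbdd
  refine ⟨u, hcard u hu, fun z hz => ?_⟩
  by_contra hcon
  simp only [Set.mem_iUnion, Metric.mem_closedBall, not_exists, not_le, Subtype.forall] at hcon
  -- A point of u lies in its own 2r-ball unless r is negative, and then its r-ball is empty and
  -- cannot have mass a.
  have hzu : z ∉ u := by
    intro h
    have h1 := hcon z h
    rw [dist_self] at h1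
    have h2 : Metric.closedBall z r = ∅ := Metric.closedBall_eq_empty.2 (by linarith)
    have h3 := hS z hz
    rw [h2] at h3
    simp at h3
    linarith
  have h1 : insert z u ∈ 𝒰 := by
    refine ⟨fun y hy => ?_, ?_⟩
    · rcases Finset.mem_insert.1 hy with rfl | hy
      · exact hz
      · exact hu.1 y hy
    · rw [Finset.coe_insert]
      refine hu.2.insert fun y hy _ => ⟨hcon y hy, ?_⟩
      rw [dist_comm]; exact hcon y hy
  have h2 := le_csSup hbdd ⟨_, h1, rfl⟩
  rw [Finset.card_insert_of_notMem hzu, ← hmax] at h2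
  omega

/-- For s > d the set is a countable union of sets G n whose points have mass at least exp(-ks) at
every scale k ≥ n. Such a set is covered by at most exp(ks) balls of diameter at most 4 exp(-k), so
the sums defining its s-dimensional measure stay below 4^s. -/
lemma dimH_hasLocalDim_le (d : ℝ) : dimH {z | HasLocalDim μ z d} ≤ ENNReal.ofReal d := by
  by_contra! hlt
  obtain ⟨s, hs, hs'⟩ := ENNReal.lt_iff_exists_nnreal_btwn.1 hlt
  refine hs'.not_ge ?_
  have hsd : d < s := by
    rw [← ENNReal.ofReal_coe_nnreal] at hs
    exact lt_of_not_ge fun h => hs.not_ge (ENNReal.ofReal_le_ofReal h)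
  set G : ℕ → Set Plane := fun n =>
    {z | ∀ k ≥ n, Real.exp (-(k * s)) ≤ μ.real (Metric.closedBall z (Real.exp (-(k : ℝ))))}
  have hsub : {z | HasLocalDim μ z d} ⊆ ⋃ n, G n := by
    intro z hz
    obtain ⟨n, hn⟩ := eventually_atTop.1 ((hz.2.eventually_lt_const hsd).and
      (eventually_gt_atTop 0))
    refine Set.mem_iUnion.2 ⟨n, fun k hk => ?_⟩
    obtain ⟨h1, h2⟩ := hn k hk
    have h2' : (0 : ℝ) < k := by exact_mod_cast h2
    rw [div_lt_iff₀ h2'] at h1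
    rw [← Real.le_log_iff_exp_le (hz.1 k)]
    linarith
  refine (dimH_mono hsub).trans ?_
  rw [dimH_iUnion]
  refine iSup_le fun n => dimH_le_of_hausdorffMeasure_ne_top ?_
  have hcov : ∀ k : ℕ, ∃ u : Finset Plane, n ≤ k → (u.card : ℝ) ≤ (Real.exp (-(k * s)))⁻¹ ∧
      G n ⊆ ⋃ z : u, Metric.closedBall (z : Plane) (2 * Real.exp (-(k : ℝ))) := by
    intro k
    by_cases hk : n ≤ k
    · obtain ⟨u, hu⟩ := exists_finset_cover (μ := μ) (S := G n) (Real.exp_pos (-(k * s)))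
        fun z hz => hz k hk
      exact ⟨u, fun _ => hu⟩
    · exact ⟨∅, fun h => absurd h hk⟩
  choose u hu using hcov
  have hr : Tendsto (fun k : ℕ => ENNReal.ofReal (4 * Real.exp (-(k : ℝ)))) atTop (𝓝 0) := by
    rw [← ENNReal.ofReal_zero]
    refine ENNReal.tendsto_ofReal ?_
    have := (Real.tendsto_exp_neg_atTop_nhds_zero.comp
      (tendsto_natCast_atTop_atTop (R := ℝ))).const_mul 4
    simpa using this
  have hdiam : ∀ (k : ℕ) (z : Plane), Metric.ediam (Metric.closedBall z (2 * Real.exp (-(k : ℝ)))) ≤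
      ENNReal.ofReal (4 * Real.exp (-(k : ℝ))) := by
    intro k z
    refine Metric.ediam_le fun x hx y hy => ?_
    rw [edist_dist]
    refine ENNReal.ofReal_le_ofReal ?_
    have := dist_triangle_right x y z
    have := Metric.mem_closedBall.1 hx
    have := Metric.mem_closedBall.1 hy
    linarith
  have h1 := Measure.hausdorffMeasure_le_liminf_sum (s : ℝ) (G n) _ hr
    (fun k (z : u k) => Metric.closedBall (z : Plane) (2 * Real.exp (-(k : ℝ))))
    (Eventually.of_forall fun k z => hdiam k z)
    (by filter_upwards [eventually_ge_atTop n] with k hk using (hu k hk).2)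
  refine ne_top_of_le_ne_top ?_ (h1.trans (liminf_le_of_frequently_le' (x := ENNReal.ofReal (4 ^ (s : ℝ)))
    (Eventually.frequently ?_)))
  · exact ENNReal.ofReal_ne_top
  filter_upwards [eventually_ge_atTop n] with k hk
  have hk1 := (hu k hk).1
  calc ∑ z : u k, Metric.ediam (Metric.closedBall (z : Plane) (2 * Real.exp (-(k : ℝ)))) ^ (s : ℝ)
      ≤ ∑ _z : u k, ENNReal.ofReal (4 * Real.exp (-(k : ℝ))) ^ (s : ℝ) := by
        gcongr; exact hdiam k _
    _ = (u k).card * ENNReal.ofReal ((4 * Real.exp (-(k : ℝ))) ^ (s : ℝ)) := by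
        rw [ENNReal.ofReal_rpow_of_pos (by positivity)]; simp
    _ = ENNReal.ofReal ((u k).card * (4 * Real.exp (-(k : ℝ))) ^ (s : ℝ)) := by
        rw [ENNReal.ofReal_mul (by positivity), ENNReal.ofReal_natCast]
    _ ≤ _ := by
        refine ENNReal.ofReal_le_ofReal ?_
        rw [Real.mul_rpow (by norm_num) (Real.exp_pos _).le, ← Real.exp_mul, neg_mul]
        calc _ ≤ (Real.exp (-(k * s)))⁻¹ * (4 ^ (s : ℝ) * Real.exp (-(k * s))) := by gcongr
          _ = _ := by field_simp

/-- If the local dimension is almost surely constant, then it is the dimension of the measure. -/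
theorem dimHMeasure_eq_of_hasLocalDim {d : ℝ} (h : ∀ᵐ z ∂μ, HasLocalDim μ z d) :
    dimHMeasure μ = ENNReal.ofReal d :=
  le_antisymm ((iInf₂_le (α := ℝ≥0∞) {z | HasLocalDim μ z d} h).trans (dimH_hasLocalDim_le d))
    (le_iInf₂ fun _ hS => ofReal_le_dimH h hS)

theorem isExactDimensional_of_hasLocalDim {d : ℝ} (h : ∀ᵐ z ∂μ, HasLocalDim μ z d) :
    IsExactDimensional μ := by
  have hd := dimHMeasure_eq_of_hasLocalDim h
  refine ⟨by rw [hd]; exact ENNReal.ofReal_ne_top, ?_⟩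
  filter_upwards [h] with z hz
  rw [hd, ENNReal.toReal_ofReal hz.nonneg]
  exact hz.tendsto_log_div_log

end LocalDim

end SelfAffine

end

noncomputable section

namespace SelfAffine

/-! ### A maximal inequality for quotients of measures on the line -/

/-- The **maximal inequality** for the quotients of two measures on the line, centred at points
distributed according to one of them. -/
lemma exists_maximal_inequality : ∃ K : ℕ, ∀ (ρ m : Measure ℝ) (r₀ : ℝ) (t : ℝ≥0∞),
    ρ {z | ∃ r, 0 < r ∧ r ≤ r₀ ∧ ρ (Metric.closedBall z r) ≤ t * m (Metric.closedBall z r)} ≤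
      K * (t * m Set.univ) := by
  -- The Besicovitch covering splits into K disjoint families, with K depending only on the line. No
  -- doubling property of the measures is therefore needed.
  obtain ⟨K, τ, hτ, hK⟩ := HasBesicovitchCovering.no_satelliteConfig (α := ℝ)
  refine ⟨K, fun ρ m r₀ t => ?_⟩
  set E := {z | ∃ r, 0 < r ∧ r ≤ r₀ ∧ ρ (Metric.closedBall z r) ≤ t * m (Metric.closedBall z r)}
  choose r hr0 hr1 hr2 using fun z : E => z.2
  let q : Besicovitch.BallPackage E ℝ := ⟨fun z => z, r, hr0, r₀, hr1⟩
  obtain ⟨s, hs, hcov⟩ := Besicovitch.exist_disjoint_covering_families hτ hK q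
  have hcount : ∀ i, (s i).Countable := fun i =>
    (hs i).countable_of_nonempty_interior fun z _ => by
      have : (Metric.ball (z : ℝ) (r z)).Nonempty := Metric.nonempty_ball.2 (hr0 z)
      exact this.mono Metric.ball_subset_interior_closedBall
  have hE : E ⊆ ⋃ i : Fin K, ⋃ z ∈ s i, Metric.closedBall (z : ℝ) (r z) := by
    intro z hz
    have h1 := hcov ⟨⟨z, hz⟩, rfl⟩
    simp only [Set.mem_iUnion] at h1 ⊢
    obtain ⟨i, y, hy, hzy⟩ := h1
    exact ⟨i, y, hy, Metric.ball_subset_closedBall hzy⟩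
  calc ρ E ≤ ρ (⋃ i : Fin K, ⋃ z ∈ s i, Metric.closedBall (z : ℝ) (r z)) := measure_mono hE
    _ ≤ ∑ i : Fin K, ρ (⋃ z ∈ s i, Metric.closedBall (z : ℝ) (r z)) :=
      measure_iUnion_fintype_le _ _
    _ ≤ ∑ _i : Fin K, t * m Set.univ := by
      refine Finset.sum_le_sum fun i _ => ?_
      calc ρ (⋃ z ∈ s i, Metric.closedBall (z : ℝ) (r z))
          ≤ ∑' z : s i, ρ (Metric.closedBall ((z : E) : ℝ) (r z)) :=
            measure_biUnion_le _ (hcount i) _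
        _ ≤ ∑' z : s i, t * m (Metric.closedBall ((z : E) : ℝ) (r z)) :=
            ENNReal.tsum_le_tsum fun z => hr2 _
        _ = t * m (⋃ z ∈ s i, Metric.closedBall (z : ℝ) (r z)) := by
            rw [ENNReal.tsum_mul_left, measure_biUnion (hcount i) (hs i)
              fun z _ => Metric.isClosed_closedBall.measurableSet]
        _ ≤ t * m Set.univ := by gcongr; exact Set.subset_univ _
    _ = K * (t * m Set.univ) := by simp

/-- A function with exponentially small tails is integrable. -/
lemma lintegral_ne_top_of_tail {Ω : Type*} [MeasurableSpace Ω] {μ : Measure Ω} {f : Ω → ℝ≥0∞}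
    (hf : Measurable f) {C : ℝ≥0∞} (hC : C ≠ ∞)
    (h : ∀ k : ℕ, μ {x | (k : ℝ≥0∞) < f x} ≤ C * ENNReal.ofReal (Real.exp (-k))) :
    ∫⁻ x, f x ∂μ ≠ ∞ := by
  -- Layer cake over the integers: every integer k below f x contributes 1.
  have hle : ∀ x, f x ≤ ∑' k : ℕ, Set.indicator {x | (k : ℝ≥0∞) < f x} (fun _ => (1 : ℝ≥0∞)) x := by
    intro x
    refine ENNReal.le_of_forall_nnreal_lt fun r hr => ?_
    set n := ⌈r⌉₊
    calc (r : ℝ≥0∞) ≤ (n : ℝ≥0∞) := by exact_mod_cast Nat.le_ceil r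
      _ = ∑ k ∈ Finset.range n,
          Set.indicator {x | (k : ℝ≥0∞) < f x} (fun _ => (1 : ℝ≥0∞)) x := by
        rw [Finset.sum_congr rfl (g := fun _ => (1 : ℝ≥0∞))]
        · simp
        · intro k hk
          refine Set.indicator_of_mem ?_ _
          have h1 : (k : NNReal) < r := Nat.lt_ceil.1 (Finset.mem_range.1 hk)
          refine lt_trans ?_ hr
          exact_mod_cast h1
      _ ≤ _ := ENNReal.sum_le_tsum _
  have hm : ∀ k : ℕ, MeasurableSet {x | (k : ℝ≥0∞) < f x} := fun k =>
    measurableSet_lt measurable_const hf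
  refine ne_top_of_le_ne_top ?_ (lintegral_mono hle)
  rw [lintegral_tsum fun k => (measurable_const.indicator (hm k)).aemeasurable]
  have h1 : ∀ k : ℕ, ∫⁻ x, Set.indicator {x | (k : ℝ≥0∞) < f x} (fun _ => (1 : ℝ≥0∞)) x ∂μ ≤
      C * ENNReal.ofReal (Real.exp (-1) ^ k) := by
    intro k
    rw [lintegral_indicator_const (hm k), one_mul]
    refine (h k).trans_eq ?_
    rw [← Real.exp_nat_mul]; simp
  refine ne_top_of_le_ne_top ?_ (ENNReal.tsum_le_tsum h1)
  rw [ENNReal.tsum_mul_left]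
  refine ENNReal.mul_ne_top hC ?_
  have hs : Summable fun k : ℕ => Real.exp (-1) ^ k :=
    summable_geometric_of_lt_one (Real.exp_pos _).le (by simp)
  rw [← ENNReal.ofReal_tsum_of_nonneg (fun k => by positivity) hs]
  exact ENNReal.ofReal_ne_top

end SelfAffine

end

noncomputable section

namespace SelfAffine

/-! ### The splitting in terms of unit vectors -/

section SplitVectors

variable {N : ℕ} {A : Fin N → Matrix (Fin 2) (Fin 2) ℝ} {u v : (ℤ → Fin N) → Plane}

/-- Unit vectors spanning the strong stable (`u`) and the stable (`v`) directions. -/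
structure SplitVectors (A : Fin N → Matrix (Fin 2) (Fin 2) ℝ) (u v : (ℤ → Fin N) → Plane) :
    Prop where
  det : ∀ i, (A i).det ≠ 0
  contr : ∀ i, ‖act (A i)‖ < 1
  norm_u : ∀ j, ‖u j‖ = 1
  norm_v : ∀ j, ‖v j‖ = 1
  cross_u : ∀ j, cross (act (A (j 0)) (u j)) (u (shift j)) = 0
  cross_v : ∀ j, cross (act (A (j 0)) (v j)) (v (shift j)) = 0
  dominated : ∃ C δ : ℝ, 0 < C ∧ 0 < δ ∧ ∀ (j : ℤ → Fin N) (n : ℕ), 1 ≤ n →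
    C * Real.exp (δ * n) ≤ ‖act (cocycle A j n) (v j)‖ / ‖act (cocycle A j n) (u j)‖

lemma IsSplitting.exists_splitVectors {es ess : (ℤ → Fin N) → Submodule ℝ Plane}
    (h : IsSplitting A es ess) (hdet : ∀ i, (A i).det ≠ 0) (hcontr : ∀ i, ‖act (A i)‖ < 1) :
    ∃ u v, SplitVectors A u v ∧ (∀ j, ess j = Submodule.span ℝ {u j}) ∧
      ∀ j, es j = Submodule.span ℝ {v j} := by
  choose u hu hu' using fun j => exists_unit_span (h.finrank_ss j)
  choose v hv hv' using fun j => exists_unit_span (h.finrank_s j)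
  have key : ∀ {e : (ℤ → Fin N) → Submodule ℝ Plane} {w : (ℤ → Fin N) → Plane},
      (∀ j, e j = Submodule.span ℝ {w j}) →
      (∀ j, (e j).map (act (A (j 0)) : Plane →ₗ[ℝ] Plane) = e (shift j)) →
      ∀ j, cross (act (A (j 0)) (w j)) (w (shift j)) = 0 := by
    intro e w he hm j
    have h1 : act (A (j 0)) (w j) ∈ e (shift j) := by
      rw [← hm j]
      exact Submodule.mem_map_of_mem (by rw [he]; exact Submodule.mem_span_singleton_self _)
    rw [he] at h1
    obtain ⟨a, ha⟩ := Submodule.mem_span_singleton.1 h1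
    rw [← ha, cross_smul_left, cross_self, mul_zero]
  refine ⟨u, v, ⟨hdet, hcontr, hu, hv, key hu' h.map_ss, key hv' h.map_s, ?_⟩, hu', hv'⟩
  obtain ⟨C, δ, hC, hδ, hd⟩ := h.dominated
  refine ⟨C, δ, hC, hδ, fun j n hn => ?_⟩
  have := hd j n hn
  rwa [hu', hv', restrictNorm_span _ (hv j), restrictNorm_span _ (hu j)] at this

/-- The contraction along the strong stable direction. -/
def strongNorm (A : Fin N → Matrix (Fin 2) (Fin 2) ℝ) (u : (ℤ → Fin N) → Plane) (n : ℕ)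
    (j : ℤ → Fin N) : ℝ := ‖act (cocycle A j n) (u j)‖

/-- The contraction transversally to the strong stable direction. -/
def transNorm (A : Fin N → Matrix (Fin 2) (Fin 2) ℝ) (u : (ℤ → Fin N) → Plane) (n : ℕ)
    (j : ℤ → Fin N) : ℝ := |(cocycle A j n).det| / strongNorm A u n j

lemma exists_det_bound (hdet : ∀ i, (A i).det ≠ 0) :
    ∃ d : ℝ, 0 < d ∧ d ≤ 1 ∧ ∀ i, d ≤ |(A i).det| := by
  rcases isEmpty_or_nonempty (Fin N) with hN | hN
  · exact ⟨1, one_pos, le_rfl, fun i => (hN.false i).elim⟩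
  obtain ⟨i₀, hi₀⟩ := Finite.exists_min fun i => |(A i).det|
  exact ⟨min 1 |(A i₀).det|, lt_min one_pos (abs_pos.2 (hdet _)), min_le_left _ _,
    fun i => (min_le_right _ _).trans (hi₀ i)⟩

lemma exists_contraction_bound (hcontr : ∀ i, ‖act (A i)‖ < 1) :
    ∃ ρ : ℝ, 0 < ρ ∧ ρ < 1 ∧ ∀ i, ‖act (A i)‖ ≤ ρ := by
  rcases isEmpty_or_nonempty (Fin N) with hN | hN
  · exact ⟨1 / 2, by norm_num, by norm_num, fun i => (hN.false i).elim⟩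
  obtain ⟨i₀, hi₀⟩ := Finite.exists_max fun i => ‖act (A i)‖
  exact ⟨max (1 / 2) ‖act (A i₀)‖, lt_max_of_lt_left (by norm_num),
    max_lt (by norm_num) (hcontr _), fun i => (hi₀ i).trans (le_max_right _ _)⟩

lemma norm_cocycle_le {ρ : ℝ} (hρ : ∀ i, ‖act (A i)‖ ≤ ρ) (j : ℤ → Fin N) (n : ℕ) :
    ‖act (cocycle A j n)‖ ≤ ρ ^ n := by
  induction n with
  | zero => simp [cocycle]
  | succ n ih =>
    rw [cocycle, pow_succ']
    exact (norm_act_mul_le _ _).trans (mul_le_mul (hρ _) ih (norm_nonneg _)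
      ((norm_nonneg _).trans (hρ (j n))))

lemma pow_le_abs_det_cocycle {d : ℝ} (hd0 : 0 < d) (hd : ∀ i, d ≤ |(A i).det|) (j : ℤ → Fin N)
    (n : ℕ) : d ^ n ≤ |(cocycle A j n).det| := by
  induction n with
  | zero => simp [cocycle]
  | succ n ih =>
    rw [cocycle, Matrix.det_mul, abs_mul, pow_succ']
    exact mul_le_mul (hd _) ih (by positivity) (abs_nonneg _)

namespace SplitVectors

lemma det_cocycle (h : SplitVectors A u v) (j : ℤ → Fin N) (n : ℕ) : (cocycle A j n).det ≠ 0 :=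
  det_cocycle_ne_zero h.det j n

lemma norm_cocycle_le_one (h : SplitVectors A u v) (j : ℤ → Fin N) (n : ℕ) :
    ‖act (cocycle A j n)‖ ≤ 1 := by
  simpa using norm_cocycle_le (fun i => (h.contr i).le) j n

lemma strongNorm_pos (h : SplitVectors A u v) (n : ℕ) (j : ℤ → Fin N) : 0 < strongNorm A u n j :=
  norm_pos_iff.2 (act_ne_zero (h.det_cocycle j n)
    (fun h0 => by have := h.norm_u j; rw [h0] at this; simp at this))

lemma transNorm_pos (h : SplitVectors A u v) (n : ℕ) (j : ℤ → Fin N) : 0 < transNorm A u n j :=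
  div_pos (abs_pos.2 (h.det_cocycle j n)) (h.strongNorm_pos n j)

lemma transNorm_mul_strongNorm (h : SplitVectors A u v) (n : ℕ) (j : ℤ → Fin N) :
    transNorm A u n j * strongNorm A u n j = |(cocycle A j n).det| :=
  div_mul_cancel₀ _ (h.strongNorm_pos n j).ne'

lemma strongNorm_le_norm (h : SplitVectors A u v) (n : ℕ) (j : ℤ → Fin N) :
    strongNorm A u n j ≤ ‖act (cocycle A j n)‖ := by
  have := (act (cocycle A j n)).le_opNorm (u j)
  rw [h.norm_u, mul_one] at this
  exact this

lemma transNorm_le_norm (h : SplitVectors A u v) (n : ℕ) (j : ℤ → Fin N) :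
    transNorm A u n j ≤ ‖act (cocycle A j n)‖ := by
  rw [transNorm, div_le_iff₀ (h.strongNorm_pos n j)]
  have := det_mul_norm_le (cocycle A j n) (u j)
  rw [h.norm_u, mul_one] at this
  exact this

/-- The unit vectors are chosen without regard to sign, so equivariance holds only up to a scalar,
whose absolute value is the norm. -/
lemma cross_cocycle {w : (ℤ → Fin N) → Plane} (hw : ∀ j, ‖w j‖ = 1)
    (h : ∀ j, cross (act (A (j 0)) (w j)) (w (shift j)) = 0) (n : ℕ) (j : ℤ → Fin N) :
    ∃ a : ℝ, act (cocycle A j n) (w j) = a • w (shiftBy n j) ∧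
      |a| = ‖act (cocycle A j n) (w j)‖ := by
  have key : ∃ a : ℝ, act (cocycle A j n) (w j) = a • w (shiftBy n j) := by
    induction n with
    | zero =>
      refine ⟨1, ?_⟩
      rw [one_smul, Nat.cast_zero, shiftBy_zero, cocycle, act_one_apply]
    | succ n ih =>
      obtain ⟨a, ha⟩ := ih
      have h1 := h (shiftBy n j)
      have h2 := eq_smul_of_cross_eq_zero (hw _) h1
      rw [shift_eq_shiftBy, shiftBy_shiftBy] at h2
      have e1 : (shiftBy n j) 0 = j n := by simp [shiftBy]
      have e2 : (1 + n : ℤ) = ((n + 1 : ℕ) : ℤ) := by push_cast; ring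
      rw [e1, e2] at h2
      refine ⟨a * (inner ℝ (w (shiftBy (n + 1 : ℕ) j)) (act (A (j n)) (w (shiftBy n j)))), ?_⟩
      rw [cocycle, act_mul_apply, ha, map_smul, mul_smul, ← h2]
  obtain ⟨a, ha⟩ := key
  exact ⟨a, ha, by rw [ha, norm_smul, hw, mul_one, Real.norm_eq_abs]⟩

/-- A product multiplies areas by its determinant and lengths along the strong stable line by
`strongNorm`, so the distance to that line is multiplied exactly by their quotient. This exactness
makes `transNorm` a multiplicative cocycle. -/
lemma abs_cross_act_cocycle (h : SplitVectors A u v) (n : ℕ) (j : ℤ → Fin N) (x : Plane) :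
    |cross (act (cocycle A j n) x) (u (shiftBy n j))| = transNorm A u n j * |cross x (u j)| := by
  obtain ⟨a, ha, ha'⟩ := cross_cocycle h.norm_u h.cross_u n j
  have h1 := cross_act (cocycle A j n) x (u j)
  rw [ha, cross_smul_right] at h1
  have h2 := congrArg abs h1
  rw [abs_mul, abs_mul, ha'] at h2
  rw [transNorm, div_mul_eq_mul_div, eq_div_iff (h.strongNorm_pos n j).ne', ← h2]
  exact mul_comm _ _

lemma strongNorm_add (h : SplitVectors A u v) (m n : ℕ) (j : ℤ → Fin N) :
    strongNorm A u (m + n) j = strongNorm A u n (shiftBy m j) * strongNorm A u m j := by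
  obtain ⟨a, ha, ha'⟩ := cross_cocycle h.norm_u h.cross_u m j
  rw [strongNorm, cocycle_add, act_mul_apply, ha, map_smul, norm_smul, Real.norm_eq_abs, ha',
    mul_comm]
  rfl

lemma transNorm_add (h : SplitVectors A u v) (m n : ℕ) (j : ℤ → Fin N) :
    transNorm A u (m + n) j = transNorm A u n (shiftBy m j) * transNorm A u m j := by
  rw [transNorm, h.strongNorm_add, cocycle_add, Matrix.det_mul, abs_mul, transNorm, transNorm,
    div_mul_div_comm]

lemma strongNorm_zero (h : SplitVectors A u v) (j : ℤ → Fin N) : strongNorm A u 0 j = 1 := by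
  simp [strongNorm, cocycle, h.norm_u]

lemma transNorm_zero (h : SplitVectors A u v) (j : ℤ → Fin N) : transNorm A u 0 j = 1 := by
  simp [transNorm, cocycle, h.strongNorm_zero]

/-- The two directions are uniformly transversal. -/
lemma exists_angle (h : SplitVectors A u v) :
    ∃ ε : ℝ, 0 < ε ∧ ε ≤ 1 ∧ ∀ j, ε ≤ |cross (v j) (u j)| := by
  obtain ⟨d, hd0, hd1, hd⟩ := exists_det_bound h.det
  obtain ⟨C, δ, hC, hδ, hdom⟩ := h.dominated
  have hlim : Tendsto (fun n : ℕ => C * Real.exp (δ * n)) atTop atTop :=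
    (Real.tendsto_exp_atTop.comp (tendsto_natCast_atTop_atTop.const_mul_atTop hδ)).const_mul_atTop hC
  -- At one fixed time the image of v is at least twice as long as that of u. As ‖M v‖ ≤ ‖M u‖ +
  -- |cross v u| ‖M‖ with ‖M‖ ≤ 1, the sine of the angle is at least the strong norm, hence at least
  -- d ^ n.
  obtain ⟨n, hn, hn1⟩ := ((hlim.eventually_ge_atTop 2).and (eventually_ge_atTop 1)).exists
  refine ⟨d ^ n, by positivity, pow_le_one₀ hd0.le hd1, fun j => ?_⟩
  have h1 := (le_div_iff₀ (h.strongNorm_pos n j)).1 (hn.trans (hdom j n hn1))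
  have h2 := norm_act_le_of_unit (cocycle A j n) (v j) (h.norm_u j)
  rw [h.norm_v, one_mul] at h2
  have h3 := h.norm_cocycle_le_one j n
  have h4 : |cross (v j) (u j)| * ‖act (cocycle A j n)‖ ≤ |cross (v j) (u j)| :=
    mul_le_of_le_one_right (abs_nonneg _) h3
  have h5 : strongNorm A u n j ≤ |cross (v j) (u j)| := by
    rw [strongNorm] at h1 ⊢; linarith
  refine (pow_le_abs_det_cocycle hd0 hd j n).trans (le_trans ?_ h5)
  rw [← h.transNorm_mul_strongNorm]
  exact mul_le_of_le_one_left (h.strongNorm_pos n j).le ((h.transNorm_le_norm n j).trans h3)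

/-- The cross product of v with u is multiplied by `transNorm` and lies between ε and 1 both before
and after, so `transNorm` is the contraction along v up to ε. -/
lemma norm_v_bounds (h : SplitVectors A u v) {ε : ℝ} (hε : 0 < ε)
    (hang : ∀ j, ε ≤ |cross (v j) (u j)|) (n : ℕ) (j : ℤ → Fin N) :
    ε * transNorm A u n j ≤ ‖act (cocycle A j n) (v j)‖ ∧
      ‖act (cocycle A j n) (v j)‖ ≤ ε⁻¹ * transNorm A u n j := by
  obtain ⟨a, ha, ha'⟩ := cross_cocycle h.norm_v h.cross_v n j
  have h1 := h.abs_cross_act_cocycle n j (v j)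
  rw [ha, cross_smul_left, abs_mul, ha'] at h1
  have hle : ∀ j, |cross (v j) (u j)| ≤ 1 := fun j => by
    simpa [h.norm_u, h.norm_v] using abs_cross_le (v j) (u j)
  have ht := h.transNorm_pos n j
  have hn := norm_nonneg (act (cocycle A j n) (v j))
  constructor
  · calc ε * transNorm A u n j ≤ |cross (v j) (u j)| * transNorm A u n j := by
          gcongr; exact hang j
      _ = ‖act (cocycle A j n) (v j)‖ * |cross (v (shiftBy n j)) (u (shiftBy n j))| := by
          rw [h1, mul_comm]
      _ ≤ _ := mul_le_of_le_one_right hn (hle _)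
  · rw [inv_mul_eq_div, le_div_iff₀ hε]
    calc ‖act (cocycle A j n) (v j)‖ * ε
        ≤ ‖act (cocycle A j n) (v j)‖ * |cross (v (shiftBy n j)) (u (shiftBy n j))| := by
          gcongr; exact hang _
      _ = transNorm A u n j * |cross (v j) (u j)| := h1
      _ ≤ _ := mul_le_of_le_one_right ht.le (hle _)

lemma exists_domination (h : SplitVectors A u v) :
    ∃ C δ : ℝ, 1 ≤ C ∧ 0 < δ ∧ ∀ (n : ℕ) (j : ℤ → Fin N),
      strongNorm A u n j ≤ C * Real.exp (-(δ * n)) * transNorm A u n j := by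
  obtain ⟨ε, hε, hε1, hang⟩ := h.exists_angle
  obtain ⟨C, δ, hC, hδ, hdom⟩ := h.dominated
  refine ⟨max 1 (C⁻¹ * ε⁻¹), δ, le_max_left _ _, hδ, fun n j => ?_⟩
  have ht := h.transNorm_pos n j
  rcases Nat.eq_zero_or_pos n with rfl | hn
  · rw [h.strongNorm_zero, h.transNorm_zero]; simp
  have h1 := (le_div_iff₀ (h.strongNorm_pos n j)).1 (hdom j n hn)
  have h2 := h1.trans (h.norm_v_bounds hε hang n j).2
  calc strongNorm A u n j
      = C⁻¹ * Real.exp (-(δ * n)) *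
        (C * Real.exp (δ * n) * ‖act (cocycle A j n) (u j)‖) := by
        rw [Real.exp_neg, strongNorm]; field_simp
    _ ≤ C⁻¹ * Real.exp (-(δ * n)) * (ε⁻¹ * transNorm A u n j) :=
        mul_le_mul_of_nonneg_left h2 (by positivity)
    _ = (C⁻¹ * ε⁻¹) * Real.exp (-(δ * n)) * transNorm A u n j := by ring
    _ ≤ _ := by gcongr; exact le_max_right _ _

/-- The products are comparable to their transversal part. -/
lemma exists_norm_le_transNorm (h : SplitVectors A u v) :
    ∃ C : ℝ, 1 ≤ C ∧ ∀ (n : ℕ) (j : ℤ → Fin N),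
      ‖act (cocycle A j n)‖ ≤ C * transNorm A u n j := by
  obtain ⟨ε, hε, hε1, hang⟩ := h.exists_angle
  obtain ⟨C, δ, hC, hδ, hdom⟩ := h.exists_domination
  have hinv : 1 ≤ ε⁻¹ := (one_le_inv₀ hε).2 hε1
  refine ⟨ε⁻¹ * (ε⁻¹ + C), by nlinarith, fun n j => ?_⟩
  have ht := h.transNorm_pos n j
  have h1 := norm_act_mul_cross_le (cocycle A j n) (h.norm_v j) (h.norm_u j)
  have h2 := (h.norm_v_bounds hε hang n j).2
  have h3 : strongNorm A u n j ≤ C * transNorm A u n j := by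
    refine (hdom n j).trans ?_
    have : Real.exp (-(δ * n)) ≤ 1 := Real.exp_le_one_iff.2 (by
      have : 0 ≤ δ * n := by positivity
      linarith)
    gcongr
    exact mul_le_of_le_one_right (by linarith) this
  rw [strongNorm] at h3
  rw [mul_assoc, inv_mul_eq_div, le_div_iff₀ hε]
  calc ‖act (cocycle A j n)‖ * ε ≤ ‖act (cocycle A j n)‖ * |cross (v j) (u j)| := by
        gcongr; exact hang j
    _ ≤ _ := by linarith

/-- The products contract no vector more than the strong stable ones, up to a constant. -/
lemma exists_strongNorm_mul_le (h : SplitVectors A u v) :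
    ∃ C : ℝ, 1 ≤ C ∧ ∀ (n : ℕ) (j : ℤ → Fin N) (x : Plane),
      strongNorm A u n j * ‖x‖ ≤ C * ‖act (cocycle A j n) x‖ := by
  obtain ⟨C, hC, hle⟩ := h.exists_norm_le_transNorm
  refine ⟨C, hC, fun n j x => ?_⟩
  have h1 := det_mul_norm_le (cocycle A j n) x
  rw [← h.transNorm_mul_strongNorm] at h1
  have ht := h.transNorm_pos n j
  refine le_of_mul_le_mul_left ?_ ht
  calc _ ≤ ‖act (cocycle A j n)‖ * ‖act (cocycle A j n) x‖ := by linarith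
    _ ≤ C * transNorm A u n j * ‖act (cocycle A j n) x‖ := by gcongr; exact hle n j
    _ = _ := by ring

/-- The products contract strips in the strong stable direction. -/
lemma exists_norm_act_le (h : SplitVectors A u v) :
    ∃ C : ℝ, 1 ≤ C ∧ ∀ (n : ℕ) (j : ℤ → Fin N) (x : Plane),
      ‖act (cocycle A j n) x‖ ≤
        C * (‖x‖ * strongNorm A u n j + |cross x (u j)| * transNorm A u n j) := by
  obtain ⟨C, hC, hle⟩ := h.exists_norm_le_transNorm
  refine ⟨C, hC, fun n j x => ?_⟩
  have h1 := norm_act_le_of_unit (cocycle A j n) x (h.norm_u j)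
  have hs := h.strongNorm_pos n j
  have h2 : ‖x‖ * strongNorm A u n j ≤ C * (‖x‖ * strongNorm A u n j) :=
    le_mul_of_one_le_left (by positivity) hC
  have h3 : |cross x (u j)| * ‖act (cocycle A j n)‖ ≤
    |cross x (u j)| * (C * transNorm A u n j) := by gcongr; exact hle n j
  rw [mul_add]
  change _ ≤ ‖x‖ * strongNorm A u n j + _ at h1
  linarith

/-- The strong stable direction depends on the future, in a Hölder way. -/
lemma exists_holder (h : SplitVectors A u v) :
    ∃ C δ : ℝ, 1 ≤ C ∧ 0 < δ ∧ ∀ (n : ℕ) (j j' : ℤ → Fin N),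
      (∀ k : ℕ, k < n → j k = j' k) → |cross (u j) (u j')| ≤ C * Real.exp (-(δ * n)) := by
  obtain ⟨C, δ, hC, hδ, hdom⟩ := h.exists_domination
  refine ⟨C, δ, hC, hδ, fun n j j' hjj => ?_⟩
  have hco := cocycle_congr (A := A) hjj
  -- The two words share the product M of the first n matrices. It contracts u j' by the strong norm
  -- at j', while multiplying its distance to the line of u j by the transversal norm at j.
  have key : ∀ j j' : ℤ → Fin N, cocycle A j n = cocycle A j' n →
      transNorm A u n j * |cross (u j') (u j)| ≤ strongNorm A u n j' := by
    intro j j' hco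
    rw [← h.abs_cross_act_cocycle, strongNorm, hco]
    simpa [h.norm_u] using abs_cross_le (act (cocycle A j' n) (u j')) (u (shiftBy n j))
  have h1 := key j j' hco
  have h2 := key j' j hco.symm
  rw [abs_cross_comm] at h1
  set a := |cross (u j) (u j')|
  have ha : 0 ≤ a := abs_nonneg _
  have ht := h.transNorm_pos n j
  have ht' := h.transNorm_pos n j'
  -- Multiplying the two symmetric estimates cancels the transversal norms of the two words, which
  -- have not been compared.
  have h3 : (transNorm A u n j * a) * (transNorm A u n j' * a) ≤
      (C * Real.exp (-(δ * n)) * transNorm A u n j') * (C * Real.exp (-(δ * n)) * transNorm A u n j) :=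
    mul_le_mul (h1.trans (hdom n j')) (h2.trans (hdom n j)) (by positivity) (by positivity)
  have h4 : (transNorm A u n j * transNorm A u n j') * a ^ 2 ≤
      (transNorm A u n j * transNorm A u n j') * (C * Real.exp (-(δ * n))) ^ 2 := by nlinarith
  have h5 := le_of_mul_le_mul_left h4 (by positivity)
  exact le_of_sq_le_sq h5 (by positivity)

lemma cross_eq_zero_of_future (h : SplitVectors A u v) {j j' : ℤ → Fin N}
    (hjj : ∀ k : ℕ, j k = j' k) : cross (u j) (u j') = 0 := by
  obtain ⟨C, δ, hC, hδ, hh⟩ := h.exists_holder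
  have hlim : Tendsto (fun n : ℕ => C * Real.exp (-(δ * n))) atTop (𝓝 0) := by
    have := Real.tendsto_exp_neg_atTop_nhds_zero.comp
      ((tendsto_natCast_atTop_atTop (R := ℝ)).const_mul_atTop hδ)
    simpa using this.const_mul C
  exact abs_nonpos_iff.1 (ge_of_tendsto' hlim fun n => hh n j j' fun k _ => hjj k)

end SplitVectors

/-! ### Measurability and boundedness of the contraction rates. -/

/-- Nearby lines have nearby unit vectors only after a change of sign. Since u is an arbitrary
choice, measurability is available only for sign-free expressions in u. -/
lemma exists_sign_norm_sub_le {x y : Plane} (hx : ‖x‖ = 1) (hy : ‖y‖ = 1) :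
    ∃ s : ℝ, |s| = 1 ∧ ‖x - s • y‖ ≤ 2 * |cross x y| := by
  have h1 := cross_sq_add_inner_sq x y
  rw [hx, hy] at h1
  have key : ∀ s : ℝ, |s| = 1 → 0 ≤ s * inner ℝ x y → ‖x - s • y‖ ≤ 2 * |cross x y| := by
    intro s hs h0
    have hs2 : s ^ 2 = 1 := by rw [← sq_abs, hs]; norm_num
    have h2 : ‖x - s • y‖ ^ 2 = 2 - 2 * (s * inner ℝ x y) := by
      rw [norm_sub_sq_real, norm_smul, inner_smul_right, hx, hy, Real.norm_eq_abs, hs]; ring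
    have h3 : (s * inner ℝ x y) ^ 2 + cross x y ^ 2 = 1 := by rw [mul_pow, hs2]; linarith
    refine le_of_sq_le_sq ?_ (by positivity)
    rw [h2, mul_pow, sq_abs]
    have h4 : s * inner ℝ x y ≤ 1 := by nlinarith [sq_nonneg (cross x y)]
    nlinarith
  rcases le_total 0 (inner ℝ x y : ℝ) with h | h
  · exact ⟨1, by simp, key 1 (by simp) (by simpa using h)⟩
  · exact ⟨-1, by simp, key (-1) (by simp) (by simpa using h)⟩

/-- Functions with exponentially small oscillation on the cylinders of the future are measurable. -/
lemma measurable_of_holder {φ : (ℤ → Fin N) → ℝ} {D δ : ℝ} (hδ : 0 < δ)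
    (h : ∀ (n : ℕ) (j j' : ℤ → Fin N), (∀ k : ℕ, k < n → j k = j' k) →
      |φ j - φ j'| ≤ D * Real.exp (-(δ * n))) : Measurable φ := by
  refine Continuous.measurable (continuous_iff_continuousAt.2 fun j => ?_)
  have hlim : Tendsto (fun n : ℕ => D * Real.exp (-(δ * n))) atTop (𝓝 0) := by
    have := Real.tendsto_exp_neg_atTop_nhds_zero.comp
      ((tendsto_natCast_atTop_atTop (R := ℝ)).const_mul_atTop hδ)
    simpa using this.const_mul D
  rw [ContinuousAt, Metric.tendsto_nhds]
  intro η hη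
  obtain ⟨n, hn⟩ := (hlim.eventually_lt_const hη).exists
  have h1 : ∀ᶠ j' in 𝓝 j, ∀ k ∈ Finset.range n, j' (k : ℤ) = j k := by
    rw [eventually_all_finset]
    intro k _
    exact (continuous_apply (k : ℤ)).continuousAt.eventually_mem (discreteTopology_iff_singleton_mem_nhds.1 inferInstance (j k))
  filter_upwards [h1] with j' hj'
  rw [Real.dist_eq]
  exact (h n j' j fun k hk => hj' k (Finset.mem_range.2 hk)).trans_lt hn

namespace SplitVectors

lemma measurable_abs_cross (h : SplitVectors A u v) (x : Plane) :
    Measurable fun j => |cross x (u j)| := by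
  obtain ⟨C, δ, hC, hδ, hh⟩ := h.exists_holder
  refine measurable_of_holder (D := ‖x‖ * (2 * C)) hδ fun n j j' hjj => ?_
  obtain ⟨s, hs, hs'⟩ := exists_sign_norm_sub_le (h.norm_u j) (h.norm_u j')
  have h1 : |cross x (u j')| = |cross x (s • u j')| := by
    rw [cross_smul_right, abs_mul, hs, one_mul]
  have h2 : cross x (u j) - cross x (s • u j') = cross x (u j - s • u j') := by
    simp [cross]; ring
  rw [h1]
  refine (abs_abs_sub_abs_le_abs_sub _ _).trans ?_
  rw [h2]
  refine (abs_cross_le _ _).trans ?_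
  rw [mul_assoc, mul_assoc]
  gcongr
  refine hs'.trans ?_
  gcongr
  exact hh n j j' hjj

lemma measurable_strongNorm (h : SplitVectors A u v) : Measurable (strongNorm A u 1) := by
  obtain ⟨C, δ, hC, hδ, hh⟩ := h.exists_holder
  refine measurable_of_holder (D := 1 + 2 * C) hδ fun n j j' hjj => ?_
  have hle : ∀ j, strongNorm A u 1 j ≤ 1 := fun j =>
    (h.strongNorm_le_norm 1 j).trans (h.norm_cocycle_le_one j 1)
  -- For n = 0 the words need not share the matrix at the origin. Both values lie in (0, 1], which
  -- accounts for the summand 1 in D.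
  rcases Nat.eq_zero_or_pos n with rfl | hn
  · have := h.strongNorm_pos 1 j
    have := h.strongNorm_pos 1 j'
    have := hle j
    have := hle j'
    rw [abs_le]
    simp only [Nat.cast_zero, mul_zero, neg_zero, Real.exp_zero]
    constructor <;> linarith
  obtain ⟨s, hs, hs'⟩ := exists_sign_norm_sub_le (h.norm_u j) (h.norm_u j')
  have hco : cocycle A j 1 = cocycle A j' 1 := cocycle_congr fun k hk => hjj k (by omega)
  have h1 : strongNorm A u 1 j' = ‖act (cocycle A j 1) (s • u j')‖ := by
    rw [map_smul, norm_smul, Real.norm_eq_abs, hs, one_mul, hco, strongNorm]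
  rw [h1, strongNorm]
  refine (abs_norm_sub_norm_le _ _).trans ?_
  rw [← map_sub]
  refine ((act (cocycle A j 1)).le_opNorm _).trans ?_
  have h2 := h.norm_cocycle_le_one j 1
  have h3 := hh n j j' hjj
  calc _ ≤ 1 * (2 * (C * Real.exp (-(δ * n)))) := by
        gcongr
        exact hs'.trans (by gcongr)
    _ ≤ _ := by have := Real.exp_pos (-(δ * n)); linarith

lemma measurable_transNorm (h : SplitVectors A u v) : Measurable (transNorm A u 1) := by
  refine Measurable.div ?_ h.measurable_strongNorm
  have : (fun j : ℤ → Fin N => |(cocycle A j 1).det|) = (fun i => |(A i).det|) ∘ fun j => j 0 := by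
    ext j; simp [cocycle]
  rw [this]
  exact (measurable_of_finite _).comp (measurable_pi_apply 0)

lemma log_strongNorm_eq (h : SplitVectors A u v) (n : ℕ) (j : ℤ → Fin N) :
    Real.log (strongNorm A u n j) = birkhoffSum (shiftBy 1) (fun j => Real.log (strongNorm A u 1 j)) n j := by
  induction n with
  | zero => simp [h.strongNorm_zero]
  | succ n ih =>
    rw [birkhoffSum_succ, iterate_shiftBy, mul_one, h.strongNorm_add,
      Real.log_mul (h.strongNorm_pos _ _).ne' (h.strongNorm_pos _ _).ne', ih, add_comm]

lemma log_transNorm_eq (h : SplitVectors A u v) (n : ℕ) (j : ℤ → Fin N) :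
    Real.log (transNorm A u n j) = birkhoffSum (shiftBy 1) (fun j => Real.log (transNorm A u 1 j)) n j := by
  induction n with
  | zero => simp [h.transNorm_zero]
  | succ n ih =>
    rw [birkhoffSum_succ, iterate_shiftBy, mul_one, h.transNorm_add,
      Real.log_mul (h.transNorm_pos _ _).ne' (h.transNorm_pos _ _).ne', ih, add_comm]

/-- Splitting off the earliest symbol writes the contraction along the past as a Birkhoff sum for
the inverse shift, so Birkhoff's theorem applies at the word itself even though the starting point
moves with n. -/
lemma log_strongNorm_backward (h : SplitVectors A u v) (n : ℕ) (j : ℤ → Fin N) :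
    Real.log (strongNorm A u n (shiftBy (-n) j)) =
      birkhoffSum (shiftBy (-1)) (fun j => Real.log (strongNorm A u 1 (shiftBy (-1) j))) n j := by
  induction n with
  | zero => simp [h.strongNorm_zero]
  | succ n ih =>
    rw [birkhoffSum_succ, iterate_shiftBy, ← ih, shiftBy_shiftBy, add_comm n 1, h.strongNorm_add,
      Real.log_mul (h.strongNorm_pos _ _).ne' (h.strongNorm_pos _ _).ne', shiftBy_shiftBy]
    congr 4 <;> (push_cast; ring)

lemma log_transNorm_backward (h : SplitVectors A u v) (n : ℕ) (j : ℤ → Fin N) :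
    Real.log (transNorm A u n (shiftBy (-n) j)) =
      birkhoffSum (shiftBy (-1)) (fun j => Real.log (transNorm A u 1 (shiftBy (-1) j))) n j := by
  induction n with
  | zero => simp [h.transNorm_zero]
  | succ n ih =>
    rw [birkhoffSum_succ, iterate_shiftBy, ← ih, shiftBy_shiftBy, add_comm n 1, h.transNorm_add,
      Real.log_mul (h.transNorm_pos _ _).ne' (h.transNorm_pos _ _).ne', shiftBy_shiftBy]
    congr 4 <;> (push_cast; ring)

lemma exists_log_bounds (h : SplitVectors A u v) :
    ∃ D c : ℝ, 0 < c ∧ ∀ j, |Real.log (strongNorm A u 1 j)| ≤ D ∧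
      |Real.log (transNorm A u 1 j)| ≤ D ∧ Real.log (transNorm A u 1 j) ≤ -c := by
  obtain ⟨d, hd0, hd1, hd⟩ := exists_det_bound h.det
  obtain ⟨ρ, hρ0, hρ1, hρ⟩ := exists_contraction_bound h.contr
  refine ⟨-Real.log d, -Real.log ρ, neg_pos.2 (Real.log_neg hρ0 hρ1), fun j => ?_⟩
  have h1 := h.transNorm_mul_strongNorm 1 j
  have h2 := pow_le_abs_det_cocycle hd0 hd j 1
  have h3 := h.norm_cocycle_le_one j 1
  have hs0 := h.strongNorm_pos 1 j
  have ht0 := h.transNorm_pos 1 j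
  have hs1 := (h.strongNorm_le_norm 1 j).trans h3
  have ht1 := (h.transNorm_le_norm 1 j).trans h3
  have ht2 := (h.transNorm_le_norm 1 j).trans (norm_cocycle_le hρ j 1)
  rw [pow_one] at h2 ht2
  rw [← h1] at h2
  have hsd : d ≤ strongNorm A u 1 j := h2.trans (mul_le_of_le_one_left hs0.le ht1)
  have htd : d ≤ transNorm A u 1 j := h2.trans (mul_le_of_le_one_right ht0.le hs1)
  have e1 := Real.log_le_log hd0 hsd
  have e2 := Real.log_le_log hd0 htd
  have e3 := Real.log_nonpos hs0.le hs1
  have e4 := Real.log_nonpos ht0.le ht1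
  refine ⟨?_, ?_, ?_⟩
  · rw [abs_of_nonpos e3]; linarith
  · rw [abs_of_nonpos e4]; linarith
  · rw [neg_neg]; exact Real.log_le_log ht0 ht2

end SplitVectors

/-! ### Lyapunov exponents as integrals. -/

/-- The Lyapunov exponent of the strong stable direction. -/
def strongExponent (κ : Measure (Fin N)) (A : Fin N → Matrix (Fin 2) (Fin 2) ℝ)
    (u : (ℤ → Fin N) → Plane) : ℝ :=
  -∫ j, Real.log (strongNorm A u 1 j) ∂(Measure.infinitePi fun _ : ℤ => κ)

/-- The Lyapunov exponent transversally to the strong stable direction. -/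
def transExponent (κ : Measure (Fin N)) (A : Fin N → Matrix (Fin 2) (Fin 2) ℝ)
    (u : (ℤ → Fin N) → Plane) : ℝ :=
  -∫ j, Real.log (transNorm A u 1 j) ∂(Measure.infinitePi fun _ : ℤ => κ)

namespace SplitVectors

variable {κ : Measure (Fin N)} [IsProbabilityMeasure κ]

lemma integrable_log_strongNorm (h : SplitVectors A u v) :
    Integrable (fun j => Real.log (strongNorm A u 1 j)) (Measure.infinitePi fun _ : ℤ => κ) := by
  obtain ⟨D, c, -, hD⟩ := h.exists_log_bounds
  exact Integrable.of_bound h.measurable_strongNorm.log.aestronglyMeasurable D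
    (Eventually.of_forall fun j => (hD j).1)

lemma integrable_log_transNorm (h : SplitVectors A u v) :
    Integrable (fun j => Real.log (transNorm A u 1 j)) (Measure.infinitePi fun _ : ℤ => κ) := by
  obtain ⟨D, c, -, hD⟩ := h.exists_log_bounds
  exact Integrable.of_bound h.measurable_transNorm.log.aestronglyMeasurable D
    (Eventually.of_forall fun j => (hD j).2.1)

lemma ae_tendsto_birkhoff_backward {φ : (ℤ → Fin N) → ℝ} (hφ : Measurable φ)
    (hφi : Integrable φ (Measure.infinitePi fun _ : ℤ => κ)) :
    ∀ᵐ j ∂(Measure.infinitePi fun _ : ℤ => κ), Tendsto (fun n : ℕ =>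
      birkhoffSum (shiftBy (-1)) (fun j => φ (shiftBy (-1) j)) n j / n) atTop
      (𝓝 (∫ j, φ j ∂(Measure.infinitePi fun _ : ℤ => κ))) := by
  have hmp := measurePreserving_shiftBy κ (-1)
  have h1 := ae_tendsto_birkhoffSum_div (ergodic_shiftBy κ (c := -1) (by norm_num))
    (hφ.comp hmp.measurable) ((hmp.integrable_comp hφi.1).2 hφi)
  have h2 : ∫ j, (φ ∘ shiftBy (-1)) j ∂(Measure.infinitePi fun _ : ℤ => κ) =
      ∫ j, φ j ∂(Measure.infinitePi fun _ : ℤ => κ) := by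
    conv_rhs => rw [← hmp.map_eq]
    rw [integral_map hmp.measurable.aemeasurable hφ.aestronglyMeasurable]
    rfl
  rw [h2] at h1
  exact h1

lemma ae_tendsto_log_strongNorm (h : SplitVectors A u v) :
    ∀ᵐ j ∂(Measure.infinitePi fun _ : ℤ => κ), Tendsto (fun n : ℕ =>
      Real.log (strongNorm A u n j) / n) atTop (𝓝 (-strongExponent κ A u)) := by
  rw [strongExponent, neg_neg]
  filter_upwards [ae_tendsto_birkhoffSum_div (ergodic_shiftBy κ one_ne_zero)
    h.measurable_strongNorm.log h.integrable_log_strongNorm] with j hj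
  exact hj.congr fun n => by rw [h.log_strongNorm_eq n]

lemma ae_tendsto_log_transNorm (h : SplitVectors A u v) :
    ∀ᵐ j ∂(Measure.infinitePi fun _ : ℤ => κ), Tendsto (fun n : ℕ =>
      Real.log (transNorm A u n j) / n) atTop (𝓝 (-transExponent κ A u)) := by
  rw [transExponent, neg_neg]
  filter_upwards [ae_tendsto_birkhoffSum_div (ergodic_shiftBy κ one_ne_zero)
    h.measurable_transNorm.log h.integrable_log_transNorm] with j hj
  exact hj.congr fun n => by rw [h.log_transNorm_eq n]

lemma ae_tendsto_log_strongNorm_backward (h : SplitVectors A u v) :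
    ∀ᵐ j ∂(Measure.infinitePi fun _ : ℤ => κ), Tendsto (fun n : ℕ =>
      Real.log (strongNorm A u n (shiftBy (-n) j)) / n) atTop (𝓝 (-strongExponent κ A u)) := by
  rw [strongExponent, neg_neg]
  filter_upwards [ae_tendsto_birkhoff_backward h.measurable_strongNorm.log
    (h.integrable_log_strongNorm (κ := κ))] with j hj
  exact hj.congr fun n => by rw [h.log_strongNorm_backward n]

lemma ae_tendsto_log_transNorm_backward (h : SplitVectors A u v) :
    ∀ᵐ j ∂(Measure.infinitePi fun _ : ℤ => κ), Tendsto (fun n : ℕ =>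
      Real.log (transNorm A u n (shiftBy (-n) j)) / n) atTop (𝓝 (-transExponent κ A u)) := by
  rw [transExponent, neg_neg]
  filter_upwards [ae_tendsto_birkhoff_backward h.measurable_transNorm.log
    (h.integrable_log_transNorm (κ := κ))] with j hj
  exact hj.congr fun n => by rw [h.log_transNorm_backward n]

lemma transExponent_pos (h : SplitVectors A u v) : 0 < transExponent κ A u := by
  obtain ⟨D, c, hc, hD⟩ := h.exists_log_bounds
  have h1 := integral_mono (h.integrable_log_transNorm (κ := κ)) (integrable_const (-c))
    fun j => (hD j).2.2
  simp at h1
  rw [transExponent]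
  linarith

/-- The uniform gap δ in the domination survives in the limit at any word typical for both
exponents. -/
lemma transExponent_lt_strongExponent (h : SplitVectors A u v) :
    transExponent κ A u < strongExponent κ A u := by
  obtain ⟨C, δ, hC, hδ, hdom⟩ := h.exists_domination
  obtain ⟨j, h1, h2⟩ := (h.ae_tendsto_log_strongNorm.and (h.ae_tendsto_log_transNorm (κ := κ))).exists
  have h3 : Tendsto (fun n : ℕ => Real.log C / n + -δ + Real.log (transNorm A u n j) / n) atTop
      (𝓝 (0 + -δ + -transExponent κ A u)) :=
    ((tendsto_const_nhds.div_atTop tendsto_natCast_atTop_atTop).add tendsto_const_nhds).add h2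
  have h4 := le_of_tendsto_of_tendsto h1 h3 (by
    filter_upwards [eventually_gt_atTop 0] with n hn
    have hn' : (0 : ℝ) < n := by exact_mod_cast hn
    have h5 := Real.log_le_log (h.strongNorm_pos n j) (hdom n j)
    rw [Real.log_mul (by positivity) (h.transNorm_pos n j).ne',
      Real.log_mul (by positivity) (Real.exp_pos _).ne', Real.log_exp] at h5
    have h6 : Real.log C / n + -δ + Real.log (transNorm A u n j) / n =
        (Real.log C + -(δ * n) + Real.log (transNorm A u n j)) / n := by field_simp
    rw [h6]
    gcongr)
  linarith

lemma isLyapunovExponent_strong (h : SplitVectors A u v) {p : Fin N → ℝ}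
    [IsProbabilityMeasure (symbolMeasure p)] {ess : (ℤ → Fin N) → Submodule ℝ Plane}
    (hess : ∀ j, ess j = Submodule.span ℝ {u j}) :
    IsLyapunovExponent A p ess (strongExponent (symbolMeasure p) A u) := by
  have h1 := h.ae_tendsto_log_strongNorm (κ := symbolMeasure p)
  filter_upwards [h1] with j hj
  have := hj.neg
  rw [neg_neg] at this
  refine this.congr fun n => ?_
  rw [hess, restrictNorm_span _ (h.norm_u j), strongNorm]
  ring

/-- The norm along v and `transNorm` differ by bounded factors, which disappear after taking
logarithms and dividing by n. -/
lemma isLyapunovExponent_trans (h : SplitVectors A u v) {p : Fin N → ℝ}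
    [IsProbabilityMeasure (symbolMeasure p)] {es : (ℤ → Fin N) → Submodule ℝ Plane}
    (hes : ∀ j, es j = Submodule.span ℝ {v j}) :
    IsLyapunovExponent A p es (transExponent (symbolMeasure p) A u) := by
  obtain ⟨ε, hε, hε1, hang⟩ := h.exists_angle
  have h1 := h.ae_tendsto_log_transNorm (κ := symbolMeasure p)
  filter_upwards [h1] with j hj
  have hc : ∀ c : ℝ, Tendsto (fun n : ℕ => -(Real.log (c * transNorm A u n j) / n)) atTop
      (𝓝 (transExponent (symbolMeasure p) A u)) ∨ c ≤ 0 := by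
    intro c
    rcases le_or_gt c 0 with h0 | h0
    · exact Or.inr h0
    · left
      have := ((tendsto_const_nhds (x := Real.log c)).div_atTop
        (tendsto_natCast_atTop_atTop (R := ℝ))).add hj
      rw [zero_add] at this
      have := this.neg
      rw [neg_neg] at this
      refine this.congr fun n => ?_
      rw [Real.log_mul h0.ne' (h.transNorm_pos n j).ne']
      ring
  refine tendsto_of_tendsto_of_tendsto_of_le_of_le ((hc ε⁻¹).resolve_right (by
    rw [not_le]; positivity)) ((hc ε).resolve_right (by rw [not_le]; positivity))
    (fun n => ?_) (fun n => ?_)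
  · obtain ⟨h2, h3⟩ := h.norm_v_bounds hε hang n j
    have ht := h.transNorm_pos n j
    have h0 := (mul_pos hε ht).trans_le h2
    simp only
    rw [hes, restrictNorm_span _ (h.norm_v j), neg_mul, one_div_mul_eq_div]
    exact neg_le_neg (div_le_div_of_nonneg_right (Real.log_le_log h0 h3) (Nat.cast_nonneg n))
  · obtain ⟨h2, h3⟩ := h.norm_v_bounds hε hang n j
    have ht := h.transNorm_pos n j
    simp only
    rw [hes, restrictNorm_span _ (h.norm_v j), neg_mul, one_div_mul_eq_div]
    exact neg_le_neg (div_le_div_of_nonneg_right (Real.log_le_log (mul_pos hε ht) h2)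
      (Nat.cast_nonneg n))

end SplitVectors

end SplitVectors

end SelfAffine

end

noncomputable section

namespace SelfAffine

/-! ### The natural projection -/

section NaturalProjection

variable {N : ℕ} {A : Fin N → Matrix (Fin 2) (Fin 2) ℝ} {t : Fin N → Plane}

/-- The one-sided word with the first `n` symbols removed. -/
def dropWord (n : ℕ) (a : ℕ → Fin N) : ℕ → Fin N := fun k => a (k + n)

/-- The past of a two-sided word, read backwards. -/
def past (j : ℤ → Fin N) : ℕ → Fin N := fun k => j (-1 - k)

/-- The point coded by the past of a two-sided word. -/
def pastPoint (A : Fin N → Matrix (Fin 2) (Fin 2) ℝ) (t : Fin N → Plane) (j : ℤ → Fin N) : Plane :=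
  natProj A t (past j)

lemma affMap_sub (i : Fin N) (x y : Plane) :
    affMap A t i x - affMap A t i y = act (A i) (x - y) := by
  rw [affMap, affMap, map_sub, add_sub_add_right_eq_sub]

lemma continuous_affMap (i : Fin N) : Continuous (affMap A t i) :=
  (act (A i)).continuous.add continuous_const

lemma norm_prefixMap_sub_le {ρ : ℝ} (hρ : ∀ i, ‖act (A i)‖ ≤ ρ) (a : ℕ → Fin N) (n : ℕ) (x y : Plane) :
    ‖prefixMap A t a n x - prefixMap A t a n y‖ ≤ ρ ^ n * ‖x - y‖ := by
  induction n generalizing x y with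
  | zero => simp [prefixMap]
  | succ n ih =>
    have hρ0 : 0 ≤ ρ := (norm_nonneg _).trans (hρ (a 0))
    refine (ih _ _).trans ?_
    rw [affMap_sub, pow_succ, mul_assoc]
    gcongr
    exact ((act (A (a n))).le_opNorm _).trans (by gcongr; exact hρ _)

/-- The recursion adds maps on the inside. The self-similarity of the coding requires the outermost
map to be split off. -/
lemma prefixMap_succ' (a : ℕ → Fin N) (n : ℕ) (x : Plane) :
    prefixMap A t a (n + 1) x = affMap A t (a 0) (prefixMap A t (dropWord 1 a) n x) := by
  induction n generalizing x with
  | zero => rfl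
  | succ n ih =>
    rw [prefixMap, Function.comp_apply, ih]
    rfl

lemma tendsto_natProj (hcontr : ∀ i, ‖act (A i)‖ < 1) (a : ℕ → Fin N) (x : Plane) :
    Tendsto (fun n => prefixMap A t a n x) atTop (𝓝 (natProj A t a)) := by
  obtain ⟨ρ, hρ0, hρ1, hρ⟩ := exists_contraction_bound hcontr
  obtain ⟨B, hB⟩ : ∃ B, ∀ i, ‖t i‖ ≤ B := by
    obtain ⟨B, hB⟩ := (Set.finite_range fun i => ‖t i‖).bddAbove
    exact ⟨B, fun i => hB ⟨i, rfl⟩⟩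
  have h0 : CauchySeq fun n => prefixMap A t a n 0 := by
    refine cauchySeq_of_le_geometric ρ B hρ1 fun n => ?_
    rw [dist_comm, dist_eq_norm, mul_comm]
    refine (norm_prefixMap_sub_le hρ a n _ _).trans ?_
    gcongr
    simpa [affMap] using hB (a n)
  have h1 : Tendsto (fun n => prefixMap A t a n 0) atTop (𝓝 (natProj A t a)) := h0.tendsto_limUnder
  have h2 : Tendsto (fun n => prefixMap A t a n x - prefixMap A t a n 0) atTop (𝓝 0) := by
    have h3 := (tendsto_pow_atTop_nhds_zero_of_lt_one hρ0.le hρ1).mul_const ‖x - 0‖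
    rw [zero_mul] at h3
    exact squeeze_zero_norm (fun n => norm_prefixMap_sub_le hρ a n x 0) h3
  simpa using h2.add h1

lemma natProj_eq (hcontr : ∀ i, ‖act (A i)‖ < 1) (a : ℕ → Fin N) :
    natProj A t a = affMap A t (a 0) (natProj A t (dropWord 1 a)) := by
  refine tendsto_nhds_unique ((tendsto_natProj hcontr a 0).comp (tendsto_add_atTop_nat 1)) ?_
  refine (((continuous_affMap (a 0)).tendsto _).comp
    (tendsto_natProj hcontr (dropWord 1 a) 0)).congr fun n => ?_
  rw [Function.comp_apply, Function.comp_apply, prefixMap_succ']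

lemma natProj_mem_closure (hcontr : ∀ i, ‖act (A i)‖ < 1) {O : Set Plane} (hO : O.Nonempty)
    (hAO : ∀ i, affMap A t i '' closure O ⊆ O) (a : ℕ → Fin N) : natProj A t a ∈ closure O := by
  obtain ⟨o, ho⟩ := hO
  have key : ∀ n, ∀ x ∈ O, prefixMap A t a n x ∈ O := by
    intro n
    induction n with
    | zero => exact fun x hx => hx
    | succ n ih => exact fun x hx => ih _ (hAO _ (Set.mem_image_of_mem _ (subset_closure hx)))
  exact mem_closure_of_tendsto (tendsto_natProj hcontr a o) (Eventually.of_forall fun n => key n o ho)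

lemma measurable_affMap : Measurable fun q : Fin N × Plane => affMap A t q.1 q.2 := by
  refine measurable_from_prod_countable_right fun i => ?_
  exact (continuous_affMap i).measurable

lemma measurable_natProj (hcontr : ∀ i, ‖act (A i)‖ < 1) : Measurable (natProj A t) := by
  have key : ∀ n (g : (ℕ → Fin N) → Plane), Measurable g →
      Measurable fun a => prefixMap A t a n (g a) := by
    intro n
    induction n with
    | zero => exact fun g hg => hg
    | succ n ih =>
      intro g hg
      have h1 : Measurable fun a : ℕ → Fin N => (a n, g a) := (measurable_pi_apply n).prodMk hg
      have h2 := (measurable_affMap (A := A) (t := t)).comp h1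
      exact ih _ h2
  exact measurable_of_tendsto_metrizable (fun n => key n _ measurable_const)
    (tendsto_pi_nhds.2 fun a => tendsto_natProj hcontr a 0)

lemma measurable_past : Measurable (past (N := N)) :=
  measurable_pi_lambda _ fun _ => measurable_pi_apply _

lemma measurable_dropWord (n : ℕ) : Measurable (dropWord (N := N) n) :=
  measurable_pi_lambda _ fun _ => measurable_pi_apply _

lemma measurable_pastPoint (hcontr : ∀ i, ‖act (A i)‖ < 1) : Measurable (pastPoint A t) :=
  (measurable_natProj hcontr).comp measurable_past

lemma past_shiftBy (j : ℤ → Fin N) (n : ℕ) : past (shiftBy (-n) j) = dropWord n (past j) := by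
  ext k
  simp only [past, shiftBy, dropWord]
  congr 2
  push_cast
  ring

/-- Two points of the attractor in the same cylinder differ by the product along the cylinder. -/
lemma natProj_sub_pastPoint (hcontr : ∀ i, ‖act (A i)‖ < 1) (j : ℤ → Fin N) (a : ℕ → Fin N) (n : ℕ)
    (h : ∀ k < n, a k = past j k) :
    natProj A t a - pastPoint A t j = act (cocycle A (shiftBy (-n) j) n)
      (natProj A t (dropWord n a) - pastPoint A t (shiftBy (-n) j)) := by
  induction n generalizing a j with
  | zero =>
    rw [cocycle, act_one_apply, Nat.cast_zero, neg_zero, shiftBy_zero]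
    rfl
  | succ n ih =>
    have h1 := ih (shiftBy (-1) j) (dropWord 1 a) fun k hk => by
      have := past_shiftBy j 1
      rw [Nat.cast_one] at this
      rw [this]
      exact h (k + 1) (by omega)
    have e1 : shiftBy (-n) (shiftBy (-1) j) = shiftBy (-(n + 1 : ℕ)) j := by
      rw [shiftBy_shiftBy]; congr 1; push_cast; ring
    have e2 : dropWord n (dropWord 1 a) = dropWord (n + 1) a := by
      ext k; simp [dropWord, add_assoc]
    have e3 : shiftBy (-(n + 1 : ℕ)) j n = j (-1) := by
      simp only [shiftBy]; congr 1; push_cast; ring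
    have e4 : a 0 = j (-1) := by simpa [past] using h 0 n.succ_pos
    have e5 : pastPoint A t j = affMap A t (j (-1)) (pastPoint A t (shiftBy (-1) j)) := by
      have := past_shiftBy j 1
      rw [Nat.cast_one] at this
      rw [pastPoint, natProj_eq hcontr, pastPoint, this]
      simp [past]
    rw [natProj_eq hcontr, e4, e5, affMap_sub, h1, e1, e2, cocycle, e3, act_mul_apply]

/-- Cylinders of a Bernoulli measure. -/
lemma infinitePi_cylinder (κ : Measure (Fin N)) [IsProbabilityMeasure κ] (w : ℕ → Fin N) (n : ℕ)
    {E : Set (ℕ → Fin N)} (hE : MeasurableSet E) :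
    (Measure.infinitePi fun _ : ℕ => κ) {a | (∀ k < n, a k = w k) ∧ dropWord n a ∈ E} =
      (∏ k ∈ Finset.range n, κ {w k}) * (Measure.infinitePi fun _ : ℕ => κ) E := by
  induction n generalizing w with
  | zero =>
    simp
    rfl
  | succ n ih =>
    have hm : MeasurableSet {a : ℕ → Fin N | (∀ k < n, a k = dropWord 1 w k) ∧ dropWord n a ∈ E} := by
      refine MeasurableSet.inter ?_ (measurable_dropWord n hE)
      have : {a : ℕ → Fin N | ∀ k < n, a k = dropWord 1 w k} =
          ⋂ k, ⋂ _ : k < n, Function.eval k ⁻¹' {dropWord 1 w k} := by ext; simp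
      change MeasurableSet {a : ℕ → Fin N | ∀ k < n, a k = dropWord 1 w k}
      rw [this]
      exact MeasurableSet.iInter fun k => MeasurableSet.iInter fun _ =>
        measurable_pi_apply k (MeasurableSet.singleton _)
    have h1 := infinitePi_cons_apply κ (MeasurableSet.singleton (w 0)) hm
    rw [ih] at h1
    rw [Finset.prod_range_succ', mul_comm _ (κ {w 0}), mul_assoc]
    refine Eq.trans (congrArg _ ?_) h1
    ext a
    simp only [Set.mem_ofPred_eq, Set.mem_singleton_iff]
    constructor
    · rintro ⟨h2, h3⟩
      refine ⟨h2 0 n.succ_pos, fun k hk => h2 (k + 1) (by omega), ?_⟩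
      convert h3 using 1
      ext k; simp [dropWord, add_assoc]
    · rintro ⟨h2, h3, h4⟩
      refine ⟨fun k hk => ?_, ?_⟩
      · rcases k with _ | k
        · exact h2
        · exact h3 k (by omega)
      · convert h4 using 1
        ext k; simp [dropWord, add_assoc]

/-- Geometric consequences of the strong separation condition. -/
lemma StrongSeparation.exists_bounds (hsep : StrongSeparation A t) (hcontr : ∀ i, ‖act (A i)‖ < 1) :
    (∃ r₀ : ℝ, 1 ≤ r₀ ∧ ∀ a b, ‖natProj A t a - natProj A t b‖ ≤ r₀) ∧
      ∃ η : ℝ, 0 < η ∧ ∀ a b : ℕ → Fin N, a 0 ≠ b 0 → η ≤ ‖natProj A t a - natProj A t b‖ := by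
  obtain ⟨O, hO, hne, hb, hAO, hd⟩ := hsep
  have hmem := natProj_mem_closure hcontr hne hAO
  have hcl : IsCompact (closure O) := hb.isCompact_closure
  constructor
  · obtain ⟨C, hC⟩ := Metric.isBounded_iff.1 hb.closure
    refine ⟨max 1 C, le_max_left _ _, fun a b => ?_⟩
    rw [← dist_eq_norm]
    exact (hC (hmem a) (hmem b)).trans (le_max_right _ _)
  · have h1 : ∀ q : Fin N × Fin N, ∃ η : ℝ, 0 < η ∧ (q.1 ≠ q.2 →
        ∀ x ∈ affMap A t q.1 '' closure O, ∀ y ∈ affMap A t q.2 '' closure O, η ≤ ‖x - y‖) := by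
      intro q
      by_cases hq : q.1 = q.2
      · exact ⟨1, one_pos, fun h => (h hq).elim⟩
      · obtain ⟨η, hη, h⟩ := (hd q.1 q.2 hq).exists_thickenings
          (hcl.image (continuous_affMap q.1)) (hcl.image (continuous_affMap q.2)).isClosed
        refine ⟨η, hη, fun _ x hx y hy => ?_⟩
        by_contra hlt
        rw [not_le, ← dist_eq_norm] at hlt
        exact Set.disjoint_left.1 h
          (Metric.mem_thickening_iff.2 ⟨x, hx, by rw [dist_comm]; exact hlt⟩)
          (Metric.self_subset_thickening hη _ hy)
    choose η hη0 hη using h1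
    rcases isEmpty_or_nonempty (Fin N) with hN | hN
    · exact ⟨1, one_pos, fun a => (hN.false (a 0)).elim⟩
    obtain ⟨q, hq⟩ := Finite.exists_min η
    refine ⟨η q, hη0 q, fun a b hab => (hq (a 0, b 0)).trans (hη (a 0, b 0) hab _ ?_ _ ?_)⟩
    · rw [natProj_eq hcontr]; exact Set.mem_image_of_mem _ (hmem _)
    · rw [natProj_eq hcontr]; exact Set.mem_image_of_mem _ (hmem _)

end NaturalProjection

end SelfAffine

end

noncomputable section

namespace SelfAffine

/-! ### Measures of strips in the strong stable direction -/

section Strips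

variable {N : ℕ}

/-- The image of a Bernoulli measure under the natural projection. -/
def codedMeasure (κ : Measure (Fin N)) (A : Fin N → Matrix (Fin 2) (Fin 2) ℝ) (t : Fin N → Plane) :
    Measure Plane := (Measure.infinitePi fun _ : ℕ => κ).map (natProj A t)

/-- The part of the projected measure that is carried by a first level cylinder. -/
def codedPiece (κ : Measure (Fin N)) (A : Fin N → Matrix (Fin 2) (Fin 2) ℝ) (t : Fin N → Plane)
    (c : Fin N) : Measure Plane :=
  ((Measure.infinitePi fun _ : ℕ => κ).restrict {a | a 0 = c}).map (natProj A t)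

/-- The strip of half-width `r` around the point coded by the past of `j`, in the direction
determined by the future of `j`. -/
def strip (A : Fin N → Matrix (Fin 2) (Fin 2) ℝ) (t : Fin N → Plane) (u : (ℤ → Fin N) → Plane)
    (j : ℤ → Fin N) (r : ℝ) : Set Plane := {y | |cross (y - pastPoint A t j) (u j)| ≤ r}

/-- The mass of a strip. -/
def stripMass (κ : Measure (Fin N)) (A : Fin N → Matrix (Fin 2) (Fin 2) ℝ) (t : Fin N → Plane)
    (u : (ℤ → Fin N) → Plane) (j : ℤ → Fin N) (r : ℝ) : ℝ :=
  (codedMeasure κ A t).real (strip A t u j r)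

/-- The mass that a strip receives from the cylinder of its centre. -/
def stripPart (κ : Measure (Fin N)) (A : Fin N → Matrix (Fin 2) (Fin 2) ℝ) (t : Fin N → Plane)
    (u : (ℤ → Fin N) → Plane) (j : ℤ → Fin N) (r : ℝ) : ℝ :=
  (codedPiece κ A t (j (-1))).real (strip A t u j r)

/-- The half-widths of strips adapted to the transversal contraction. -/
def stripRadius (A : Fin N → Matrix (Fin 2) (Fin 2) ℝ) (u : (ℤ → Fin N) → Plane) (r₀ : ℝ) (l : ℕ)
    (j : ℤ → Fin N) : ℝ := transNorm A u l (shiftBy (-l) j) * r₀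

/-- The proportion of the mass of a strip that lies in the cylinder of its centre. -/
def stripRatio (κ : Measure (Fin N)) (A : Fin N → Matrix (Fin 2) (Fin 2) ℝ) (t : Fin N → Plane)
    (u : (ℤ → Fin N) → Plane) (r₀ : ℝ) (l : ℕ) (j : ℤ → Fin N) : ℝ :=
  stripPart κ A t u j (stripRadius A u r₀ l j) / stripMass κ A t u j (stripRadius A u r₀ l j)

variable {A : Fin N → Matrix (Fin 2) (Fin 2) ℝ} {t : Fin N → Plane} {u v : (ℤ → Fin N) → Plane}

lemma continuous_cross_left (w : Plane) : Continuous fun y => cross y w := by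
  unfold cross
  fun_prop

lemma isClosed_strip (j : ℤ → Fin N) (r : ℝ) : IsClosed (strip A t u j r) :=
  isClosed_le ((continuous_cross_left (u j)).comp (continuous_id.sub continuous_const)).abs
    continuous_const

lemma measurableSet_eval_eq (c : Fin N) : MeasurableSet {a : ℕ → Fin N | a 0 = c} :=
  measurableSet_eq_fun (measurable_pi_apply 0) measurable_const

variable {κ : Measure (Fin N)}

lemma codedPiece_le (hcontr : ∀ i, ‖act (A i)‖ < 1) (c : Fin N) :
    codedPiece κ A t c ≤ codedMeasure κ A t :=
  Measure.map_mono Measure.restrict_le_self (measurable_natProj hcontr)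

lemma stripRatio_nonneg (r₀ : ℝ) (l : ℕ) (j : ℤ → Fin N) : 0 ≤ stripRatio κ A t u r₀ l j :=
  div_nonneg measureReal_nonneg measureReal_nonneg

variable [IsProbabilityMeasure κ]

lemma isProbabilityMeasure_codedMeasure (hcontr : ∀ i, ‖act (A i)‖ < 1) :
    IsProbabilityMeasure (codedMeasure κ A t) :=
  Measure.isProbabilityMeasure_map (measurable_natProj hcontr).aemeasurable

instance isFiniteMeasure_codedMeasure : IsFiniteMeasure (codedMeasure κ A t) := by
  unfold codedMeasure; infer_instance

instance isFiniteMeasure_codedPiece (c : Fin N) : IsFiniteMeasure (codedPiece κ A t c) := by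
  unfold codedPiece; infer_instance

lemma stripPart_le_stripMass (hcontr : ∀ i, ‖act (A i)‖ < 1) (j : ℤ → Fin N) (r : ℝ) :
    stripPart κ A t u j r ≤ stripMass κ A t u j r :=
  ENNReal.toReal_mono (measure_ne_top _ _) (codedPiece_le hcontr _ _)

lemma stripMass_mono (j : ℤ → Fin N) : Monotone (stripMass κ A t u j) :=
  fun _ _ hrs => measureReal_mono fun _ hy => le_trans hy hrs

namespace SplitVectors

lemma stripRadius_pos (h : SplitVectors A u v) {r₀ : ℝ} (hr : 0 < r₀) (l : ℕ) (j : ℤ → Fin N) :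
    0 < stripRadius A u r₀ l j := mul_pos (h.transNorm_pos _ _) hr

lemma stripRadius_zero (h : SplitVectors A u v) (r₀ : ℝ) (j : ℤ → Fin N) :
    stripRadius A u r₀ 0 j = r₀ := by
  rw [stripRadius, h.transNorm_zero, one_mul]

lemma stripRadius_le (h : SplitVectors A u v) {r₀ : ℝ} (hr : 0 ≤ r₀) (l : ℕ) (j : ℤ → Fin N) :
    stripRadius A u r₀ l j ≤ r₀ :=
  mul_le_of_le_one_left hr ((h.transNorm_le_norm _ _).trans (h.norm_cocycle_le_one _ _))

lemma stripRadius_add (h : SplitVectors A u v) (r₀ : ℝ) (l n : ℕ) (j : ℤ → Fin N) :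
    stripRadius A u r₀ (l + n) j =
      transNorm A u n (shiftBy (-n) j) * stripRadius A u r₀ l (shiftBy (-n) j) := by
  have e1 : (l + -((l + n : ℕ) : ℤ)) = -(n : ℤ) := by push_cast; ring
  have e2 : (-(l : ℤ) + -n) = -((l + n : ℕ) : ℤ) := by push_cast; ring
  rw [stripRadius, stripRadius, h.transNorm_add, shiftBy_shiftBy, shiftBy_shiftBy, e1, e2, mul_assoc]

lemma exists_stripRadius_le_pow (h : SplitVectors A u v) :
    ∃ ρ : ℝ, 0 < ρ ∧ ρ < 1 ∧ ∀ r₀ : ℝ, 0 ≤ r₀ → ∀ l j, stripRadius A u r₀ l j ≤ ρ ^ l * r₀ := by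
  obtain ⟨ρ, hρ0, hρ1, hρ⟩ := exists_contraction_bound h.contr
  exact ⟨ρ, hρ0, hρ1, fun r₀ hr l j => mul_le_mul_of_nonneg_right
    ((h.transNorm_le_norm _ _).trans (norm_cocycle_le hρ _ _)) hr⟩

lemma tendsto_stripRadius (h : SplitVectors A u v) {r₀ : ℝ} (hr : 0 < r₀) (j : ℤ → Fin N) :
    Tendsto (fun l => stripRadius A u r₀ l j) atTop (𝓝[>] 0) := by
  obtain ⟨ρ, hρ0, hρ1, hle⟩ := h.exists_stripRadius_le_pow
  refine tendsto_nhdsWithin_iff.2 ⟨?_, Eventually.of_forall fun l => h.stripRadius_pos hr l j⟩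
  have := (tendsto_pow_atTop_nhds_zero_of_lt_one hρ0.le hρ1).mul_const r₀
  rw [zero_mul] at this
  exact squeeze_zero (fun l => (h.stripRadius_pos hr l j).le) (fun l => hle r₀ hr.le l j) this

/-- Within a cylinder, differences of points are images under the cocycle, which carries `u (shiftBy
(-n) j)` into the line of `u j` and scales the distance to that line exactly by `transNorm`. Strips
renormalise to strips with no error. -/
lemma cylinder_strip (h : SplitVectors A u v) (j : ℤ → Fin N) (n : ℕ) (r : ℝ) (a : ℕ → Fin N)
    (ha : ∀ k < n, a k = past j k) :
    natProj A t a ∈ strip A t u j (transNorm A u n (shiftBy (-n) j) * r) ↔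
      natProj A t (dropWord n a) ∈ strip A t u (shiftBy (-n) j) r := by
  have h1 := h.abs_cross_act_cocycle n (shiftBy (-n) j)
    (natProj A t (dropWord n a) - pastPoint A t (shiftBy (-n) j))
  rw [shiftBy_shiftBy, add_neg_cancel, shiftBy_zero] at h1
  rw [strip, strip, Set.mem_ofPred_eq, Set.mem_ofPred_eq, natProj_sub_pastPoint h.contr j a n ha, h1]
  exact mul_le_mul_iff_right₀ (h.transNorm_pos _ _)

/-- The mass of the part of a strip in a cylinder. -/
lemma measure_cylinder_strip (h : SplitVectors A u v) (j : ℤ → Fin N) (n : ℕ) (r : ℝ) :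
    (Measure.infinitePi fun _ : ℕ => κ).real {a | (∀ k < n, a k = past j k) ∧
      natProj A t a ∈ strip A t u j (transNorm A u n (shiftBy (-n) j) * r)} =
      (∏ k ∈ Finset.range n, κ.real {past j k}) * stripMass κ A t u (shiftBy (-n) j) r := by
  have hm : MeasurableSet (natProj A t ⁻¹' strip A t u (shiftBy (-n) j) r) :=
    measurable_natProj h.contr (isClosed_strip _ _).measurableSet
  have h1 := infinitePi_cylinder κ (past j) n hm
  have h2 : {a | (∀ k < n, a k = past j k) ∧
      natProj A t a ∈ strip A t u j (transNorm A u n (shiftBy (-n) j) * r)} =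
      {a | (∀ k < n, a k = past j k) ∧
        dropWord n a ∈ natProj A t ⁻¹' strip A t u (shiftBy (-n) j) r} := by
    ext a
    exact and_congr_right fun ha => h.cylinder_strip j n r a ha
  rw [h2, measureReal_def, h1, ENNReal.toReal_mul, ENNReal.toReal_prod, stripMass, measureReal_def,
    codedMeasure, Measure.map_apply (measurable_natProj h.contr) (isClosed_strip _ _).measurableSet]
  rfl

/-- The one-step renormalisation. As the radii are multiplicative along the past, it links depth l +
1 at j with depth l at the shifted word. -/
lemma stripPart_succ (h : SplitVectors A u v) (r₀ : ℝ) (l : ℕ) (j : ℤ → Fin N) :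
    stripPart κ A t u j (stripRadius A u r₀ (l + 1) j) = κ.real {j (-1)} *
      stripMass κ A t u (shiftBy (-1) j) (stripRadius A u r₀ l (shiftBy (-1) j)) := by
  have h1 := h.measure_cylinder_strip (κ := κ) (t := t) j 1 (stripRadius A u r₀ l (shiftBy (-1) j))
  have h2 := h.stripRadius_add r₀ l 1 j
  rw [Nat.cast_one] at h1 h2
  rw [← h2, Finset.prod_range_one] at h1
  have e : past j 0 = j (-1) := by simp [past]
  rw [e] at h1
  rw [← h1, stripPart, measureReal_def, measureReal_def, codedPiece,
    Measure.map_apply (measurable_natProj h.contr) (isClosed_strip _ _).measurableSet,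
    Measure.restrict_apply (measurable_natProj h.contr (isClosed_strip _ _).measurableSet)]
  congr 2
  ext a
  simp [past, and_comm]

/-- The telescoping ends here: r₀ bounds the diameter of the attractor, so the widest strip carries
all the mass. -/
lemma stripMass_radius_zero (h : SplitVectors A u v) {r₀ : ℝ}
    (hr : ∀ a b, ‖natProj A t a - natProj A t b‖ ≤ r₀) (j : ℤ → Fin N) :
    stripMass κ A t u j (stripRadius A u r₀ 0 j) = 1 := by
  rw [h.stripRadius_zero, stripMass, measureReal_def, codedMeasure,
    Measure.map_apply (measurable_natProj h.contr) (isClosed_strip _ _).measurableSet]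
  have : natProj A t ⁻¹' strip A t u j r₀ = Set.univ := by
    refine Set.eq_univ_of_forall fun a => ?_
    refine (abs_cross_le _ _).trans ?_
    rw [h.norm_u, mul_one]
    exact hr _ _
  rw [this, measure_univ, ENNReal.toReal_one]

lemma stripMass_radius_pos (h : SplitVectors A u v) {r₀ : ℝ}
    (hr : ∀ a b, ‖natProj A t a - natProj A t b‖ ≤ r₀) (l : ℕ) {j : ℤ → Fin N}
    (hj : ∀ k, 0 < κ.real {j k}) : 0 < stripMass κ A t u j (stripRadius A u r₀ l j) := by
  induction l generalizing j with
  | zero => rw [h.stripMass_radius_zero hr]; exact one_pos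
  | succ l ih =>
    refine lt_of_lt_of_le ?_ (stripPart_le_stripMass h.contr _ _)
    rw [h.stripPart_succ]
    exact mul_pos (hj _) (ih fun k => hj _)

lemma stripMass_pos (h : SplitVectors A u v) {r₀ : ℝ} (hr0 : 0 < r₀)
    (hr : ∀ a b, ‖natProj A t a - natProj A t b‖ ≤ r₀) {j : ℤ → Fin N}
    (hj : ∀ k, 0 < κ.real {j k}) {r : ℝ} (hrpos : 0 < r) : 0 < stripMass κ A t u j r := by
  obtain ⟨l, hl⟩ := (((h.tendsto_stripRadius hr0 j).mono_right
    nhdsWithin_le_nhds).eventually_lt_const hrpos).exists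
  exact (h.stripMass_radius_pos hr l hj).trans_le (stripMass_mono j hl.le)

lemma stripRatio_succ_pos (h : SplitVectors A u v) {r₀ : ℝ}
    (hr : ∀ a b, ‖natProj A t a - natProj A t b‖ ≤ r₀) (l : ℕ) {j : ℤ → Fin N}
    (hj : ∀ k, 0 < κ.real {j k}) : 0 < stripRatio κ A t u r₀ (l + 1) j := by
  refine div_pos ?_ (h.stripMass_radius_pos hr _ hj)
  rw [h.stripPart_succ]
  exact mul_pos (hj _) (h.stripMass_radius_pos hr _ fun k => hj _)

lemma stripRatio_le_one (h : SplitVectors A u v) (r₀ : ℝ) (l : ℕ) (j : ℤ → Fin N) :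
    stripRatio κ A t u r₀ l j ≤ 1 :=
  div_le_one_of_le₀ (stripPart_le_stripMass h.contr _ _) measureReal_nonneg

/-- Each strip mass is the symbol weight times the strip mass at the shifted word, divided by the
ratio. The depth m - k falls as the orbit advances, which is why an ergodic theorem along the
reversed index is needed. -/
lemma neg_log_stripMass (h : SplitVectors A u v) {r₀ : ℝ}
    (hr : ∀ a b, ‖natProj A t a - natProj A t b‖ ≤ r₀) (m : ℕ) {j : ℤ → Fin N}
    (hj : ∀ k, 0 < κ.real {j k}) :
    -Real.log (stripMass κ A t u j (stripRadius A u r₀ m j)) =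
      ∑ k ∈ Finset.range m, (-Real.log (κ.real {((shiftBy (-1))^[k] j) (-1)}) +
        Real.log (stripRatio κ A t u r₀ (m - k) ((shiftBy (-1))^[k] j))) := by
  induction m generalizing j with
  | zero => rw [h.stripMass_radius_zero hr]; simp
  | succ m ih =>
    have hj' : ∀ k, 0 < κ.real {shiftBy (-1) j k} := fun k => hj _
    have h1 := ih hj'
    have h2 := h.stripMass_radius_pos hr (m + 1) hj
    have h3 := h.stripMass_radius_pos hr m hj'
    have h4 : Real.log (stripRatio κ A t u r₀ (m + 1) j) = Real.log (κ.real {j (-1)}) +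
        Real.log (stripMass κ A t u (shiftBy (-1) j) (stripRadius A u r₀ m (shiftBy (-1) j))) -
        Real.log (stripMass κ A t u j (stripRadius A u r₀ (m + 1) j)) := by
      rw [stripRatio, h.stripPart_succ, Real.log_div (mul_pos (hj _) h3).ne' h2.ne',
        Real.log_mul (hj _).ne' h3.ne']
    rw [Finset.sum_range_succ']
    simp only [Nat.add_sub_add_right, Function.iterate_succ_apply]
    rw [← h1, Function.iterate_zero_apply, Nat.sub_zero, h4]
    ring

end SplitVectors

end Strips

end SelfAffine

end

noncomputable section

namespace SelfAffine

/-! ### Convergence and domination of the strip ratios -/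

section StripRatios

variable {N : ℕ} {A : Fin N → Matrix (Fin 2) (Fin 2) ℝ} {t : Fin N → Plane}
  {u v : (ℤ → Fin N) → Plane}

lemma past_glue (x : (ℕ → Fin N) × (ℕ → Fin N)) : past (glue x) = x.2 := by
  ext k; rw [past, glue_neg]

lemma glue_neg_one (x : (ℕ → Fin N) × (ℕ → Fin N)) : glue x (-1) = x.2 0 := by
  simpa using glue_neg x 0

lemma ae_symbol_pos (κ : Measure (Fin N)) [IsProbabilityMeasure κ] :
    ∀ᵐ j ∂(Measure.infinitePi fun _ : ℤ => κ), ∀ k, 0 < κ.real {j k} := by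
  refine ae_all_iff.2 fun k => ?_
  have h1 : ∀ᵐ i ∂κ, 0 < κ.real {i} := by
    refine ae_iff.2 ?_
    refine (measure_null_iff_singleton (Set.to_countable _)).2 fun i hi => ?_
    exact (measureReal_eq_zero_iff).1 (le_antisymm (not_lt.1 hi) measureReal_nonneg)
  exact (measurePreserving_eval_infinitePi (fun _ : ℤ => κ) k).quasiMeasurePreserving.ae h1

namespace SplitVectors

lemma abs_cross_congr (h : SplitVectors A u v) {j j' : ℤ → Fin N} (hj : ∀ k : ℕ, j k = j' k)
    (x : Plane) : |cross x (u j)| = |cross x (u j')| := by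
  have h1 := eq_smul_of_cross_eq_zero (h.norm_u j') (h.cross_eq_zero_of_future hj)
  have h2 := congrArg norm h1
  rw [norm_smul, h.norm_u, h.norm_u, mul_one, Real.norm_eq_abs] at h2
  rw [h1, cross_smul_right, abs_mul, ← h2, one_mul]

lemma measurable_abs_cross_uncurry (h : SplitVectors A u v) :
    Measurable fun q : Plane × (ℤ → Fin N) => |cross q.1 (u q.2)| := by
  have h1 : ∀ j : ℤ → Fin N, Continuous fun y : Plane => |cross y (u j)| := fun j =>
    (continuous_cross_left (u j)).abs
  exact measurable_uncurry_of_continuous_of_measurable (u := fun y j => |cross y (u j)|) h1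
    h.measurable_abs_cross

lemma measurableSet_strip (h : SplitVectors A u v) {r : (ℤ → Fin N) → ℝ} (hr : Measurable r) :
    MeasurableSet {q : (ℤ → Fin N) × Plane | q.2 ∈ strip A t u q.1 (r q.1)} := by
  have h1 : Measurable fun q : (ℤ → Fin N) × Plane => (q.2 - pastPoint A t q.1, q.1) :=
    (measurable_snd.sub ((measurable_pastPoint h.contr).comp measurable_fst)).prodMk measurable_fst
  exact measurableSet_le (h.measurable_abs_cross_uncurry.comp h1) (hr.comp measurable_fst)

variable {κ : Measure (Fin N)}

/-- With the future a fixed, all strips are parallel and become intervals under a single linear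
functional. The auxiliary past b' fixes one sign of that functional for all b. -/
lemma strip_glue (h : SplitVectors A u v) (a b b' : ℕ → Fin N) (r : ℝ) :
    strip A t u (glue (a, b)) r = (fun y => cross y (u (glue (a, b')))) ⁻¹'
      Metric.closedBall (cross (natProj A t b) (u (glue (a, b')))) r := by
  ext y
  rw [strip, Set.mem_ofPred_eq, Set.mem_preimage, Metric.mem_closedBall, Real.dist_eq,
    ← cross_sub_left, pastPoint, past_glue,
    h.abs_cross_congr (j := glue (a, b)) (j' := glue (a, b')) (fun k => rfl)]

/-- The projection of a cylinder along a fixed strong stable direction. -/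
lemma stripPart_glue (h : SplitVectors A u v) (a b b' : ℕ → Fin N) (r : ℝ) :
    codedPiece κ A t (b 0) (strip A t u (glue (a, b)) r) =
      ((Measure.infinitePi fun _ : ℕ => κ).restrict {a | a 0 = b 0}).map
        (fun b => cross (natProj A t b) (u (glue (a, b'))))
        (Metric.closedBall (cross (natProj A t b) (u (glue (a, b')))) r) := by
  have hm := measurable_natProj (t := t) h.contr
  have hc := (continuous_cross_left (u (glue (a, b')))).measurable
  rw [codedPiece, Measure.map_apply hm (isClosed_strip _ _).measurableSet, h.strip_glue a b b',
    Measure.map_apply (f := fun b => cross (natProj A t b) (u (glue (a, b')))) (hc.comp hm)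
      Metric.isClosed_closedBall.measurableSet]
  rfl

lemma stripMass_glue (h : SplitVectors A u v) (a b b' : ℕ → Fin N) (r : ℝ) :
    codedMeasure κ A t (strip A t u (glue (a, b)) r) =
      (Measure.infinitePi fun _ : ℕ => κ).map (fun b => cross (natProj A t b) (u (glue (a, b'))))
        (Metric.closedBall (cross (natProj A t b) (u (glue (a, b')))) r) := by
  have hm := measurable_natProj (t := t) h.contr
  have hc := (continuous_cross_left (u (glue (a, b')))).measurable
  rw [codedMeasure, Measure.map_apply hm (isClosed_strip _ _).measurableSet, h.strip_glue a b b',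
    Measure.map_apply (f := fun b => cross (natProj A t b) (u (glue (a, b')))) (hc.comp hm)
      Metric.isClosed_closedBall.measurableSet]
  rfl

variable [IsProbabilityMeasure κ]

lemma measurable_stripMass (h : SplitVectors A u v) {r : (ℤ → Fin N) → ℝ} (hr : Measurable r) :
    Measurable fun j => stripMass κ A t u j (r j) :=
  (measurable_measure_prodMk_left (ν := codedMeasure κ A t)
    (h.measurableSet_strip hr)).ennreal_toReal

lemma measurable_stripPart (h : SplitVectors A u v) {r : (ℤ → Fin N) → ℝ} (hr : Measurable r) :
    Measurable fun j => stripPart κ A t u j (r j) := by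
  have h1 : Measurable fun q : Fin N × (ℤ → Fin N) =>
      (codedPiece κ A t q.1).real (strip A t u q.2 (r q.2)) := by
    refine measurable_from_prod_countable_right fun c => ?_
    exact (measurable_measure_prodMk_left (ν := codedPiece κ A t c)
      (h.measurableSet_strip hr)).ennreal_toReal
  have h2 : Measurable fun j : ℤ → Fin N => (j (-1), j) :=
    (measurable_pi_apply (-1)).prodMk measurable_id
  exact h1.comp h2

lemma measurable_transNorm_iterate (h : SplitVectors A u v) (n : ℕ) :
    Measurable (transNorm A u n) := by
  induction n with
  | zero =>
    have : transNorm A u 0 = fun _ => 1 := funext h.transNorm_zero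
    rw [this]; exact measurable_const
  | succ n ih =>
    have : transNorm A u (n + 1) = fun j => transNorm A u 1 (shiftBy n j) * transNorm A u n j :=
      funext fun j => h.transNorm_add n 1 j
    rw [this]
    exact (h.measurable_transNorm.comp (measurable_shiftBy _)).mul ih

lemma measurable_stripRadius (h : SplitVectors A u v) (r₀ : ℝ) (l : ℕ) :
    Measurable (stripRadius A u r₀ l) :=
  ((h.measurable_transNorm_iterate l).comp (measurable_shiftBy _)).mul_const r₀

lemma measurable_stripRatio (h : SplitVectors A u v) (r₀ : ℝ) (l : ℕ) :
    Measurable (stripRatio κ A t u r₀ l) :=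
  (h.measurable_stripPart (h.measurable_stripRadius r₀ l)).div
    (h.measurable_stripMass (h.measurable_stripRadius r₀ l))

/-- The ratios are small only with small probability, conditionally on the future. -/
lemma exists_ratio_tail_future (h : SplitVectors A u v) {r₀ : ℝ} (hr : 0 < r₀) :
    ∃ K : ℕ, ∀ (a : ℕ → Fin N) (k : ℕ), (Measure.infinitePi fun _ : ℕ => κ)
      {b | ∃ l, stripRatio κ A t u r₀ l (glue (a, b)) ≤ Real.exp (-k)} ≤
        K * ENNReal.ofReal (Real.exp (-k)) := by
  obtain ⟨K, hK⟩ := exists_maximal_inequality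
  refine ⟨N * K, fun a k => ?_⟩
  set P := Measure.infinitePi fun _ : ℕ => κ
  set φ : (ℕ → Fin N) → ℝ := fun b => cross (natProj A t b) (u (glue (a, a)))
  have hφ : Measurable φ := (continuous_cross_left _).measurable.comp (measurable_natProj h.contr)
  set s : NNReal := (Real.exp (-k)).toNNReal
  have hs : (s : ℝ≥0∞) = ENNReal.ofReal (Real.exp (-k)) := rfl
  have hpiece : ∀ c, P {b | b 0 = c ∧ ∃ l, stripRatio κ A t u r₀ l (glue (a, b)) ≤ Real.exp (-k)} ≤
      K * ENNReal.ofReal (Real.exp (-k)) := by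
    intro c
    -- The maximal inequality compares the projection of the piece over c with the projection of the
    -- whole measure. Summing over the symbols c costs the factor N.
    have h1 := hK ((P.restrict {a | a 0 = c}).map φ) (P.map φ) r₀ s
    rw [Measure.map_apply hφ MeasurableSet.univ, Set.preimage_univ, measure_univ, mul_one, hs] at h1
    refine le_trans ?_ ((Measure.le_map_apply hφ.aemeasurable _).trans h1)
    rw [Measure.restrict_apply' (measurableSet_eval_eq c)]
    refine measure_mono ?_
    rintro b ⟨rfl, l, hl⟩
    refine ⟨⟨stripRadius A u r₀ l (glue (a, b)), h.stripRadius_pos hr _ _,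
      h.stripRadius_le hr.le _ _, ?_⟩, rfl⟩
    rw [← h.stripPart_glue a b a, ← h.stripMass_glue a b a]
    have h2 : stripPart κ A t u (glue (a, b)) (stripRadius A u r₀ l (glue (a, b))) ≤
        Real.exp (-k) * stripMass κ A t u (glue (a, b)) (stripRadius A u r₀ l (glue (a, b))) := by
      have h3 := stripPart_le_stripMass (κ := κ) (t := t) (u := u) h.contr (glue (a, b))
        (stripRadius A u r₀ l (glue (a, b)))
      -- If the strip has mass 0, the quotient is 0 by convention, but the part is 0 too and the
      -- inequality persists.
      rcases (measureReal_nonneg : 0 ≤ stripMass κ A t u (glue (a, b))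
        (stripRadius A u r₀ l (glue (a, b)))).eq_or_lt with h4 | h4
      · have h5 : stripMass κ A t u (glue (a, b)) (stripRadius A u r₀ l (glue (a, b))) = 0 := h4.symm
        rw [h5] at h3 ⊢
        rwa [mul_zero]
      · exact (div_le_iff₀ h4).1 hl
    rw [stripPart, stripMass, glue_neg_one] at h2
    have h5 := ENNReal.ofReal_le_ofReal h2
    rwa [ENNReal.ofReal_mul (Real.exp_pos _).le, ofReal_measureReal, ofReal_measureReal] at h5
  calc P {b | ∃ l, stripRatio κ A t u r₀ l (glue (a, b)) ≤ Real.exp (-k)}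
      ≤ P (⋃ c, {b | b 0 = c ∧ ∃ l, stripRatio κ A t u r₀ l (glue (a, b)) ≤ Real.exp (-k)}) :=
        measure_mono fun b hb => Set.mem_iUnion.2 ⟨b 0, rfl, hb⟩
    _ ≤ ∑ c, P {b | b 0 = c ∧ ∃ l, stripRatio κ A t u r₀ l (glue (a, b)) ≤ Real.exp (-k)} :=
        measure_iUnion_fintype_le _ _
    _ ≤ ∑ _c : Fin N, K * ENNReal.ofReal (Real.exp (-k)) := Finset.sum_le_sum fun c _ => hpiece c
    _ = _ := by simp [mul_assoc]

lemma exists_ratio_tail (h : SplitVectors A u v) {r₀ : ℝ} (hr : 0 < r₀) :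
    ∃ K : ℕ, ∀ k : ℕ, (Measure.infinitePi fun _ : ℤ => κ)
      {j | ∃ l, stripRatio κ A t u r₀ l j ≤ Real.exp (-k)} ≤
        K * ENNReal.ofReal (Real.exp (-k)) := by
  obtain ⟨K, hK⟩ := h.exists_ratio_tail_future (κ := κ) (t := t) hr
  refine ⟨K, fun k => ?_⟩
  have hm : MeasurableSet {j | ∃ l, stripRatio κ A t u r₀ l j ≤ Real.exp (-k)} := by
    have : {j | ∃ l, stripRatio κ A t u r₀ l j ≤ Real.exp (-k)} =
        ⋃ l, {j | stripRatio κ A t u r₀ l j ≤ Real.exp (-k)} := by ext; simp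
    rw [this]
    exact MeasurableSet.iUnion fun l => measurableSet_le (h.measurable_stripRatio r₀ l)
      measurable_const
  have hg := measurePreserving_glue κ
  rw [← hg.measure_preimage hm.nullMeasurableSet, Measure.prod_apply (hg.measurable hm)]
  refine (lintegral_mono fun a => hK a k).trans ?_
  rw [lintegral_const, measure_univ, mul_one]

/-- The logarithms of the ratios have an integrable envelope. -/
lemma exists_envelope (h : SplitVectors A u v) {r₀ : ℝ} (hr : 0 < r₀) :
    ∃ G : (ℤ → Fin N) → ℝ, Measurable G ∧ Integrable G (Measure.infinitePi fun _ : ℤ => κ) ∧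
      ∀ᵐ j ∂(Measure.infinitePi fun _ : ℤ => κ), ∀ l,
        |Real.log (stripRatio κ A t u r₀ l j)| ≤ G j := by
  obtain ⟨K, hK⟩ := h.exists_ratio_tail (κ := κ) (t := t) hr
  set F : (ℤ → Fin N) → ℝ≥0∞ := fun j =>
    ⨆ l, ENNReal.ofReal (-Real.log (stripRatio κ A t u r₀ l j))
  have hF : Measurable F :=
    Measurable.iSup fun l => ((h.measurable_stripRatio r₀ l).log.neg).ennreal_ofReal
  have hFi : ∫⁻ j, F j ∂(Measure.infinitePi fun _ : ℤ => κ) ≠ ∞ := by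
    refine lintegral_ne_top_of_tail hF (ENNReal.natCast_ne_top K) fun k =>
      (measure_mono ?_).trans (hK k)
    intro j hj
    obtain ⟨l, hl⟩ := lt_iSup_iff.1 (show (k : ℝ≥0∞) < F j from hj)
    refine ⟨l, ?_⟩
    rw [← ENNReal.ofReal_natCast, ENNReal.ofReal_lt_ofReal_iff_of_nonneg (Nat.cast_nonneg k)] at hl
    rcases (stripRatio_nonneg r₀ l j : 0 ≤ stripRatio κ A t u r₀ l j).eq_or_lt with h0 | h0
    · rw [← h0]; positivity
    · exact ((Real.log_lt_iff_lt_exp h0).1 (by linarith)).le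
  refine ⟨fun j => (F j).toReal, hF.ennreal_toReal, integrable_toReal_of_lintegral_ne_top
    hF.aemeasurable hFi, ?_⟩
  filter_upwards [ae_lt_top hF hFi] with j hj l
  rw [abs_of_nonpos (Real.log_nonpos (stripRatio_nonneg _ _ _) (h.stripRatio_le_one _ _ _))]
  exact (ENNReal.ofReal_le_iff_le_toReal hj.ne).1 (le_iSup
    (fun l => ENNReal.ofReal (-Real.log (stripRatio κ A t u r₀ l j))) l)

/-- For a fixed future the ratio is a quotient of two measures on the line over shrinking intervals,
and it converges almost surely to the Radon–Nikodym derivative. -/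
lemma ae_future_tendsto_stripRatio (h : SplitVectors A u v) {r₀ : ℝ} (hr : 0 < r₀)
    (a : ℕ → Fin N) : ∀ᵐ b ∂(Measure.infinitePi fun _ : ℕ => κ),
      ∃ L, Tendsto (fun l => stripRatio κ A t u r₀ l (glue (a, b))) atTop (𝓝 L) := by
  set P := Measure.infinitePi fun _ : ℕ => κ
  set φ : (ℕ → Fin N) → ℝ := fun b => cross (natProj A t b) (u (glue (a, a)))
  have hφ : Measurable φ := (continuous_cross_left _).measurable.comp (measurable_natProj h.contr)
  -- All symbols c are treated at once because the relevant piece is selected by b 0.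
  have h1 : ∀ c, ∀ᵐ b ∂P, Tendsto (fun r => (P.restrict {a | a 0 = c}).map φ
      (Metric.closedBall (φ b) r) / P.map φ (Metric.closedBall (φ b) r)) (𝓝[>] 0)
      (𝓝 (((P.restrict {a | a 0 = c}).map φ).rnDeriv (P.map φ) (φ b))) := fun c =>
    ae_of_ae_map hφ.aemeasurable
      (Besicovitch.ae_tendsto_rnDeriv ((P.restrict {a | a 0 = c}).map φ) (P.map φ))
  have h2 : ∀ c, ∀ᵐ b ∂P, ((P.restrict {a | a 0 = c}).map φ).rnDeriv (P.map φ) (φ b) < ∞ :=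
    fun c => ae_of_ae_map hφ.aemeasurable (Measure.rnDeriv_lt_top _ _)
  filter_upwards [ae_all_iff.2 h1, ae_all_iff.2 h2] with b hb hb'
  refine ⟨_, ((ENNReal.tendsto_toReal (hb' (b 0)).ne).comp ((hb (b 0)).comp
    (h.tendsto_stripRadius hr (glue (a, b))))).congr fun l => ?_⟩
  rw [Function.comp_apply, Function.comp_apply, ← h.stripPart_glue a b a,
    ← h.stripMass_glue a b a, ENNReal.toReal_div, stripRatio, stripPart, stripMass, glue_neg_one]
  rfl

lemma ae_tendsto_stripRatio (h : SplitVectors A u v) {r₀ : ℝ} (hr : 0 < r₀) :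
    ∀ᵐ j ∂(Measure.infinitePi fun _ : ℤ => κ),
      ∃ L, Tendsto (fun l => stripRatio κ A t u r₀ l j) atTop (𝓝 L) := by
  have hm : MeasurableSet {j | ∃ L, Tendsto (fun l => stripRatio κ A t u r₀ l j) atTop (𝓝 L)} :=
    measurableSet_exists_tendsto fun l => h.measurable_stripRatio r₀ l
  have hg := measurePreserving_glue κ
  rw [← hg.map_eq, ae_map_iff hg.measurable.aemeasurable hm]
  exact (Measure.ae_prod_iff_ae_ae (hg.measurable hm)).2
    (Eventually.of_forall fun a => h.ae_future_tendsto_stripRatio hr a)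

/-- The envelope keeps the ratios above exp(-G), so their limit is positive and the logarithm is
continuous there. -/
lemma exists_limit_log_stripRatio (h : SplitVectors A u v) {r₀ : ℝ} (hr0 : 0 < r₀)
    (hr : ∀ a b, ‖natProj A t a - natProj A t b‖ ≤ r₀) :
    ∃ g : (ℤ → Fin N) → ℝ, Measurable g ∧ ∀ᵐ j ∂(Measure.infinitePi fun _ : ℤ => κ),
      Tendsto (fun l => Real.log (stripRatio κ A t u r₀ l j)) atTop (𝓝 (g j)) := by
  obtain ⟨G, -, -, hG⟩ := h.exists_envelope (κ := κ) (t := t) hr0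
  have key : ∀ᵐ j ∂(Measure.infinitePi fun _ : ℤ => κ), ∃ L : ℝ,
      Tendsto (fun l => Real.log (stripRatio κ A t u r₀ l j)) atTop (𝓝 L) := by
    filter_upwards [h.ae_tendsto_stripRatio (κ := κ) (t := t) hr0, hG,
      ae_symbol_pos κ] with j ⟨L, hL⟩ hGj hj
    have hpos : 0 < L := by
      refine (Real.exp_pos (-G j)).trans_le (ge_of_tendsto hL ?_)
      filter_upwards [eventually_gt_atTop 0] with l hl
      obtain ⟨l, rfl⟩ := Nat.exists_eq_add_of_lt hl
      rw [zero_add]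
      rw [← Real.le_log_iff_exp_le (h.stripRatio_succ_pos hr l hj)]
      exact (abs_le.1 (hGj (l + 1))).1
    exact ⟨Real.log L, hL.log hpos.ne'⟩
  obtain ⟨g, hg, hg'⟩ := measurable_limit_of_tendsto_metrizable_ae
    (fun l => (h.measurable_stripRatio (κ := κ) (t := t) r₀ l).log.aemeasurable) key
  exact ⟨g, hg, hg'⟩

end SplitVectors

end StripRatios

end SelfAffine

end

noncomputable section

namespace SelfAffine

/-! ### Asymptotics of the strip masses and the transversal measures -/

section Asymptotics

variable {N : ℕ} {A : Fin N → Matrix (Fin 2) (Fin 2) ℝ} {t : Fin N → Plane}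
  {u v : (ℤ → Fin N) → Plane}

/-- The information of the cylinder of length `n` of the past of `j`. -/
def pastInformation (κ : Measure (Fin N)) (j : ℤ → Fin N) (n : ℕ) : ℝ :=
  -∑ k ∈ Finset.range n, Real.log (κ.real {past j k})

/-- The entropy of a measure on the symbols. -/
def symbolEntropy (κ : Measure (Fin N)) : ℝ := ∫ i, -Real.log (κ.real {i}) ∂κ

lemma symbolEntropy_symbolMeasure {p : Fin N → ℝ} (hp : ∀ i, 0 ≤ p i) :
    symbolEntropy (symbolMeasure p) = entropy p := by
  rw [symbolEntropy, integral_symbolMeasure hp, entropy]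
  refine Finset.sum_congr rfl fun i _ => ?_
  rw [measureReal_def, symbolMeasure_singleton, ENNReal.toReal_ofReal (hp i), Real.negMulLog]
  ring

/-- The asymptotic description of the masses of the strips along the backward orbit of `j`. -/
structure StripAsymptotics (κ : Measure (Fin N)) (A : Fin N → Matrix (Fin 2) (Fin 2) ℝ)
    (t : Fin N → Plane) (u : (ℤ → Fin N) → Plane) (r₀ β : ℝ) (j : ℤ → Fin N) (b E : ℕ → ℝ) :
    Prop where
  tendsto_main : Tendsto (fun n => b n / n) atTop (𝓝 β)
  tendsto_error : Tendsto (fun n => E n / n) atTop (𝓝 0)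
  abs_sub_le : ∀ n m : ℕ, n ≤ m →
    |-Real.log (stripMass κ A t u (shiftBy (-n) j) (stripRadius A u r₀ (m - n) (shiftBy (-n) j))) -
      (b m - b n)| ≤ E m

variable {κ : Measure (Fin N)}

/-- The orthogonal projection away from a line measures the distance to it, so balls of the
transversal measure are strips. -/
lemma SplitVectors.transversal_closedBall (h : SplitVectors A u v) (j : ℤ → Fin N) (r : ℝ) :
    (transversalMeasure (codedMeasure κ A t) (Submodule.span ℝ {u j})).real
      (Metric.closedBall ((Submodule.span ℝ {u j})ᗮ.starProjection (pastPoint A t j)) r) =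
      stripMass κ A t u j r := by
  rw [transversalMeasure, measureReal_def, Measure.map_apply (ContinuousLinearMap.measurable _)
    Metric.isClosed_closedBall.measurableSet, stripMass, measureReal_def]
  congr 2
  ext y
  rw [Set.mem_preimage, Metric.mem_closedBall, dist_eq_norm, ← map_sub,
    norm_starProjection_orthogonal_span _ (h.norm_u j)]
  rfl

variable [IsProbabilityMeasure κ]

lemma integrable_log_symbol :
    Integrable (fun j : ℤ → Fin N => -Real.log (κ.real {j (-1)}))
      (Measure.infinitePi fun _ : ℤ => κ) :=
  ((measurePreserving_eval_infinitePi (fun _ : ℤ => κ) (-1)).integrable_comp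
    (g := fun i => -Real.log (κ.real {i})) (measurable_of_finite _).aestronglyMeasurable).2
    (Integrable.of_finite)

lemma measurable_log_symbol (κ : Measure (Fin N)) :
    Measurable fun j : ℤ → Fin N => -Real.log (κ.real {j (-1)}) :=
  (measurable_of_finite fun i => -Real.log (κ.real {i})).comp (measurable_pi_apply (-1))

lemma iterate_shiftBy_neg_one (n : ℕ) (j : ℤ → Fin N) : (shiftBy (-1))^[n] j = shiftBy (-n) j := by
  rw [iterate_shiftBy, mul_neg_one]

lemma ae_tendsto_pastInformation (κ : Measure (Fin N)) [IsProbabilityMeasure κ] :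
    ∀ᵐ j ∂(Measure.infinitePi fun _ : ℤ => κ),
      Tendsto (fun n : ℕ => pastInformation κ j n / n) atTop (𝓝 (symbolEntropy κ)) := by
  have h1 := ae_tendsto_birkhoffSum_div (ergodic_shiftBy κ (c := -1) (by norm_num))
    (measurable_log_symbol κ) integrable_log_symbol
  have hmp := measurePreserving_eval_infinitePi (fun _ : ℤ => κ) (-1)
  have h2 : ∫ j, -Real.log (κ.real {j (-1)}) ∂(Measure.infinitePi fun _ : ℤ => κ) =
      symbolEntropy κ := by
    have h3 := integral_map (μ := Measure.infinitePi fun _ : ℤ => κ)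
      (f := fun i => -Real.log (κ.real {i})) hmp.measurable.aemeasurable
      (measurable_of_finite _).aestronglyMeasurable
    rw [hmp.map_eq] at h3
    exact h3.symm
  rw [h2] at h1
  filter_upwards [h1] with j hj
  refine hj.congr fun n => ?_
  rw [pastInformation, birkhoffSum, Finset.sum_neg_distrib]
  congr 3
  ext k
  rw [iterate_shiftBy_neg_one, shiftBy, past, sub_eq_add_neg]

namespace SplitVectors

/-- Replacing the ratios by their limit g turns the telescoping sum into a Birkhoff sum b of the
inverse shift, and β is the mean of its summand. The error E is the sum in Maker's theorem. -/
lemma exists_stripAsymptotics (h : SplitVectors A u v) {r₀ : ℝ} (hr0 : 0 < r₀)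
    (hr : ∀ a b, ‖natProj A t a - natProj A t b‖ ≤ r₀) :
    ∃ β : ℝ, ∀ᵐ j ∂(Measure.infinitePi fun _ : ℤ => κ),
      ∃ b E, StripAsymptotics κ A t u r₀ β j b E := by
  obtain ⟨G, hGm, hGi, hG⟩ := h.exists_envelope (κ := κ) (t := t) hr0
  obtain ⟨g, hgm, hg⟩ := h.exists_limit_log_stripRatio (κ := κ) hr0 hr
  have hT := ergodic_shiftBy (N := N) κ (c := -1) (by norm_num)
  have hgi : Integrable g (Measure.infinitePi fun _ : ℤ => κ) := by
    refine hGi.mono' hgm.aestronglyMeasurable ?_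
    filter_upwards [hG, hg] with j h1 h2
    exact le_of_tendsto' h2.norm fun l => h1 l
  set f : (ℤ → Fin N) → ℝ := fun j => -Real.log (κ.real {j (-1)}) + g j
  have h1 := ae_tendsto_birkhoffSum_div hT (f := f) ((measurable_log_symbol κ).add hgm)
    (integrable_log_symbol.add hgi)
  have h2 := ae_tendsto_sum_abs_sub_div hT
    (fun l => (h.measurable_stripRatio (κ := κ) (t := t) r₀ l).log) hgm hGm hGi hG hg
  refine ⟨∫ j, f j ∂(Measure.infinitePi fun _ : ℤ => κ), ?_⟩
  filter_upwards [h1, h2, ae_symbol_pos κ] with j hj1 hj2 hj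
  refine ⟨_, _, hj1, hj2, fun n m hnm => ?_⟩
  obtain ⟨d, rfl⟩ := Nat.exists_eq_add_of_le hnm
  rw [Nat.add_sub_cancel_left, h.neg_log_stripMass hr d (j := shiftBy (-n) j)
    (fun k => hj _), birkhoffSum_add, add_sub_cancel_left, iterate_shiftBy_neg_one, birkhoffSum, ← Finset.sum_sub_distrib,
    Finset.sum_range_add]
  -- The error over the window from n to m is part of the sum of absolute values up to m. This gives
  -- the bound E m uniformly in n.
  refine (Finset.abs_sum_le_sum_abs _ _).trans (le_trans (Finset.sum_le_sum fun k _ => ?_)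
    (le_add_of_nonneg_left (Finset.sum_nonneg fun k _ => abs_nonneg _)))
  simp only [f]
  rw [add_sub_add_left_eq_sub, Nat.add_sub_add_left, add_comm n k, Function.iterate_add_apply,
    iterate_shiftBy_neg_one n]

lemma ae_tendsto_neg_log_stripRadius (h : SplitVectors A u v) {r₀ : ℝ} (hr0 : 0 < r₀) :
    ∀ᵐ j ∂(Measure.infinitePi fun _ : ℤ => κ), Tendsto (fun n : ℕ =>
      -Real.log (stripRadius A u r₀ n j) / n) atTop (𝓝 (transExponent κ A u)) := by
  filter_upwards [h.ae_tendsto_log_transNorm_backward (κ := κ)] with j hj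
  have h1 := (hj.neg).sub ((tendsto_const_nhds (x := Real.log r₀)).div_atTop
    (tendsto_natCast_atTop_atTop (R := ℝ)))
  rw [neg_neg, sub_zero] at h1
  refine h1.congr fun n => ?_
  rw [stripRadius, Real.log_mul (h.transNorm_pos _ _).ne' hr0.ne']
  ring

/-- The strip asymptotics with n = 0, sampled along the radii of depth m, whose logarithms grow like
-m times the transversal exponent. -/
lemma hasLocalDim_transversal (h : SplitVectors A u v) {r₀ β : ℝ} (hr0 : 0 < r₀)
    (hr : ∀ a b, ‖natProj A t a - natProj A t b‖ ≤ r₀)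
    (hβ : ∀ᵐ j ∂(Measure.infinitePi fun _ : ℤ => κ), ∃ b E, StripAsymptotics κ A t u r₀ β j b E) :
    ∀ᵐ j ∂(Measure.infinitePi fun _ : ℤ => κ),
      HasLocalDim (transversalMeasure (codedMeasure κ A t) (Submodule.span ℝ {u j}))
        ((Submodule.span ℝ {u j})ᗮ.starProjection (pastPoint A t j))
        (β / transExponent κ A u) := by
  filter_upwards [hβ, h.ae_tendsto_neg_log_stripRadius (κ := κ) hr0, ae_symbol_pos κ] with j
    ⟨b, E, hb⟩ hς hj
  have hpos : ∀ n : ℕ, 0 < (transversalMeasure (codedMeasure κ A t) (Submodule.span ℝ {u j})).real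
      (Metric.closedBall ((Submodule.span ℝ {u j})ᗮ.starProjection (pastPoint A t j))
        (Real.exp (-n))) := fun n => by
    rw [h.transversal_closedBall]
    exact h.stripMass_pos hr0 hr hj (Real.exp_pos _)
  have hprob := isProbabilityMeasure_codedMeasure (κ := κ) (t := t) h.contr
  have : IsProbabilityMeasure (transversalMeasure (codedMeasure κ A t) (Submodule.span ℝ {u j})) :=
    Measure.isProbabilityMeasure_map (ContinuousLinearMap.measurable _).aemeasurable
  refine hasLocalDim_of_tendsto hpos (tendsto_div_of_tendsto_subseq (logBall_mono hpos)
    h.transExponent_pos hς ?_)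
  have h1 : Tendsto (fun m : ℕ => (b m - b 0) / m) atTop (𝓝 β) := by
    have := hb.tendsto_main.sub ((tendsto_const_nhds (x := b 0)).div_atTop
      (tendsto_natCast_atTop_atTop (R := ℝ)))
    rw [sub_zero] at this
    exact this.congr fun m => (sub_div _ _ _).symm
  have h2 : Tendsto (fun m : ℕ => (logBall
      (transversalMeasure (codedMeasure κ A t) (Submodule.span ℝ {u j}))
      ((Submodule.span ℝ {u j})ᗮ.starProjection (pastPoint A t j))
      (-Real.log (stripRadius A u r₀ m j))) / m - (b m - b 0) / m) atTop (𝓝 0) := by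
    refine squeeze_zero_norm (fun m => ?_) hb.tendsto_error
    rw [← sub_div, norm_div, Real.norm_natCast, Real.norm_eq_abs]
    refine div_le_div_of_nonneg_right ?_ (Nat.cast_nonneg m)
    have h3 := hb.abs_sub_le 0 m m.zero_le
    rw [Nat.cast_zero, neg_zero, shiftBy_zero, Nat.sub_zero] at h3
    rw [logBall, neg_neg, Real.exp_log (h.stripRadius_pos hr0 m j), h.transversal_closedBall]
    exact h3
  simpa using h2.add h1

/-- The transversal measures have the same dimension for almost every future. -/
lemma ae_dimHMeasure_transversal (h : SplitVectors A u v) {r₀ β : ℝ} (hr0 : 0 < r₀)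
    (hr : ∀ a b, ‖natProj A t a - natProj A t b‖ ≤ r₀)
    (hβ : ∀ᵐ j ∂(Measure.infinitePi fun _ : ℤ => κ), ∃ b E, StripAsymptotics κ A t u r₀ β j b E) :
    ∀ᵐ i ∂(Measure.infinitePi fun _ : ℕ => κ), ∀ j : ℤ → Fin N, (∀ n : ℕ, j n = i n) →
      dimHMeasure (transversalMeasure (codedMeasure κ A t) (Submodule.span ℝ {u j})) =
        ENNReal.ofReal (β / transExponent κ A u) := by
  have h1 := h.hasLocalDim_transversal hr0 hr hβ
  have hg := measurePreserving_glue κ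
  -- By Fubini, for almost every future the statement holds for almost every past, and the past
  -- distributes its coded point according to the projected measure.
  have h2 := Measure.ae_ae_of_ae_prod (hg.quasiMeasurePreserving.ae h1)
  filter_upwards [h2] with i hi j hj
  -- The line depends only on the future, so the result passes to every word j with that future.
  have hL : ∀ b, Submodule.span ℝ {u (glue (i, b))} = Submodule.span ℝ {u j} := fun b =>
    span_eq_of_cross_eq_zero (h.norm_u j)
      (fun h0 => by have := h.norm_u (glue (i, b)); rw [h0] at this; simp at this)
      (h.cross_eq_zero_of_future fun k => by rw [glue_natCast, hj])
  have hprob := isProbabilityMeasure_codedMeasure (κ := κ) (t := t) h.contr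
  have : IsProbabilityMeasure (transversalMeasure (codedMeasure κ A t) (Submodule.span ℝ {u j})) :=
    Measure.isProbabilityMeasure_map (ContinuousLinearMap.measurable _).aemeasurable
  refine dimHMeasure_eq_of_hasLocalDim ?_
  have hms := measurableSet_hasLocalDim
    (μ := transversalMeasure (codedMeasure κ A t) (Submodule.span ℝ {u j}))
    (β / transExponent κ A u)
  conv in ae _ => rw [transversalMeasure]
  rw [ae_map_iff (ContinuousLinearMap.measurable _).aemeasurable hms]
  conv in ae _ => rw [codedMeasure]
  refine (ae_map_iff (measurable_natProj h.contr).aemeasurable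
    (ContinuousLinearMap.measurable _ hms)).2 ?_
  filter_upwards [hi] with b hb
  simp only [hL b, pastPoint, past_glue] at hb
  exact hb

end SplitVectors

end Asymptotics

end SelfAffine

end

noncomputable section

namespace SelfAffine

/-! ### The local dimension of the self-affine measure -/

section BallEstimates

variable {N : ℕ} {A : Fin N → Matrix (Fin 2) (Fin 2) ℝ} {t : Fin N → Plane}
  {u v : (ℤ → Fin N) → Plane} {κ : Measure (Fin N)}

lemma codedMeasure_closedBall (hcontr : ∀ i, ‖act (A i)‖ < 1) (x : Plane) (r : ℝ) :
    (codedMeasure κ A t).real (Metric.closedBall x r) =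
      (Measure.infinitePi fun _ : ℕ => κ).real {a | ‖natProj A t a - x‖ ≤ r} := by
  rw [codedMeasure, measureReal_def, Measure.map_apply (measurable_natProj hcontr)
    Metric.isClosed_closedBall.measurableSet, measureReal_def]
  simp only [Metric.closedBall, dist_eq_norm]
  rfl

variable [IsProbabilityMeasure κ]

lemma codedMeasure_eq_map_pastPoint (hcontr : ∀ i, ‖act (A i)‖ < 1) :
    codedMeasure κ A t = (Measure.infinitePi fun _ : ℤ => κ).map (pastPoint A t) := by
  rw [codedMeasure, ← (measurePreserving_past κ).map_eq,
    Measure.map_map (measurable_natProj hcontr) (measurePreserving_past κ).measurable]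
  rfl

namespace SplitVectors

lemma strongNorm_backward_antitone (h : SplitVectors A u v) (j : ℤ → Fin N) :
    Antitone fun n : ℕ => strongNorm A u n (shiftBy (-n) j) := by
  intro k n hkn
  obtain ⟨d, rfl⟩ := Nat.exists_eq_add_of_le hkn
  have e : (d : ℤ) + -((k + d : ℕ) : ℤ) = -k := by push_cast; ring
  have h1 := h.strongNorm_add d k (shiftBy (-((k + d : ℕ) : ℤ)) j)
  rw [shiftBy_shiftBy, e, add_comm d k] at h1
  simp only
  rw [h1]
  exact mul_le_of_le_one_right (h.strongNorm_pos _ _).le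
    ((h.strongNorm_le_norm _ _).trans (h.norm_cocycle_le_one _ _))

lemma tendsto_strongNorm_backward (h : SplitVectors A u v) (j : ℤ → Fin N) :
    Tendsto (fun n : ℕ => strongNorm A u n (shiftBy (-n) j)) atTop (𝓝 0) := by
  obtain ⟨ρ, hρ0, hρ1, hρ⟩ := exists_contraction_bound h.contr
  exact squeeze_zero (fun n => (h.strongNorm_pos _ _).le)
    (fun n => (h.strongNorm_le_norm _ _).trans (norm_cocycle_le hρ _ _))
    (tendsto_pow_atTop_nhds_zero_of_lt_one hρ0.le hρ1)

/-- Small balls are contained in a single cylinder, hence in a strip of that cylinder. -/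
lemma exists_measure_closedBall_le (h : SplitVectors A u v) {η : ℝ} (hη : 0 < η)
    (hsep : ∀ a b : ℕ → Fin N, a 0 ≠ b 0 → η ≤ ‖natProj A t a - natProj A t b‖) :
    ∃ c : ℝ, 0 < c ∧ ∀ (j : ℤ → Fin N) (n : ℕ) (r : ℝ),
      c * strongNorm A u n (shiftBy (-n) j) ≤ transNorm A u n (shiftBy (-n) j) * r →
      (codedMeasure κ A t).real
        (Metric.closedBall (pastPoint A t j) (c * strongNorm A u n (shiftBy (-n) j))) ≤
      (∏ k ∈ Finset.range n, κ.real {past j k}) * stripMass κ A t u (shiftBy (-n) j) r := by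
  obtain ⟨C, hC, hle⟩ := h.exists_strongNorm_mul_le
  -- C measures how much more than the strong norm a vector can be contracted, and the factor 2
  -- makes the separation estimate below strict.
  refine ⟨η / (2 * C), by positivity, fun j n r hr => ?_⟩
  rw [← h.measure_cylinder_strip, codedMeasure_closedBall h.contr]
  refine measureReal_mono fun a ha => ⟨fun k => ?_, ?_⟩
  · induction k using Nat.strong_induction_on with
    | _ k ih =>
      intro hkn
      by_contra hne
      -- At a first disagreement k < n the two points differ by the image of a vector of length at
      -- least η. This is at least twice the admissible radius, because the strong norms decrease
      -- along the past.
      have h1 := natProj_sub_pastPoint (t := t) h.contr j a k fun m hm => ih m hm (hm.trans hkn)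
      have h2 := hle k (shiftBy (-k) j)
        (natProj A t (dropWord k a) - pastPoint A t (shiftBy (-k) j))
      rw [← h1] at h2
      have h3 : η ≤ ‖natProj A t (dropWord k a) - pastPoint A t (shiftBy (-k) j)‖ := by
        refine hsep _ _ ?_
        rw [past_shiftBy]
        simpa [dropWord] using hne
      have h4 : ‖natProj A t a - pastPoint A t j‖ ≤
          η / (2 * C) * strongNorm A u k (shiftBy (-k) j) :=
        le_trans ha (mul_le_mul_of_nonneg_left (h.strongNorm_backward_antitone j hkn.le)
          (by positivity))
      have h5 := h.strongNorm_pos k (shiftBy (-k) j)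
      have h6 : strongNorm A u k (shiftBy (-k) j) * η ≤
          C * (η / (2 * C) * strongNorm A u k (shiftBy (-k) j)) :=
        (mul_le_mul_of_nonneg_left h3 h5.le).trans (h2.trans (by gcongr))
      have h7 : C * (η / (2 * C) * strongNorm A u k (shiftBy (-k) j)) =
          strongNorm A u k (shiftBy (-k) j) * η / 2 := by field_simp
      have h8 := mul_pos h5 hη
      linarith
  · refine le_trans ?_ hr
    refine (abs_cross_le _ _).trans ?_
    rw [h.norm_u, mul_one]
    exact ha

/-- Balls contain strips of cylinders. -/
lemma exists_le_measure_closedBall (h : SplitVectors A u v) {r₀ : ℝ}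
    (hr₀ : ∀ a b, ‖natProj A t a - natProj A t b‖ ≤ r₀) :
    ∃ C : ℝ, 0 < C ∧ ∀ (j : ℤ → Fin N) (n : ℕ) (r : ℝ),
      transNorm A u n (shiftBy (-n) j) * r ≤ strongNorm A u n (shiftBy (-n) j) →
      (∏ k ∈ Finset.range n, κ.real {past j k}) * stripMass κ A t u (shiftBy (-n) j) r ≤
      (codedMeasure κ A t).real
        (Metric.closedBall (pastPoint A t j) (C * strongNorm A u n (shiftBy (-n) j))) := by
  obtain ⟨C, hC, hle⟩ := h.exists_norm_act_le
  -- The part |r₀| covers the extent of the attractor along the strong stable direction, and the 1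
  -- covers the transversal width, bounded by the strong norm.
  refine ⟨C * (|r₀| + 1), by positivity, fun j n r hr => ?_⟩
  rw [← h.measure_cylinder_strip, codedMeasure_closedBall h.contr]
  refine measureReal_mono ?_
  rintro a ⟨ha, hs⟩
  have h1 := (h.cylinder_strip j n r a ha).1 hs
  have h2 := hle n (shiftBy (-n) j) (natProj A t (dropWord n a) - pastPoint A t (shiftBy (-n) j))
  rw [← natProj_sub_pastPoint h.contr j a n ha] at h2
  have h3 : ‖natProj A t (dropWord n a) - pastPoint A t (shiftBy (-n) j)‖ ≤ |r₀| :=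
    (hr₀ _ _).trans (le_abs_self _)
  have hs := h.strongNorm_pos n (shiftBy (-n) j)
  have ht := h.transNorm_pos n (shiftBy (-n) j)
  refine h2.trans ?_
  rw [mul_assoc]
  refine mul_le_mul_of_nonneg_left ?_ (by linarith)
  rw [add_mul, one_mul]
  refine add_le_add (mul_le_mul_of_nonneg_right h3 hs.le) (le_trans ?_ hr)
  rw [mul_comm]
  exact mul_le_mul_of_nonneg_left h1 ht.le

/-- The two ball estimates at radius about the strong norm of depth n meet the strip asymptotics at
depth m. The scales τ and ς are minus the logarithms of the strong norms and of the strip radii. -/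
lemma hasLocalDim_codedMeasure (h : SplitVectors A u v) {r₀ β η : ℝ} (hr0 : 0 < r₀)
    (hr : ∀ a b, ‖natProj A t a - natProj A t b‖ ≤ r₀) (hη : 0 < η)
    (hsep : ∀ a b : ℕ → Fin N, a 0 ≠ b 0 → η ≤ ‖natProj A t a - natProj A t b‖)
    (hβ : ∀ᵐ j ∂(Measure.infinitePi fun _ : ℤ => κ), ∃ b E, StripAsymptotics κ A t u r₀ β j b E) :
    ∀ᵐ z ∂(codedMeasure κ A t), HasLocalDim (codedMeasure κ A t) z
      (symbolEntropy κ / strongExponent κ A u +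
        (1 - transExponent κ A u / strongExponent κ A u) * (β / transExponent κ A u)) := by
  have hprob := isProbabilityMeasure_codedMeasure (κ := κ) (t := t) h.contr
  have hms := measurableSet_hasLocalDim (μ := codedMeasure κ A t)
    (symbolEntropy κ / strongExponent κ A u +
      (1 - transExponent κ A u / strongExponent κ A u) * (β / transExponent κ A u))
  conv in ae _ => rw [codedMeasure_eq_map_pastPoint h.contr]
  refine (ae_map_iff (measurable_pastPoint h.contr).aemeasurable hms).2 ?_
  obtain ⟨c, hc, hupper⟩ := h.exists_measure_closedBall_le (κ := κ) hη hsep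
  obtain ⟨C, hC, hlower⟩ := h.exists_le_measure_closedBall (κ := κ) hr
  filter_upwards [hβ, h.ae_tendsto_neg_log_stripRadius (κ := κ) hr0, ae_symbol_pos κ,
    h.ae_tendsto_log_strongNorm_backward (κ := κ), ae_tendsto_pastInformation κ] with j
    ⟨b, E, hb⟩ hς hj hτ hP
  have hprod : ∀ n : ℕ, 0 < ∏ k ∈ Finset.range n, κ.real {past j k} := fun n =>
    Finset.prod_pos fun k _ => hj _
  have hT : ∀ n : ℕ, ∀ k, 0 < κ.real {shiftBy (-(n : ℤ)) j k} := fun n k => hj _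
  have hballs : ∀ r : ℝ, 0 < r →
      0 < (codedMeasure κ A t).real (Metric.closedBall (pastPoint A t j) r) := by
    intro r hr'
    have h1 := (h.tendsto_strongNorm_backward j).const_mul C
    rw [mul_zero] at h1
    obtain ⟨n, hn⟩ := (h1.eventually_lt_const hr').exists
    have hs := h.strongNorm_pos n (shiftBy (-n) j)
    have ht := h.transNorm_pos n (shiftBy (-n) j)
    -- The largest half-width allowed in the lower estimate, namely the strong norm over the
    -- transversal norm.
    refine lt_of_lt_of_le ?_ ((hlower j n (strongNorm A u n (shiftBy (-n) j) /
      transNorm A u n (shiftBy (-n) j)) (mul_div_cancel₀ _ ht.ne').le).trans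
      (measureReal_mono (Metric.closedBall_subset_closedBall hn.le)))
    exact mul_pos (hprod n) (h.stripMass_pos hr0 hr (hT n) (div_pos hs ht))
  have hballs' : ∀ n : ℕ, 0 < (codedMeasure κ A t).real
      (Metric.closedBall (pastPoint A t j) (Real.exp (-n))) := fun n => hballs _ (Real.exp_pos _)
  have hτ' : Tendsto (fun n : ℕ => -Real.log (strongNorm A u n (shiftBy (-n) j)) / n) atTop
      (𝓝 (strongExponent κ A u)) := by
    have := hτ.neg
    rw [neg_neg] at this
    exact this.congr fun n => (neg_div _ _).symm
  have hmass : ∀ n m : ℕ, 0 < stripMass κ A t u (shiftBy (-n) j)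
      (stripRadius A u r₀ (m - n) (shiftBy (-n) j)) := fun n m =>
    h.stripMass_radius_pos hr _ (hT n)
  have hlog : ∀ n m : ℕ, -Real.log ((∏ k ∈ Finset.range n, κ.real {past j k}) *
      stripMass κ A t u (shiftBy (-n) j) (stripRadius A u r₀ (m - n) (shiftBy (-n) j))) =
      pastInformation κ j n + -Real.log (stripMass κ A t u (shiftBy (-n) j)
        (stripRadius A u r₀ (m - n) (shiftBy (-n) j))) := by
    intro n m
    have hlogprod : Real.log (∏ k ∈ Finset.range n, κ.real {past j k}) =
        ∑ k ∈ Finset.range n, Real.log (κ.real {past j k}) :=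
      Real.log_prod fun k _ => (hj (-1 - k)).ne'
    rw [Real.log_mul (hprod n).ne' (hmass n m).ne', hlogprod, pastInformation]
    ring
  -- A strip of depth m - n at the word shifted by -n renormalises to one of depth m at j, so the
  -- condition on its width compares the strip radius of depth m with the strong norm of depth n.
  have hrad : ∀ n m : ℕ, n ≤ m → transNorm A u n (shiftBy (-n) j) *
      stripRadius A u r₀ (m - n) (shiftBy (-n) j) = stripRadius A u r₀ m j := by
    intro n m hnm
    rw [← h.stripRadius_add, Nat.sub_add_cancel hnm]
  have hexp : ∀ (n : ℕ) (d : ℝ), 0 < d →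
      Real.exp (-(-Real.log (strongNorm A u n (shiftBy (-n) j)) + -Real.log d)) =
        d * strongNorm A u n (shiftBy (-n) j) := by
    intro n d hd
    rw [neg_add, neg_neg, neg_neg, Real.exp_add, Real.exp_log hd,
      Real.exp_log (h.strongNorm_pos _ _), mul_comm]
  refine hasLocalDim_of_tendsto hballs' (tendsto_div_of_two_scales (logBall_mono hballs')
    h.transExponent_pos h.transExponent_lt_strongExponent hτ' hς hP hb.tendsto_main
    hb.tendsto_error (c₁ := -Real.log c) (c₂ := -Real.log C) ?_ ?_)
  · intro n m hnm hle
    have h1 : c * strongNorm A u n (shiftBy (-n) j) ≤ stripRadius A u r₀ m j := by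
      rw [← hexp n c hc, ← Real.le_log_iff_exp_le (h.stripRadius_pos hr0 m j)]
      linarith
    rw [← hrad n m hnm] at h1
    have h2 := hupper j n _ h1
    have h3 := Real.log_le_log (hballs _ (mul_pos hc (h.strongNorm_pos _ _))) h2
    have h4 := hlog n m
    have h5 := abs_le.1 (hb.abs_sub_le n m hnm)
    rw [logBall, hexp n c hc]
    linarith [h5.1]
  · intro n m hnm hle
    have h1 : stripRadius A u r₀ m j ≤ strongNorm A u n (shiftBy (-n) j) :=
      (Real.log_le_log_iff (h.stripRadius_pos hr0 m j) (h.strongNorm_pos _ _)).1 (by linarith)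
    rw [← hrad n m hnm] at h1
    have h2 := hlower j n _ h1
    have h3 := Real.log_le_log (mul_pos (hprod n) (hmass n m)) h2
    have h4 := hlog n m
    have h5 := abs_le.1 (hb.abs_sub_le n m hnm)
    rw [logBall, hexp n C hC]
    linarith [h5.2]

/-- The local dimension of the self-affine measure and the dimension of the transversal measures. -/
lemma exists_dimension_formula (h : SplitVectors A u v) (hsep : StrongSeparation A t) :
    ∃ d : ℝ, 0 ≤ d ∧
      (∀ᵐ z ∂(codedMeasure κ A t), HasLocalDim (codedMeasure κ A t) z
        (symbolEntropy κ / strongExponent κ A u +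
          (1 - transExponent κ A u / strongExponent κ A u) * d)) ∧
      ∀ᵐ i ∂(Measure.infinitePi fun _ : ℕ => κ), ∀ j : ℤ → Fin N, (∀ n : ℕ, j n = i n) →
        dimHMeasure (transversalMeasure (codedMeasure κ A t) (Submodule.span ℝ {u j})) =
          ENNReal.ofReal d := by
  obtain ⟨⟨r₀, hr0, hr⟩, η, hη, hη'⟩ := hsep.exists_bounds h.contr
  have hr0' : 0 < r₀ := one_pos.trans_le hr0
  obtain ⟨β, hβ⟩ := h.exists_stripAsymptotics (κ := κ) hr0' hr
  refine ⟨β / transExponent κ A u, ?_, h.hasLocalDim_codedMeasure hr0' hr hη hη' hβ,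
    h.ae_dimHMeasure_transversal hr0' hr hβ⟩
  have hprob := isProbabilityMeasure_codedMeasure (κ := κ) (t := t) h.contr
  obtain ⟨j, hj⟩ := (h.hasLocalDim_transversal hr0' hr hβ).exists
  have : IsProbabilityMeasure (transversalMeasure (codedMeasure κ A t) (Submodule.span ℝ {u j})) :=
    Measure.isProbabilityMeasure_map (ContinuousLinearMap.measurable _).aemeasurable
  exact hj.nonneg

end SplitVectors

end BallEstimates

end SelfAffine

end

/-! ### Assembly of the theorem. -/

theorem theorem2p6 {N : ℕ} (A : Fin N → Matrix (Fin 2) (Fin 2) ℝ) (t : Fin N → Plane)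
    (p : Fin N → ℝ)
    (hdet : ∀ i, (A i).det ≠ 0)
    (hcontr : ∀ i, ‖act (A i)‖ < 1)
    (hp : ∀ i, 0 ≤ p i) (hp1 : ∑ i, p i = 1)
    (hdom : DominatedSplitting A)
    (hsep : StrongSeparation A t) :
    IsExactDimensional (selfAffineMeasure A t p) ∧
    (∃ es ess : (ℤ → Fin N) → Submodule ℝ Plane, IsSplitting A es ess) ∧
    ∀ es ess : (ℤ → Fin N) → Submodule ℝ Plane, IsSplitting A es ess →
      ∃ χs χss : ℝ, 0 < χs ∧ χs < χss ∧
        IsLyapunovExponent A p es χs ∧ IsLyapunovExponent A p ess χss ∧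
        ∀ᵐ i ∂(bernoulliMeasure p), ∀ j : ℤ → Fin N, (∀ n : ℕ, j n = i n) →
          dimHMeasure (selfAffineMeasure A t p) =
            ENNReal.ofReal (entropy p / χss) +
              ENNReal.ofReal (1 - χs / χss) *
                dimHMeasure (transversalMeasure (selfAffineMeasure A t p) (ess j)) := by
  have hκ : IsProbabilityMeasure (symbolMeasure p) := isProbabilityMeasure_symbolMeasure hp hp1
  have hμ : IsProbabilityMeasure (selfAffineMeasure A t p) :=
    isProbabilityMeasure_codedMeasure (κ := symbolMeasure p) hcontr
  have hsplit := exists_splitting hdet hdom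
  refine ⟨?_, hsplit, fun es ess hes => ?_⟩
  -- Exact dimensionality does not refer to a splitting, so any existing one serves as a tool.
  · obtain ⟨es, ess, hes⟩ := hsplit
    obtain ⟨u, v, h, -, -⟩ := hes.exists_splitVectors hdet hcontr
    obtain ⟨d, -, hd, -⟩ := h.exists_dimension_formula (κ := symbolMeasure p) hsep
    exact isExactDimensional_of_hasLocalDim hd
  · obtain ⟨u, v, h, hu, hv⟩ := hes.exists_splitVectors hdet hcontr
    obtain ⟨d, hd0, hd, htrans⟩ := h.exists_dimension_formula (κ := symbolMeasure p) hsep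
    have hχ := h.transExponent_pos (κ := symbolMeasure p)
    have hχ' := h.transExponent_lt_strongExponent (κ := symbolMeasure p)
    refine ⟨transExponent (symbolMeasure p) A u, strongExponent (symbolMeasure p) A u, hχ, hχ',
      h.isLyapunovExponent_trans hv, h.isLyapunovExponent_strong hu, ?_⟩
    filter_upwards [htrans] with i hi j hj
    have h1 : dimHMeasure (transversalMeasure (selfAffineMeasure A t p) (ess j)) =
        ENNReal.ofReal d := by
      rw [hu]; exact hi j hj
    have h2 : 0 ≤ entropy p / strongExponent (symbolMeasure p) A u := by
      refine div_nonneg (Finset.sum_nonneg fun i _ => Real.negMulLog_nonneg (hp i) ?_)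
        (hχ.trans hχ').le
      rw [← hp1]
      exact Finset.single_le_sum (fun i _ => hp i) (Finset.mem_univ i)
    have h3 : 0 ≤ 1 - transExponent (symbolMeasure p) A u / strongExponent (symbolMeasure p) A u :=
      sub_nonneg.2 ((div_le_one (hχ.trans hχ')).2 hχ'.le)
    -- Each summand is non-negative, so the formula can be passed between ℝ and the extended
    -- non-negative reals without truncation.
    rw [h1, ← ENNReal.ofReal_mul h3, ← ENNReal.ofReal_add h2 (mul_nonneg h3 hd0),
      ← symbolEntropy_symbolMeasure hp]
    exact dimHMeasure_eq_of_hasLocalDim hd
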